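/- Notation. Let $m,n\ge 1$ be integers. For $f\in C^\infty(\mathbb R^d)$ (complex valued), $r\in\mathbb Z$ and a real $l\ge 0$ put $\mu_{r,l}(f)=\sup_{x\in\mathbb R^d,\,|\alpha|\le l}(1+|x|)^r|\partial^\alpha f(x)|\in[0,\infty]$. Let $\mathcal O_M(\mathbb R^d)$ be the space of $f\in C^\infty(\mathbb R^d)$ such that for every $l\in\mathbb N$ there is $q\in\mathbb N$ with $\mu_{-q,l}(f)<\infty$, with its usual topology, given by the seminorms $f\mapsto\sup_x|\chi(x)\partial^\alpha f(x)|$, $\chi\in\mathcal S(\mathbb R^d)$, $\alpha\in\mathbb N^d$. Nets are indexed by $\varepsilon\in(0,1]$, and $O(\cdot)$ is meant as $\varepsilon\to0$. Let - $\mathcal E_{\mathcal S}(\mathbb R^d)$ (resp. $\mathcal N_{\mathcal S}(\mathbb R^d)$) be the set of nets $(f_\varepsilon)$ in $\mathcal S(\mathbb R^d)$ such that for all $q,l\in\mathbb N$ there is $N\in\mathbb N$ with $\mu_{q,l}(f_\varepsilon)=O(\varepsilon^{-N})$ (resp. for all $q,l,p\in\mathbb N$, $\mu_{q,l}(f_\varepsilon)=O(\varepsilon^p)$),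 and $\mathcal G_{\mathcal S}=\mathcal E_{\mathcal S}/\mathcal N_{\mathcal S}$; - $\mathcal E_\tau(\mathbb R^d)$ (resp. $\mathcal N_\tau(\mathbb R^d)$) be the set of nets $(f_\varepsilon)$ in $\mathcal O_M(\mathbb R^d)$ such that for all $l\in\mathbb N$ there are $q,N\in\mathbb N$ with $\mu_{-q,l}(f_\varepsilon)=O(\varepsilon^{-N})$ (resp. for all $l$ there is $q$ such that $\mu_{-q,l}(f_\varepsilon)=O(\varepsilon^p)$ for all $p\in\mathbb N$), and $\mathcal G_\tau=\mathcal E_\tau/\mathcal N_\tau$; - $\mathcal L_0$ be the set of sequences $q:\mathbb N\to[0,\infty)$ with $q(l)/l\to0$ and, for $a>0$, $\mathcal L_a$ the set of those with $\limsup_{l\to\infty}q(l)/l<a$; - $\mathcal G_{\mathcal S}^{\mathcal L_a}(\mathbb R^d)$ be the set of classes in $\mathcal G_{\mathcal S}(\mathbb R^d)$ of nets $(f_\varepsilon)$ for which there is $N\in\mathcal L_a$ with $\mu_{q,l}(f_\varepsilon)=O(\varepsilon^{-N(l)})$ for all $q,l\in\mathbb N$. A net of continuous linear maps $L_\varepsilon:\mathcal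 S(\mathbb R^n)\to\mathcal O_M(\mathbb R^m)$ is moderate if for every $l\in\mathbb N$ there are $C_\varepsilon\ge0$ with $C_\varepsilon=O(\varepsilon^{-N})$ for some $N$, and $p,q,l'\in\mathbb N$, such that, for $\varepsilon$ small enough, $\mu_{-p,l}(L_\varepsilon f)\le C_\varepsilon\,\mu_{q,l'}(f)$ for all $f\in\mathcal S(\mathbb R^n)$. Given sets $A,B$ of sequences $\mathbb N\to[0,\infty)$, it is strongly moderate over $(A,B)$ if there are $\lambda\in A$ and $r\in B$ such that for every $l\in\mathbb N$ there are $C\ge 0$ and $p,q\in\mathbb N$ such that, for $\varepsilon$ small enough, $\mu_{-p,l}(L_\varepsilon f)\le C\varepsilon^{-r(l)}\mu_{q,\lambda(l)}(f)$ for all $f\in\mathcal S(\mathbb R^n)$; it is $\mathcal L_{b,c}$-strongly moderate if this holds with $A=\mathcal L_b$, $B=\mathcal L_c$. A moderate net has the extension $L:\mathcal G_{\mathcal S}(\mathbb R^n)\to\mathcal G_\tau(\mathbb R^m)$, $[(f_\varepsilon)]\mapsto[(L_\varepsilon f_\varepsilon)]$. For $H\in\mathcal G_\tau(\mathbb R^{m+n})$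 and $f\in\mathcal G_{\mathcal S}(\mathbb R^n)$, $\widetilde H(f)\in\mathcal G_\tau(\mathbb R^m)$ denotes the class of $\bigl(x\mapsto\int H_\varepsilon(x,y)f_\varepsilon(y)\,dy\bigr)_\varepsilon$, for any representatives $(H_\varepsilon)$, $(f_\varepsilon)$. We say that $H$ is a kernel of $L$ on $\mathcal G_{\mathcal S}^{\mathcal L_a}$ if $L(f)=\widetilde H(f)$ for all $f\in\mathcal G_{\mathcal S}^{\mathcal L_a}(\mathbb R^n)$. Proposition. Let $\Lambda:\mathcal S(\mathbb R^n)\to\mathcal S'(\mathbb R^m)$ be linear and continuous, let $\varphi\in\mathcal S(\mathbb R^m)$ satisfy $\int\varphi=1$ and $\int x^\alpha\varphi(x)\,dx=0$ for all $\alpha\in\mathbb N^m\setminus\{0\}$, let $\varphi_\delta(x)=\delta^{-m}\varphi(x/\delta)$ for $\delta>0$, let $0<s<1$, and put $L_\varepsilon f=\Lambda(f)*\varphi_{\varepsilon^s}$, i.e. $(L_\varepsilon f)(x)=\langle\Lambda(f),\varphi_{\varepsilon^s}(x-\cdot)\rangle$. (i) Each $L_\varepsilon$ maps $\mathcal S(\mathbb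 R^n)$ into $\mathcal O_M(\mathbb R^m)$ and is linear and continuous. The net $(L_\varepsilon)$ is strongly moderate over $(\mathcal L_0,\{r:\limsup_{l\to\infty} r(l)/l\le s\})$; in particular it is $\mathcal L_{0,c}$-strongly moderate for every $c>s$. (ii) The net $(L_\varepsilon)$ is moderate, and there is $H_L\in\mathcal G_\tau(\mathbb R^{m+n})$ which is a kernel of its extension $L$ on $\mathcal G_{\mathcal S}^{\mathcal L_a}$ for every $a\in[0,1]$. Furthermore, if $H\in\mathcal G_\tau(\mathbb R^{m+n})$ is a kernel of $L$ on $\mathcal G_{\mathcal S}^{\mathcal L_a}$ for some $a\in[0,1]$ (for instance $H=H_L$), then for every $f\in\mathcal S(\mathbb R^n)$, $\Lambda(f)$ and $\widetilde H(f)$ are equal in the generalized distribution sense: for every representative $(H_\varepsilon)$ of $H$, all $g\in\mathcal S(\mathbb R^m)$ and all $p\in\mathbb N$, $$\langle\Lambda(f),g\rangle-\int\Bigl(\int H_\varepsilon(x,y)f(y)\,dy\Bigr)g(x)\,dx=O(\varepsilon^p)\quad\text{as }\varepsilon\to0.$$ -/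

import Mathlib

open MeasureTheory Filter
open scoped SchwartzMap NNReal ENNReal Topology ContDiff

noncomputable section

namespace Colombeau

/-- The Euclidean space whose coordinates are indexed by `ι`.
`ℝᵐ⁺ⁿ` is realised as `Euc (Fin m ⊕ Fin n)`. -/
abbrev Euc (ι : Type) : Type := EuclideanSpace ℝ ι

/-- The point `(x, y)` of `ℝᵐ⁺ⁿ`. -/
def pair {m n : ℕ} (x : Euc (Fin m)) (y : Euc (Fin n)) : Euc (Fin m ⊕ Fin n) :=
  WithLp.toLp 2 (Sum.elim (fun i => x i) (fun j => y j))

section Seminorms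

variable {ι : Type} [Fintype ι]

/-- The partial derivative `∂_{w 0} ⋯ ∂_{w (k-1)} f (x)`. For smooth `f`, the partial derivatives
`∂^α f` with `|α| = k` are exactly these, with `w` running over the words of length `k`. -/
def partialD {k : ℕ} (w : Fin k → ι) (f : Euc ι → ℂ) (x : Euc ι) : ℂ :=
  letI := Classical.decEq ι
  iteratedFDeriv ℝ k f x (fun j => EuclideanSpace.single (w j) (1 : ℝ))

/-- `μ_{r,l}(f) = sup_{x, |α| ≤ l} (1 + |x|)^r |∂^α f(x)|`, with values in `[0, ∞]`.
The bound `l` on the order may be any nonnegative real. -/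
def mu (r : ℤ) (l : ℝ≥0) (f : Euc ι → ℂ) : ℝ≥0∞ :=
  ⨆ (k : ℕ) (_ : (k : ℝ≥0) ≤ l) (w : Fin k → ι) (x : Euc ι),
    ENNReal.ofReal ((1 + ‖x‖) ^ r) * ‖partialD w f x‖ₑ

lemma le_mu (r : ℤ) {l : ℝ≥0} (f : Euc ι → ℂ) {k : ℕ} (hk : (k : ℝ≥0) ≤ l) (w : Fin k → ι)
    (x : Euc ι) : ENNReal.ofReal ((1 + ‖x‖) ^ r) * ‖partialD w f x‖ₑ ≤ mu r l f :=
  le_iSup₂_of_le k hk (le_iSup₂_of_le w x le_rfl)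

lemma mu_le {r : ℤ} {l : ℝ≥0} {f : Euc ι → ℂ} {B : ℝ≥0∞}
    (h : ∀ (k : ℕ), (k : ℝ≥0) ≤ l → ∀ (w : Fin k → ι) (x : Euc ι),
      ENNReal.ofReal ((1 + ‖x‖) ^ r) * ‖partialD w f x‖ₑ ≤ B) : mu r l f ≤ B :=
  iSup₂_le fun k hk => iSup₂_le fun w x => h k hk w x

lemma partialD_add {k : ℕ} (w : Fin k → ι) {f g : Euc ι → ℂ} (hf : ContDiff ℝ ∞ f)
    (hg : ContDiff ℝ ∞ g) (x : Euc ι) :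
    partialD w (f + g) x = partialD w f x + partialD w g x := by
  unfold partialD
  rw [iteratedFDeriv_add_apply (hf.contDiffAt.of_le (by exact_mod_cast le_top))
    (hg.contDiffAt.of_le (by exact_mod_cast le_top))]
  rfl

lemma partialD_smul {k : ℕ} (w : Fin k → ι) (c : ℂ) {f : Euc ι → ℂ} (hf : ContDiff ℝ ∞ f)
    (x : Euc ι) : partialD w (c • f) x = c * partialD w f x := by
  unfold partialD
  rw [iteratedFDeriv_const_smul_apply (hf.contDiffAt.of_le (by exact_mod_cast le_top))]
  rfl

lemma mu_add_le (r : ℤ) (l : ℝ≥0) {f g : Euc ι → ℂ} (hf : ContDiff ℝ ∞ f)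
    (hg : ContDiff ℝ ∞ g) : mu r l (f + g) ≤ mu r l f + mu r l g := by
  refine mu_le fun k hk w x => ?_
  rw [partialD_add w hf hg]
  calc _ ≤ ENNReal.ofReal ((1 + ‖x‖) ^ r) * (‖partialD w f x‖ₑ + ‖partialD w g x‖ₑ) := by
        gcongr; exact enorm_add_le _ _
    _ ≤ _ := by rw [mul_add]; exact add_le_add (le_mu r f hk w x) (le_mu r g hk w x)

lemma mu_smul_le (r : ℤ) (l : ℝ≥0) (c : ℂ) {f : Euc ι → ℂ} (hf : ContDiff ℝ ∞ f) :
    mu r l (c • f) ≤ ‖c‖₊ * mu r l f := by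
  refine mu_le fun k hk w x => ?_
  rw [partialD_smul w c hf, enorm_mul, mul_left_comm]
  exact mul_le_mul_right (le_mu r f hk w x) _

lemma mu_zero (r : ℤ) (l : ℝ≥0) : mu r l (0 : Euc ι → ℂ) = 0 := by
  refine le_antisymm (mu_le fun k _ w x => ?_) zero_le
  have : (iteratedFDeriv ℝ k (0 : Euc ι → ℂ) x) = 0 := by simp
  simp [partialD, this]

lemma mu_mono {r r' : ℤ} (h : r ≤ r') (l : ℝ≥0) (f : Euc ι → ℂ) : mu r l f ≤ mu r' l f := by
  refine mu_le fun k hk w x => le_trans ?_ (le_mu r' f hk w x)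
  gcongr
  linarith [norm_nonneg x]

end Seminorms

section Nets

/-- The index set `(0, 1]` of the nets. -/
abbrev Param : Type := Set.Ioc (0 : ℝ) 1

/-- The filter `ε → 0` on `(0, 1]`. -/
def toZero : Filter Param := comap (fun ε : Param => (ε : ℝ)) (𝓝 0)

/-- `a_ε = O(ε^t)` as `ε → 0`, for a net with values in `[0, ∞]`. -/
def BigO (a : Param → ℝ≥0∞) (t : ℝ) : Prop :=
  ∃ C : ℝ≥0, ∀ᶠ ε in toZero, a ε ≤ C * ENNReal.ofReal ((ε : ℝ) ^ t)

lemma BigO.mono {a b : Param → ℝ≥0∞} {t t' : ℝ} (h : BigO b t') (ht : t ≤ t')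
    (hab : ∀ᶠ ε in toZero, a ε ≤ b ε) : BigO a t := by
  obtain ⟨C, hC⟩ := h
  refine ⟨C, ?_⟩
  filter_upwards [hC, hab] with ε h1 h2
  refine h2.trans (h1.trans ?_)
  exact mul_le_mul_right
    (ENNReal.ofReal_le_ofReal (Real.rpow_le_rpow_of_exponent_ge ε.2.1 ε.2.2 ht)) _

lemma BigO.add {a b : Param → ℝ≥0∞} {t : ℝ} (ha : BigO a t) (hb : BigO b t) :
    BigO (fun ε => a ε + b ε) t := by
  obtain ⟨C, hC⟩ := ha
  obtain ⟨D, hD⟩ := hb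
  refine ⟨C + D, ?_⟩
  filter_upwards [hC, hD] with ε h1 h2
  rw [ENNReal.coe_add, add_mul]
  exact add_le_add h1 h2

lemma BigO.mul {a b : Param → ℝ≥0∞} {t t' : ℝ} (ha : BigO a t) (hb : BigO b t') :
    BigO (fun ε => a ε * b ε) (t + t') := by
  obtain ⟨C, hC⟩ := ha
  obtain ⟨D, hD⟩ := hb
  refine ⟨C * D, ?_⟩
  filter_upwards [hC, hD] with ε h1 h2
  rw [Real.rpow_add ε.2.1, ENNReal.ofReal_mul (Real.rpow_nonneg ε.2.1.le _), ENNReal.coe_mul,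
    mul_mul_mul_comm]
  exact mul_le_mul' h1 h2

lemma BigO.const_mul {a : Param → ℝ≥0∞} {t : ℝ} (c : ℝ≥0) (ha : BigO a t) :
    BigO (fun ε => c * a ε) t := by
  obtain ⟨C, hC⟩ := ha
  refine ⟨c * C, ?_⟩
  filter_upwards [hC] with ε h1
  rw [ENNReal.coe_mul, mul_assoc]
  exact mul_le_mul_right h1 _

lemma BigO.zero (t : ℝ) : BigO (fun _ => 0) t := ⟨0, by simp⟩

end Nets

section Spaces

variable (ι : Type) [Fintype ι]

/-- The smooth functions with slow growth, as a subspace of the functions `ℝᵈ → ℂ`. -/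
def OMSubmodule : Submodule ℂ (Euc ι → ℂ) where
  carrier := {f | ContDiff ℝ ∞ f ∧ ∀ l : ℕ, ∃ q : ℕ, mu (-(q : ℤ)) l f < ⊤}
  zero_mem' := ⟨contDiff_const, fun l => ⟨0, by rw [mu_zero]; simp⟩⟩
  add_mem' := by
    rintro f g ⟨hf, hf'⟩ ⟨hg, hg'⟩
    refine ⟨hf.add hg, fun l => ?_⟩
    obtain ⟨q, hq⟩ := hf' l
    obtain ⟨q', hq'⟩ := hg' l
    refine ⟨max q q', (mu_add_le _ _ hf hg).trans_lt (ENNReal.add_lt_top.2 ⟨?_, ?_⟩)⟩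
    · exact (mu_mono (by simp) _ _).trans_lt hq
    · exact (mu_mono (by simp) _ _).trans_lt hq'
  smul_mem' := by
    rintro c f ⟨hf, hf'⟩
    refine ⟨hf.const_smul c, fun l => ?_⟩
    obtain ⟨q, hq⟩ := hf' l
    exact ⟨q, (mu_smul_le _ _ c hf).trans_lt (ENNReal.mul_lt_top (by simp) hq)⟩

/-- The space `𝒪_M(ℝᵈ)` of smooth functions with slow growth. It is a type of its own, so that it does
not inherit the topology of pointwise convergence. -/
def OM : Type := OMSubmodule ι

instance : AddCommGroup (OM ι) := inferInstanceAs (AddCommGroup (OMSubmodule ι))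

instance : Module ℂ (OM ι) := inferInstanceAs (Module ℂ (OMSubmodule ι))

instance : CoeFun (OM ι) (fun _ => Euc ι → ℂ) := ⟨fun f => f.1⟩

/-- The usual topology of `𝒪_M(ℝᵈ)`, defined by the seminorms `f ↦ sup_x |χ(x) ∂^α f(x)|` for
`χ ∈ 𝒮(ℝᵈ)` and all multi-indices `α`: the coarsest topology for which all the maps
`f ↦ χ ∂^α f` are continuous into the functions on `ℝᵈ` with uniform convergence. -/
instance OM.topology : TopologicalSpace (OM ι) :=
  ⨅ (χ : 𝓢(Euc ι, ℂ)) (k : ℕ) (w : Fin k → ι),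
    TopologicalSpace.induced
      (fun f : OM ι => UniformFun.ofFun (fun x => χ x * partialD w f x))
      (inferInstance : TopologicalSpace (UniformFun (Euc ι) ℂ))

variable {ι}

/-- The moderate nets of rapidly decreasing functions, `ℰ_𝒮(ℝᵈ)`. -/
def ES (ι : Type) [Fintype ι] : Submodule ℂ (Param → 𝓢(Euc ι, ℂ)) where
  carrier := {f | ∀ q l : ℕ, ∃ N : ℕ, BigO (fun ε => mu q l (f ε)) (-(N : ℝ))}
  zero_mem' := fun q l => ⟨0, (BigO.zero _).mono le_rfl
    (.of_forall fun ε => by simpa using (mu_zero (ι := ι) q l).le)⟩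
  add_mem' := by
    intro f g hf hg q l
    obtain ⟨N, hN⟩ := hf q l
    obtain ⟨N', hN'⟩ := hg q l
    refine ⟨max N N', BigO.mono (BigO.add
      (hN.mono (t := -((max N N' : ℕ) : ℝ)) (by simp) (.of_forall fun _ => le_rfl))
      (hN'.mono (t := -((max N N' : ℕ) : ℝ)) (by simp) (.of_forall fun _ => le_rfl))) le_rfl
      (.of_forall fun ε => mu_add_le _ _ ((f ε).smooth _) ((g ε).smooth _))⟩
  smul_mem' := by
    intro c f hf q l
    obtain ⟨N, hN⟩ := hf q l
    exact ⟨N, (hN.const_mul ‖c‖₊).mono le_rfl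
      (.of_forall fun ε => mu_smul_le _ _ c ((f ε).smooth _))⟩

/-- The negligible nets of rapidly decreasing functions, `𝒩_𝒮(ℝᵈ)`. -/
def NS (ι : Type) [Fintype ι] : Submodule ℂ (Param → 𝓢(Euc ι, ℂ)) where
  carrier := {f | ∀ q l p : ℕ, BigO (fun ε => mu q l (f ε)) p}
  zero_mem' := fun q l p => (BigO.zero _).mono le_rfl
    (.of_forall fun ε => by simpa using (mu_zero (ι := ι) q l).le)
  add_mem' := fun {f g} hf hg q l p => BigO.mono ((hf q l p).add (hg q l p)) le_rfl
      (.of_forall fun ε => mu_add_le _ _ ((f ε).smooth _) ((g ε).smooth _))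
  smul_mem' := fun c f hf q l p => ((hf q l p).const_mul ‖c‖₊).mono le_rfl
      (.of_forall fun ε => mu_smul_le _ _ c ((f ε).smooth _))

/-- The moderate nets of functions with slow growth, `ℰ_τ(ℝᵈ)`. -/
def Etau (ι : Type) [Fintype ι] : Submodule ℂ (Param → OM ι) where
  carrier := {f | ∀ l : ℕ, ∃ q N : ℕ,
    BigO (fun ε => mu (-(q : ℤ)) l (f ε)) (-(N : ℝ))}
  zero_mem' := fun l => ⟨0, 0, (BigO.zero _).mono le_rfl
    (.of_forall fun ε => (mu_zero (ι := ι) _ _).le)⟩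
  add_mem' := by
    intro f g hf hg l
    obtain ⟨q, N, hN⟩ := hf l
    obtain ⟨q', N', hN'⟩ := hg l
    refine ⟨max q q', max N N', BigO.mono (BigO.add
      (hN.mono (t := -((max N N' : ℕ) : ℝ)) (by simp)
        (.of_forall fun _ => mu_mono (r := -((max q q' : ℕ) : ℤ)) (by simp) _ _))
      (hN'.mono (t := -((max N N' : ℕ) : ℝ)) (by simp)
        (.of_forall fun _ => mu_mono (r := -((max q q' : ℕ) : ℤ)) (by simp) _ _))) le_rfl
      (.of_forall fun ε => mu_add_le _ _ (f ε).2.1 (g ε).2.1)⟩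
  smul_mem' := by
    intro c f hf l
    obtain ⟨q, N, hN⟩ := hf l
    exact ⟨q, N, (hN.const_mul ‖c‖₊).mono le_rfl
      (.of_forall fun ε => mu_smul_le _ _ c (f ε).2.1)⟩

/-- The negligible nets of functions with slow growth, `𝒩_τ(ℝᵈ)`. -/
def Ntau (ι : Type) [Fintype ι] : Submodule ℂ (Param → OM ι) where
  carrier := {f | ∀ l : ℕ, ∃ q : ℕ, ∀ p : ℕ,
    BigO (fun ε => mu (-(q : ℤ)) l (f ε)) p}
  zero_mem' := fun l => ⟨0, fun p => (BigO.zero _).mono le_rfl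
    (.of_forall fun ε => (mu_zero (ι := ι) _ _).le)⟩
  add_mem' := by
    intro f g hf hg l
    obtain ⟨q, hN⟩ := hf l
    obtain ⟨q', hN'⟩ := hg l
    refine ⟨max q q', fun p => BigO.mono (BigO.add
      ((hN p).mono le_rfl
        (.of_forall fun _ => mu_mono (r := -((max q q' : ℕ) : ℤ)) (by simp) _ _))
      ((hN' p).mono le_rfl
        (.of_forall fun _ => mu_mono (r := -((max q q' : ℕ) : ℤ)) (by simp) _ _))) le_rfl
      (.of_forall fun ε => mu_add_le _ _ (f ε).2.1 (g ε).2.1)⟩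
  smul_mem' := by
    intro c f hf l
    obtain ⟨q, hN⟩ := hf l
    exact ⟨q, fun p => ((hN p).const_mul ‖c‖₊).mono le_rfl
      (.of_forall fun ε => mu_smul_le _ _ c (f ε).2.1)⟩

/-- The space `𝒢_𝒮(ℝᵈ) = ℰ_𝒮(ℝᵈ) / 𝒩_𝒮(ℝᵈ)` of rapidly decreasing generalized functions. -/
abbrev GS (ι : Type) [Fintype ι] : Type := ES ι ⧸ (NS ι).submoduleOf (ES ι)

/-- The space `𝒢_τ(ℝᵈ) = ℰ_τ(ℝᵈ) / 𝒩_τ(ℝᵈ)` of tempered generalized functions. -/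
abbrev Gtau (ι : Type) [Fintype ι] : Type := Etau ι ⧸ (Ntau ι).submoduleOf (Etau ι)

/-- The class `[(f_ε)]_𝒮`. -/
abbrev clsS (f : ES ι) : GS ι := Submodule.Quotient.mk f

/-- The class `[(f_ε)]_τ`. -/
abbrev clsTau (f : Etau ι) : Gtau ι := Submodule.Quotient.mk f

/-- The sequences of slow asymptotic growth: `𝓛_0` is the set of the `q : ℕ → ℝ₊` such that
`q(l)/l → 0`, and for `a > 0` (possibly `a = ∞`), `𝓛_a` is the set of the `q : ℕ → ℝ₊` such that
`lim sup q(l)/l < a`. -/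
def slow (a : ℝ≥0∞) : Set (ℕ → ℝ≥0) :=
  {q | (a = 0 ∧ Tendsto (fun l : ℕ => q l / (l : ℝ≥0)) atTop (𝓝 0)) ∨
    (a ≠ 0 ∧ limsup (fun l : ℕ => ((q l / (l : ℝ≥0) : ℝ≥0) : ℝ≥0∞)) atTop < a)}

/-- The set of the `q : ℕ → ℝ₊` such that `lim sup q(l)/l ≤ a`. -/
def slowLE (a : ℝ≥0∞) : Set (ℕ → ℝ≥0) :=
  {q | limsup (fun l : ℕ => ((q l / (l : ℝ≥0) : ℝ≥0) : ℝ≥0∞)) atTop ≤ a}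

/-- The subspace `𝒢_𝒮^{𝓛_a}(ℝᵈ)` of `𝒢_𝒮(ℝᵈ)`: the classes of the nets `(f_ε)` for which there is
`N ∈ 𝓛_a` with `μ_{q,l}(f_ε) = O(ε^{-N(l)})` for all `q` and `l`. -/
def GSslow (ι : Type) [Fintype ι] (a : ℝ≥0∞) : Set (GS ι) :=
  {F | ∃ f : ES ι, clsS f = F ∧
    ∃ N ∈ slow a, ∀ q l : ℕ, BigO (fun ε => mu q l (f.1 ε)) (-(N l : ℝ))}

end Spaces

section Maps

variable {ι κ : Type} [Fintype ι] [Fintype κ]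

/-- Moderate nets of continuous linear maps `𝒮 → 𝒪_M`. -/
def IsModerate (L : Param → 𝓢(Euc κ, ℂ) →L[ℂ] OM ι) : Prop :=
  ∀ l : ℕ, ∃ C : Param → ℝ≥0, (∃ N : ℕ, BigO (fun ε => C ε) (-(N : ℝ))) ∧
    ∃ p q l' : ℕ, ∀ᶠ ε in toZero, ∀ f : 𝓢(Euc κ, ℂ),
      mu (-(p : ℤ)) l (L ε f) ≤ C ε * mu q l' f

/-- Strong moderation of a net of continuous linear maps `𝒮 → 𝒪_M`, where the orders `λ` of
derivation range over `A` and the exponents `r` over `B`. -/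
def IsStronglyModerateOver (A B : Set (ℕ → ℝ≥0)) (L : Param → 𝓢(Euc κ, ℂ) →L[ℂ] OM ι) : Prop :=
  ∃ lam ∈ A, ∃ r ∈ B, ∀ l : ℕ, ∃ C : ℝ≥0, ∃ p q : ℕ, ∀ᶠ ε in toZero, ∀ f : 𝓢(Euc κ, ℂ),
    mu (-(p : ℤ)) l (L ε f) ≤
      C * ENNReal.ofReal ((ε : ℝ) ^ (-(r l : ℝ))) * mu q (lam l) f

/-- `𝓛_{b,c}`-strongly moderate nets. -/
def IsStronglyModerate (b c : ℝ≥0∞) (L : Param → 𝓢(Euc κ, ℂ) →L[ℂ] OM ι) : Prop :=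
  IsStronglyModerateOver (slow b) (slow c) L

/-- The linear map `(f_ε) ↦ (L_ε f_ε)` on nets. -/
def netMap (L : Param → 𝓢(Euc κ, ℂ) →L[ℂ] OM ι) :
    (Param → 𝓢(Euc κ, ℂ)) →ₗ[ℂ] (Param → OM ι) where
  toFun f ε := L ε (f ε)
  map_add' f g := by ext1 ε; exact map_add (L ε) _ _
  map_smul' c f := by ext1 ε; exact map_smul (L ε) _ _

lemma netMap_mem_Etau {L : Param → 𝓢(Euc κ, ℂ) →L[ℂ] OM ι} (hL : IsModerate L)
    (f : Param → 𝓢(Euc κ, ℂ)) (hf : f ∈ ES κ) : netMap L f ∈ Etau ι := by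
  intro l
  obtain ⟨C, ⟨N, hN⟩, p, q, l', h⟩ := hL l
  obtain ⟨N', hN'⟩ := hf q l'
  exact ⟨p, N + N', (hN.mul hN').mono (by push_cast; linarith) (h.mono fun ε hε => hε (f ε))⟩

lemma netMap_mem_Ntau {L : Param → 𝓢(Euc κ, ℂ) →L[ℂ] OM ι} (hL : IsModerate L)
    (f : Param → 𝓢(Euc κ, ℂ)) (hf : f ∈ NS κ) : netMap L f ∈ Ntau ι := by
  intro l
  obtain ⟨C, ⟨N, hN⟩, p, q, l', h⟩ := hL l
  exact ⟨p, fun j => (hN.mul (hf q l' (j + N))).mono (by push_cast; linarith)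
    (h.mono fun ε hε => hε (f ε))⟩

/-- The canonical extension `[(f_ε)]_𝒮 ↦ [(L_ε f_ε)]_τ` of a moderate net of linear maps. -/
def extension (L : Param → 𝓢(Euc κ, ℂ) →L[ℂ] OM ι) (hL : IsModerate L) : GS κ →ₗ[ℂ] Gtau ι :=
  Submodule.mapQ _ _ ((netMap L).restrict (netMap_mem_Etau hL))
    (fun f hf => netMap_mem_Ntau hL f.1 hf)

lemma extension_clsS (L : Param → 𝓢(Euc κ, ℂ) →L[ℂ] OM ι) (hL : IsModerate L) (f : ES κ) :
    extension L hL (clsS f) = clsTau ⟨fun ε => L ε (f.1 ε), netMap_mem_Etau hL f.1 f.2⟩ := rfl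

end Maps

section Kernels

variable {m n : ℕ}

/-- `T` is represented on `𝒢_𝒮^{𝓛_a}(ℝⁿ)` by the kernel `H ∈ 𝒢_τ(ℝᵐ⁺ⁿ)`: for `f` in that subspace,
`T(f) = [(x ↦ ∫ H_ε(x,y) f_ε(y) dy)]_τ` for any representatives of `H` and of `f`
(the net on the right being in `ℰ_τ(ℝᵐ)`). -/
def IsKernelOn (a : ℝ≥0∞) (H : Gtau (Fin m ⊕ Fin n)) (T : GS (Fin n) →ₗ[ℂ] Gtau (Fin m)) : Prop :=
  ∀ f ∈ GSslow (Fin n) a, ∀ Hrep : Etau (Fin m ⊕ Fin n), clsTau Hrep = H →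
    ∀ frep : ES (Fin n), clsS frep = f →
      ∃ u : Etau (Fin m),
        (∀ (ε : Param) (x : Euc (Fin m)), u.1 ε x =
          ∫ y : Euc (Fin n), Hrep.1 ε (pair x y) * frep.1 ε y) ∧
        T f = clsTau u

/-- A distribution `v` and `H̃(f)`, for `H ∈ 𝒢_τ(ℝᵐ⁺ⁿ)` and `f ∈ 𝒮(ℝⁿ)`, are equal in the generalized
distribution sense: for every representative of `H`, every `g ∈ 𝒮(ℝᵐ)` and every `p`,
`⟨v, g⟩ - ∫ (∫ H_ε(x,y) f(y) dy) g(x) dx = O(ε^p)`. -/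
def EqGD (v : 𝓢'(Euc (Fin m), ℂ)) (H : Gtau (Fin m ⊕ Fin n)) (f : 𝓢(Euc (Fin n), ℂ)) : Prop :=
  ∀ Hrep : Etau (Fin m ⊕ Fin n), clsTau Hrep = H → ∀ (g : 𝓢(Euc (Fin m), ℂ)) (p : ℕ),
    (fun ε : Param => v g - ∫ x : Euc (Fin m),
      (∫ y : Euc (Fin n), Hrep.1 ε (pair x y) * f y) * g x)
      =O[toZero] (fun ε : Param => (ε : ℝ) ^ p)

end Kernels

section Regularization

variable {d : ℕ}

/-- `∫ φ = 1` and `∫ x^α φ(x) dx = 0` for every multi-index `α ≠ 0`. -/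
def IsMollifier (φ : 𝓢(Euc (Fin d), ℂ)) : Prop :=
  (∫ x, φ x) = 1 ∧
    ∀ α : Fin d → ℕ, α ≠ 0 → (∫ x : Euc (Fin d), ((∏ i, x i ^ α i : ℝ) : ℂ) * φ x) = 0

/-- `φ_δ(x) = δ^{-d} φ(x/δ)`. -/
def rescale (φ : 𝓢(Euc (Fin d), ℂ)) (δ : ℝ) (hδ : 0 < δ) : 𝓢(Euc (Fin d), ℂ) :=
  ((δ : ℂ) ^ d)⁻¹ • SchwartzMap.compCLMOfContinuousLinearEquiv ℂ
    (ContinuousLinearEquiv.smulLeft (Units.mk0 δ⁻¹ (inv_ne_zero hδ.ne'))) φ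

lemma rescale_apply (φ : 𝓢(Euc (Fin d), ℂ)) (δ : ℝ) (hδ : 0 < δ) (x : Euc (Fin d)) :
    rescale φ δ hδ x = ((δ : ℂ) ^ d)⁻¹ * φ (δ⁻¹ • x) := rfl

/-- The Schwartz function `y ↦ φ(x - y)`. -/
def reflectAt (φ : 𝓢(Euc (Fin d), ℂ)) (x : Euc (Fin d)) : 𝓢(Euc (Fin d), ℂ) :=
  SchwartzMap.compSubConstCLM ℂ x
    (SchwartzMap.compCLMOfContinuousLinearEquiv ℂ (ContinuousLinearEquiv.neg ℝ) φ)

lemma reflectAt_apply (φ : 𝓢(Euc (Fin d), ℂ)) (x y : Euc (Fin d)) :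
    reflectAt φ x y = φ (x - y) := by
  rw [← neg_sub y x]; rfl

/-- The convolution `(u * φ)(x) = ⟨u, φ(x - ·)⟩` of `u ∈ 𝒮'` and `φ ∈ 𝒮`. -/
def conv (u : 𝓢'(Euc (Fin d), ℂ)) (φ : 𝓢(Euc (Fin d), ℂ)) (x : Euc (Fin d)) : ℂ :=
  u (reflectAt φ x)

end Regularization

end Colombeau

end

/-! Everything rests on one estimate, |Λ(f)(g)| ≤ C μ_{q,l}(f) μ_{q',l'}(g) (`exists_joint_bound`):
𝒮 is complete and metrizable, hence a Baire space, so the separately continuous form (f, g) ↦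
Λ(f)(g) is jointly continuous.

Strong moderation. The derivatives of Λ(f) * φ_δ fall on φ_δ (`mu_conv_le`), so the order l needed
on f never changes and λ may be constant. Each derivative of φ_δ costs one power of 1/δ
(`mu_rescale_le`); for δ = ε^s, order k costs ε^{-s(m+l'+k)}, an exponent affine in k with slope s.

The kernel. Λ is mollified in its argument too: choose θ ∈ 𝒮(ℝⁿ) with integral one and all other
moments zero (`exists_momentsVanish`) and put H_ε(x, y) = Λ(θ_ε(y - ·))(φ_{ε^s}(x - ·)), which is
moderate by the joint bound. Taking Λ out of the integral (`functional_reflConv`) turns ∫ H_ε(x, y)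
f(y) dy into L_ε applied to z ↦ ∫ θ_ε(y - z) f(y) dy. The vanishing moments make this function equal
to f up to ε^k, at the price of k derivatives (`exists_mu_reflConv_sub_le`). For a net with growth
exponents N the error of order l is ε^{k-N(k+l)}, and k - N(k+l) becomes as large as desired because
lim sup N(j)/j < 1. This is why θ is scaled by ε and not by ε^s. The error is negligible, and a
moderate net of maps keeps it negligible.

Equality of distributions. Constant nets have growth exponent 0, so any kernel computes L on them.
Testing L_ε f against g moves the mollifier φ_{ε^s} onto g, and the moments of φ give an error
O(ε^{sk}) for every k.

Smoothness and derivative bounds always come from one device: if ∂_i F(a) = F(d_i a) for a family F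
with operators d_i on its parameters, then each F(a) is smooth and its higher derivatives are values
of F at other parameters (`contDiff_of_family`, `partialD_of_family`). -/

noncomputable section

namespace Colombeau

/-! ### Words of operators and orders of derivation -/

section Words

variable {ι : Type}

/-- The vectors of the standard basis. -/
def unitVec (i : ι) : Euc ι :=
  letI := Classical.decEq ι
  EuclideanSpace.single i 1

lemma unitVec_apply_self (i : ι) : unitVec i i = 1 := by
  classical
  simp [unitVec]

lemma unitVec_apply_ne {i j : ι} (h : j ≠ i) : unitVec i j = 0 := by
  classical
  simp [unitVec, h]

/-- Iteration of a family of operators along a word. -/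
def wordOp {A : Type*} (d : ι → A → A) : (k : ℕ) → (Fin k → ι) → A → A
  | 0, _, a => a
  | k + 1, w, a => wordOp d k (Fin.init w) (d (w (Fin.last k)) a)

/-- Each letter raises the order by one, so the lengths add up. The quantity `N` is left general so
that scaling factors can be built into it. -/
lemma le_wordOp {A : Type*} {d : ι → A → A} {N : ℕ → A → ℝ≥0∞}
    (h : ∀ l i a, N l (d i a) ≤ N (l + 1) a) {k : ℕ} (w : Fin k → ι) (l : ℕ) (a : A) :
    N l (wordOp d k w a) ≤ N (l + k) a := by
  induction k generalizing a with
  | zero => exact le_rfl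
  | succ k ih =>
    refine (ih (Fin.init w) _).trans ((h _ _ _).trans ?_)
    rw [add_assoc]

end Words

/-! ### Partial derivatives and families closed under derivation -/

section Partials

variable {ι : Type} [Fintype ι]

lemma norm_unitVec (i : ι) : ‖unitVec i‖ = 1 := by
  classical
  simp [unitVec]

lemma sum_smul_unitVec (x : Euc ι) : ∑ i, x i • unitVec i = x := by
  classical
  ext j
  rw [WithLp.ofLp_sum, Finset.sum_apply, Finset.sum_eq_single j]
  · simp [unitVec_apply_self]
  · intro i _ hi
    simp [unitVec_apply_ne hi.symm]
  · simp

lemma partialD_eq {k : ℕ} (w : Fin k → ι) (f : Euc ι → ℂ) (x : Euc ι) :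
    partialD w f x = iteratedFDeriv ℝ k f x (fun j => unitVec (w j)) := rfl

lemma partialD_zero (w : Fin 0 → ι) (f : Euc ι → ℂ) (x : Euc ι) : partialD w f x = f x := by
  rw [partialD_eq, iteratedFDeriv_zero_apply]

/-- The linear map with prescribed values on the standard basis. -/
def ofPartials {F : Type*} [NormedAddCommGroup F] [NormedSpace ℝ F] (c : ι → F) : Euc ι →L[ℝ] F :=
  ∑ i, (EuclideanSpace.proj i : Euc ι →L[ℝ] ℝ).smulRight (c i)

lemma ofPartials_apply {F : Type*} [NormedAddCommGroup F] [NormedSpace ℝ F] (c : ι → F)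
    (x : Euc ι) : ofPartials c x = ∑ i, x i • c i := by
  simp [ofPartials]

lemma ofPartials_unitVec {F : Type*} [NormedAddCommGroup F] [NormedSpace ℝ F] (c : ι → F)
    (i : ι) : ofPartials c (unitVec i) = c i := by
  rw [ofPartials_apply, Finset.sum_eq_single i]
  · simp [unitVec_apply_self]
  · intro j _ hj
    simp [unitVec_apply_ne hj]
  · simp

lemma ofPartials_apply_unitVec {F : Type*} [NormedAddCommGroup F] [NormedSpace ℝ F]
    (A : Euc ι →L[ℝ] F) : ofPartials (fun i => A (unitVec i)) = A := by
  ext x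
  conv_rhs => rw [← sum_smul_unitVec x]
  simp [ofPartials_apply]

lemma norm_ofPartials_le {F : Type*} [NormedAddCommGroup F] [NormedSpace ℝ F] (c : ι → F) :
    ‖ofPartials c‖ ≤ ∑ i, ‖c i‖ := by
  refine ContinuousLinearMap.opNorm_le_bound _ (by positivity) fun x => ?_
  rw [ofPartials_apply, Finset.sum_mul]
  refine (norm_sum_le _ _).trans (Finset.sum_le_sum fun i _ => ?_)
  rw [norm_smul, mul_comm]
  gcongr
  exact PiLp.norm_apply_le x i

/-- The partial derivative of a function. -/
def pderiv (i : ι) (f : Euc ι → ℂ) (x : Euc ι) : ℂ := fderiv ℝ f x (unitVec i)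

lemma ContDiff.pderiv {f : Euc ι → ℂ} (hf : ContDiff ℝ ∞ f) (i : ι) :
    ContDiff ℝ ∞ (pderiv i f) :=
  (contDiff_infty_iff_fderiv.1 hf).2.clm_apply contDiff_const

lemma hasFDerivAt_ofPartials {f : Euc ι → ℂ} (hf : ContDiff ℝ ∞ f) (x : Euc ι) :
    HasFDerivAt f (ofPartials fun i => pderiv i f x) x := by
  unfold pderiv
  rw [ofPartials_apply_unitVec]
  exact ((contDiff_infty_iff_fderiv.1 hf).1 x).hasFDerivAt

/-- The last letter is the innermost derivative, the same convention as in `wordOp`. -/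
lemma partialD_succ {k : ℕ} (w : Fin (k + 1) → ι) {f : Euc ι → ℂ} (hf : ContDiff ℝ ∞ f)
    (x : Euc ι) : partialD w f x = partialD (Fin.init w) (pderiv (w (Fin.last k)) f) x := by
  rw [partialD_eq, iteratedFDeriv_succ_apply_right, partialD_eq]
  have : pderiv (w (Fin.last k)) f
      = (ContinuousLinearMap.apply ℝ ℂ (unitVec (w (Fin.last k)))) ∘ (fderiv ℝ f) := rfl
  rw [this, ContinuousLinearMap.iteratedFDeriv_comp_left (i := k) _
    ((contDiff_infty_iff_fderiv.1 hf).2.contDiffAt) (by exact_mod_cast le_top)]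
  rfl

lemma mu_pderiv_le (r : ℤ) (l : ℝ≥0) {f : Euc ι → ℂ} (hf : ContDiff ℝ ∞ f) (i : ι) :
    mu r l (pderiv i f) ≤ mu r (l + 1) f := by
  refine mu_le fun k hk w x => ?_
  have h := partialD_succ (Fin.snoc w i : Fin (k + 1) → ι) hf x
  rw [Fin.init_snoc, Fin.snoc_last] at h
  rw [← h]
  exact le_mu r f (by push_cast; gcongr) _ x

lemma mu_mono_order (r : ℤ) {l l' : ℝ≥0} (h : l ≤ l') (f : Euc ι → ℂ) : mu r l f ≤ mu r l' f :=
  mu_le fun _ hk w x => le_mu r f (hk.trans h) w x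

section Family

variable {A : Type*} {d : ι → A → A} {F : A → Euc ι → ℂ}

/-- A family of functions whose partial derivatives belong to the family consists of smooth
functions. -/
lemma contDiff_of_family (h : ∀ a x, HasFDerivAt (F a) (ofPartials fun i => F (d i a) x) x)
    (a : A) : ContDiff ℝ ∞ (F a) := by
  rw [contDiff_infty]
  intro n
  induction n generalizing a with
  | zero =>
    rw [Nat.cast_zero, contDiff_zero]
    exact continuous_iff_continuousAt.2 fun x => (h a x).continuousAt
  | succ n ih =>
    rw [Nat.cast_succ, contDiff_succ_iff_hasFDerivAt]
    refine ⟨_, ?_, h a⟩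
    unfold ofPartials
    refine ContDiff.sum fun i _ => ?_
    exact (ContinuousLinearMap.smulRightL ℝ (Euc ι) ℂ
      (EuclideanSpace.proj i : Euc ι →L[ℝ] ℝ)).contDiff.comp (ih (d i a))

lemma pderiv_of_family (h : ∀ a x, HasFDerivAt (F a) (ofPartials fun i => F (d i a) x) x)
    (a : A) (i : ι) : pderiv i (F a) = F (d i a) := by
  ext x
  rw [pderiv, (h a x).fderiv, ofPartials_unitVec]

/-- Reduces every estimate of order k to one of order zero, at the parameter obtained by applying
the operators along the word. -/
lemma partialD_of_family (h : ∀ a x, HasFDerivAt (F a) (ofPartials fun i => F (d i a) x) x)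
    {k : ℕ} (w : Fin k → ι) (a : A) (x : Euc ι) :
    partialD w (F a) x = F (wordOp d k w a) x := by
  induction k generalizing a with
  | zero => rw [partialD_zero]; rfl
  | succ k ih =>
    rw [partialD_succ w (contDiff_of_family h a), pderiv_of_family h, ih]
    rfl

end Family

/-- Multilinear expansion in the standard basis, each coordinate being at most the norm. It bounds
the usual Schwartz seminorms by the μ's. -/
lemma norm_iteratedFDeriv_le_sum (k : ℕ) (f : Euc ι → ℂ) (x : Euc ι) :
    ‖iteratedFDeriv ℝ k f x‖ ≤ ∑ w : Fin k → ι, ‖partialD w f x‖ := by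
  classical
  refine ContinuousMultilinearMap.opNorm_le_bound (by positivity) fun v => ?_
  have hv : v = fun j => ∑ i, (v j i) • unitVec i := by
    ext1 j
    exact (sum_smul_unitVec (v j)).symm
  have h1 : iteratedFDeriv ℝ k f x v
      = ∑ w : Fin k → ι, iteratedFDeriv ℝ k f x (fun j => (v j (w j)) • unitVec (w j)) := by
    conv_lhs => rw [hv]
    exact (iteratedFDeriv ℝ k f x).map_sum (fun j i => (v j i) • unitVec i)
  rw [h1, Finset.sum_mul]
  refine (norm_sum_le _ _).trans (Finset.sum_le_sum fun w _ => ?_)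
  rw [ContinuousMultilinearMap.map_smul_univ, norm_smul, mul_comm, norm_prod]
  exact mul_le_mul_of_nonneg_left
    (Finset.prod_le_prod (fun _ _ => norm_nonneg _) fun j _ => PiLp.norm_apply_le (v j) (w j))
    (norm_nonneg _)

lemma norm_partialD_le {k : ℕ} (w : Fin k → ι) (f : Euc ι → ℂ) (x : Euc ι) :
    ‖partialD w f x‖ ≤ ‖iteratedFDeriv ℝ k f x‖ := by
  simpa [norm_unitVec, partialD_eq] using (iteratedFDeriv ℝ k f x).le_opNorm (fun j => unitVec (w j))

end Partials

/-! ### Weights and real-valued forms of the bounds -/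

section Weights

variable {ι : Type} [Fintype ι]

lemma weighted_le_of_mu_le {q : ℤ} {l : ℝ≥0} {f : Euc ι → ℂ} {B : ℝ} (hB : 0 ≤ B)
    (h : mu q l f ≤ ENNReal.ofReal B) {k : ℕ} (hk : (k : ℝ≥0) ≤ l) (w : Fin k → ι) (x : Euc ι) :
    (1 + ‖x‖) ^ q * ‖partialD w f x‖ ≤ B := by
  have h1 := (le_mu q f hk w x).trans h
  rwa [← ofReal_norm, ← ENNReal.ofReal_mul (by positivity),
    ENNReal.ofReal_le_ofReal_iff hB] at h1

lemma mu_le_ofReal {q : ℤ} {l : ℝ≥0} {f : Euc ι → ℂ} {B : ℝ}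
    (h : ∀ (k : ℕ), (k : ℝ≥0) ≤ l → ∀ (w : Fin k → ι) (x : Euc ι),
      (1 + ‖x‖) ^ q * ‖partialD w f x‖ ≤ B) : mu q l f ≤ ENNReal.ofReal B := by
  refine mu_le fun k hk w x => ?_
  rw [← ofReal_norm, ← ENNReal.ofReal_mul (by positivity)]
  exact ENNReal.ofReal_le_ofReal (h k hk w x)

lemma zpow_neg_mul_le_iff {a b c : ℝ} (ha : 0 < a) (q : ℕ) :
    a ^ (-(q : ℤ)) * b ≤ c ↔ b ≤ c * a ^ q := by
  rw [zpow_neg, zpow_natCast, inv_mul_le_iff₀ (by positivity), mul_comm]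

lemma one_add_norm_add_le {E : Type*} [SeminormedAddCommGroup E] (x y : E) :
    1 + ‖x + y‖ ≤ (1 + ‖x‖) * (1 + ‖y‖) := by
  nlinarith [norm_add_le x y, norm_nonneg x, norm_nonneg y]

end Weights

/-! ### Equivalence of the norms μ with the Schwartz seminorms -/

section Schwartz

variable {ι : Type} [Fintype ι]

/-- The partial derivative of a Schwartz function. -/
def pderivS (i : ι) (f : 𝓢(Euc ι, ℂ)) : 𝓢(Euc ι, ℂ) := LineDeriv.lineDerivOp (unitVec i) f

lemma smoothS (f : 𝓢(Euc ι, ℂ)) : ContDiff ℝ ∞ f := f.smooth ⊤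

lemma hasFDerivAtS (f : 𝓢(Euc ι, ℂ)) (x : Euc ι) :
    HasFDerivAt f (ofPartials fun i => pderivS i f x) x :=
  hasFDerivAt_ofPartials (smoothS f) x

lemma partialDS {k : ℕ} (w : Fin k → ι) (f : 𝓢(Euc ι, ℂ)) (x : Euc ι) :
    partialD w f x = (wordOp pderivS k w f : 𝓢(Euc ι, ℂ)) x :=
  partialD_of_family (F := fun f : 𝓢(Euc ι, ℂ) => ⇑f) hasFDerivAtS w f x

lemma mu_pderivS_le (q : ℤ) (l : ℝ≥0) (i : ι) (f : 𝓢(Euc ι, ℂ)) :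
    mu q l (pderivS i f) ≤ mu q (l + 1) f := mu_pderiv_le q l (smoothS f) i

lemma mu_wordOp_le (q : ℤ) (l : ℕ) {k : ℕ} (w : Fin k → ι) (f : 𝓢(Euc ι, ℂ)) :
    mu q l (wordOp pderivS k w f : 𝓢(Euc ι, ℂ)) ≤ mu q ((l + k : ℕ) : ℝ≥0) f :=
  le_wordOp (N := fun l (f : 𝓢(Euc ι, ℂ)) => mu q (l : ℝ≥0) f)
    (fun l i a => by push_cast; exact mu_pderivS_le q l i a) w l f

lemma mu_le_sup_seminorm (q l : ℕ) (f : 𝓢(Euc ι, ℂ)) :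
    mu q l f ≤ ENNReal.ofReal
      (2 ^ q * ((Finset.Iic (q, l)).sup fun m => SchwartzMap.seminorm ℂ m.1 m.2) f) := by
  refine mu_le_ofReal fun k hk w x => ?_
  have h := SchwartzMap.one_add_le_sup_seminorm_apply (𝕜 := ℂ) (m := (q, l)) (k := q) (n := k)
    le_rfl (by exact_mod_cast hk) f x
  rw [zpow_natCast]
  exact (mul_le_mul_of_nonneg_left (norm_partialD_le w f x) (by positivity)).trans h

lemma mu_lt_top (q l : ℕ) (f : 𝓢(Euc ι, ℂ)) : mu q l f < ⊤ :=
  (mu_le_sup_seminorm q l f).trans_lt ENNReal.ofReal_lt_top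

lemma mu_ne_top (q l : ℕ) (f : 𝓢(Euc ι, ℂ)) : mu q l f ≠ ⊤ := (mu_lt_top q l f).ne

lemma ofReal_toReal_mu (q l : ℕ) (f : 𝓢(Euc ι, ℂ)) :
    ENNReal.ofReal (mu q l f).toReal = mu q l f := ENNReal.ofReal_toReal (mu_ne_top q l f)

lemma weighted_le_mu (q l : ℕ) (f : 𝓢(Euc ι, ℂ)) {k : ℕ} (hk : k ≤ l) (w : Fin k → ι)
    (x : Euc ι) : (1 + ‖x‖) ^ q * ‖partialD w f x‖ ≤ (mu q l f).toReal := by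
  rw [← zpow_natCast]
  exact weighted_le_of_mu_le ENNReal.toReal_nonneg (ofReal_toReal_mu q l f).ge
    (by exact_mod_cast hk) w x

lemma weighted_norm_le_mu (q l : ℕ) (f : 𝓢(Euc ι, ℂ)) (x : Euc ι) :
    (1 + ‖x‖) ^ q * ‖f x‖ ≤ (mu q l f).toReal := by
  simpa only [partialD_zero] using weighted_le_mu q l f (Nat.zero_le l) Fin.elim0 x

lemma pow_mul_norm_iteratedFDeriv_le {f : Euc ι → ℂ} {q l : ℕ} {B : ℝ} (hB : 0 ≤ B)
    (h : mu q l f ≤ ENNReal.ofReal B) (x : Euc ι) :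
    ‖x‖ ^ q * ‖iteratedFDeriv ℝ l f x‖ ≤ (Fintype.card ι : ℝ) ^ l * B := by
  calc _ ≤ (1 + ‖x‖) ^ q * ∑ w : Fin l → ι, ‖partialD w f x‖ := by
        gcongr
        · linarith
        · exact norm_iteratedFDeriv_le_sum l f x
    _ = ∑ w : Fin l → ι, (1 + ‖x‖) ^ q * ‖partialD w f x‖ := Finset.mul_sum _ _ _
    _ ≤ ∑ w : Fin l → ι, B := Finset.sum_le_sum fun w _ => by
        rw [← zpow_natCast]
        exact weighted_le_of_mu_le hB h le_rfl w x
    _ = _ := by simp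

lemma seminorm_le_mu (q l : ℕ) (f : 𝓢(Euc ι, ℂ)) :
    SchwartzMap.seminorm ℂ q l f ≤ (Fintype.card ι : ℝ) ^ l * (mu q l f).toReal :=
  SchwartzMap.seminorm_le_bound ℂ q l f (by positivity) fun x =>
    pow_mul_norm_iteratedFDeriv_le ENNReal.toReal_nonneg (ofReal_toReal_mu q l f).ge x

lemma toReal_mu_mono {q q' l l' : ℕ} (hq : q ≤ q') (hl : l ≤ l') (f : 𝓢(Euc ι, ℂ)) :
    (mu q l f).toReal ≤ (mu q' l' f).toReal := by
  refine ENNReal.toReal_mono (mu_ne_top _ _ f) ?_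
  exact (mu_mono (by exact_mod_cast hq) _ _).trans (mu_mono_order _ (by exact_mod_cast hl) _)

/-- The norms μ increase with both indices, so one of them dominates any finite supremum of
seminorms. -/
lemma exists_sup_seminorm_le_mu (s : Finset (ℕ × ℕ)) : ∃ C : ℝ, 0 ≤ C ∧ ∃ q l : ℕ,
    ∀ f : 𝓢(Euc ι, ℂ),
      (s.sup (schwartzSeminormFamily ℂ (Euc ι) ℂ)) f ≤ C * (mu q l f).toReal := by
  classical
  induction s using Finset.induction_on with
  | empty =>
    exact ⟨0, le_rfl, 0, 0, fun f => by simp⟩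
  | insert m s _ ih =>
    obtain ⟨C, hC, q, l, h⟩ := ih
    refine ⟨max C ((Fintype.card ι : ℝ) ^ m.2), le_max_of_le_left hC, max q m.1, max l m.2,
      fun f => ?_⟩
    rw [Finset.sup_insert, Seminorm.sup_apply]
    refine sup_le ?_ ?_
    · refine (seminorm_le_mu m.1 m.2 f).trans ?_
      exact mul_le_mul (le_max_right _ _) (toReal_mu_mono (le_max_right _ _) (le_max_right _ _) f)
        ENNReal.toReal_nonneg (le_max_of_le_left hC)
    · refine (h f).trans ?_
      exact mul_le_mul (le_max_left _ _) (toReal_mu_mono (le_max_left _ _) (le_max_left _ _) f)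
        ENNReal.toReal_nonneg (le_max_of_le_left hC)

/-- A smooth function all of whose weighted norms are finite, as a Schwartz function. -/
def schwartzOfMu (f : Euc ι → ℂ) (hf : ContDiff ℝ ∞ f) (h : ∀ q l : ℕ, mu q l f < ⊤) :
    𝓢(Euc ι, ℂ) where
  toFun := f
  smooth' := hf
  decay' := fun q l => ⟨_, fun x => pow_mul_norm_iteratedFDeriv_le ENNReal.toReal_nonneg
    (ENNReal.ofReal_toReal (h q l).ne).ge x⟩

/-- A continuous linear functional is bounded by one of the norms `μ_{q,l}`. -/
lemma exists_norm_le_mu (T : 𝓢(Euc ι, ℂ) →L[ℂ] ℂ) : ∃ C : ℝ, 0 ≤ C ∧ ∃ q l : ℕ,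
    ∀ f : 𝓢(Euc ι, ℂ), ‖T f‖ ≤ C * (mu q l f).toReal := by
  obtain ⟨s, C, -, h⟩ := Seminorm.bound_of_continuous (schwartz_withSeminorms ℂ (Euc ι) ℂ)
    ((normSeminorm ℂ ℂ).comp T.toLinearMap) (continuous_norm.comp T.continuous)
  obtain ⟨D, hD, q, l, h'⟩ := exists_sup_seminorm_le_mu (ι := ι) s
  refine ⟨C * D, by positivity, q, l, fun f => (h f).trans ?_⟩
  rw [mul_assoc]
  exact mul_le_mul_of_nonneg_left (h' f) C.2

end Schwartz

/-! ### Absolutely convergent series of Schwartz functions -/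

section Complete

variable {E F : Type*} [NormedAddCommGroup E] [NormedSpace ℝ E] [NormedAddCommGroup F]
  [NormedSpace ℝ F] [CompleteSpace F]

lemma norm_iteratedFDeriv_tsum_le {d : ℕ → 𝓢(E, F)}
    (hd : ∀ k n, Summable fun j => SchwartzMap.seminorm ℝ k n (d j)) (k n : ℕ) (x : E) :
    ‖x‖ ^ k * ‖iteratedFDeriv ℝ n (fun y => ∑' j, d j y) x‖
      ≤ ∑' j, SchwartzMap.seminorm ℝ k n (d j) := by
  rw [iteratedFDeriv_tsum_apply (N := ⊤) (v := fun n j => SchwartzMap.seminorm ℝ 0 n (d j))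
    (fun j => (d j).smooth _) (fun n _ => hd 0 n)
    (fun n j x _ => (d j).norm_iteratedFDeriv_le_seminorm ℝ n x) le_top]
  have h0 : Summable fun j => ‖iteratedFDeriv ℝ n (d j) x‖ :=
    (hd 0 n).of_nonneg_of_le (fun _ => norm_nonneg _)
      fun j => (d j).norm_iteratedFDeriv_le_seminorm ℝ n x
  calc _ ≤ ‖x‖ ^ k * ∑' j, ‖iteratedFDeriv ℝ n (d j) x‖ := by
        gcongr
        exact norm_tsum_le_tsum_norm h0
    _ = ∑' j, ‖x‖ ^ k * ‖iteratedFDeriv ℝ n (d j) x‖ := tsum_mul_left.symm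
    _ ≤ _ := (h0.mul_left _).tsum_le_tsum (fun j => (d j).le_seminorm ℝ k n x) (hd k n)

/-- The sum of a series of Schwartz functions which converges absolutely for all seminorms. -/
def schwartzTsum (d : ℕ → 𝓢(E, F))
    (hd : ∀ k n, Summable fun j => SchwartzMap.seminorm ℝ k n (d j)) : 𝓢(E, F) where
  toFun x := ∑' j, d j x
  smooth' := contDiff_tsum (N := ⊤) (v := fun n j => SchwartzMap.seminorm ℝ 0 n (d j))
    (fun j => (d j).smooth _) (fun n _ => hd 0 n)
    (fun n j x _ => (d j).norm_iteratedFDeriv_le_seminorm ℝ n x)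
  decay' k n := ⟨_, norm_iteratedFDeriv_tsum_le hd k n⟩

lemma seminorm_schwartzTsum_le {d : ℕ → 𝓢(E, F)}
    (hd : ∀ k n, Summable fun j => SchwartzMap.seminorm ℝ k n (d j)) (k n : ℕ) :
    SchwartzMap.seminorm ℝ k n (schwartzTsum d hd) ≤ ∑' j, SchwartzMap.seminorm ℝ k n (d j) :=
  SchwartzMap.seminorm_le_bound ℝ k n _ (tsum_nonneg fun _ => apply_nonneg _ _)
    (norm_iteratedFDeriv_tsum_le hd k n)

/-- The difference from a partial sum is the sum of the shifted series, whose seminorms are bounded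
by the tails of convergent series. -/
lemma tendsto_sum_schwartzTsum {d : ℕ → 𝓢(E, F)}
    (hd : ∀ k n, Summable fun j => SchwartzMap.seminorm ℝ k n (d j)) :
    Tendsto (fun N => ∑ j ∈ Finset.range N, d j) atTop (𝓝 (schwartzTsum d hd)) := by
  rw [(schwartz_withSeminorms ℝ E F).tendsto_nhds]
  rintro ⟨k, n⟩ ε hε
  have hd' : ∀ N, ∀ k n, Summable fun j => SchwartzMap.seminorm ℝ k n (d (j + N)) :=
    fun N k n => (summable_nat_add_iff N).2 (hd k n)
  have key : ∀ N, schwartzTsum d hd - ∑ j ∈ Finset.range N, d j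
      = schwartzTsum (fun j => d (j + N)) (hd' N) := by
    intro N
    ext x
    have hs : Summable fun j => d j x :=
      ((hd 0 0).of_nonneg_of_le (fun _ => norm_nonneg _)
        fun j => (d j).norm_le_seminorm ℝ x).of_norm
    have h := hs.sum_add_tsum_nat_add N
    change (∑' j, d j x) - (∑ j ∈ Finset.range N, d j) x = ∑' j, d (j + N) x
    rw [sum_apply, ← h]
    abel
  have h0 := tendsto_sum_nat_add fun j => SchwartzMap.seminorm ℝ k n (d j)
  filter_upwards [h0.eventually_lt_const hε] with N hN
  rw [← map_sub_rev, key]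
  exact (seminorm_schwartzTsum_le _ k n).trans_lt hN

end Complete

/-! ### Completeness and the Baire property of 𝒮 -/

section Baire

variable {ι : Type} [Fintype ι]

lemma continuous_sup_seminorm (q l : ℕ) : Continuous fun f : 𝓢(Euc ι, ℂ) =>
    ((Finset.Iic (q, l)).sup fun m => SchwartzMap.seminorm ℂ m.1 m.2) f := by
  refine Seminorm.continuous_of_le (q := ∑ m ∈ Finset.Iic (q, l),
    SchwartzMap.seminorm ℂ m.1 m.2) ?_ (Seminorm.finset_sup_le_sum _ _)
  have h : (⇑(∑ m ∈ Finset.Iic (q, l),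
      (SchwartzMap.seminorm ℂ m.1 m.2 : Seminorm ℂ 𝓢(Euc ι, ℂ))) : 𝓢(Euc ι, ℂ) → ℝ)
      = fun f => ∑ m ∈ Finset.Iic (q, l), SchwartzMap.seminorm ℂ m.1 m.2 f := by
    ext f
    exact sum_apply _ _ _
  rw [h]
  exact continuous_finsetSum _ fun m _ =>
    (schwartz_withSeminorms ℂ (Euc ι) ℂ).continuous_seminorm m

lemma tendsto_mu_zero (q l : ℕ) :
    Tendsto (fun f : 𝓢(Euc ι, ℂ) => (mu q l f).toReal) (𝓝 0) (𝓝 0) := by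
  have h := ((continuous_sup_seminorm (ι := ι) q l).const_mul (2 ^ q)).tendsto 0
  rw [map_zero, mul_zero] at h
  exact squeeze_zero (fun _ => ENNReal.toReal_nonneg)
    (fun f => ENNReal.toReal_le_of_le_ofReal (by positivity) (mu_le_sup_seminorm q l f)) h

instance : (uniformity 𝓢(Euc ι, ℂ)).IsCountablyGenerated :=
  IsUniformAddGroup.uniformity_countably_generated

instance : CompleteSpace 𝓢(Euc ι, ℂ) := by
  refine UniformSpace.complete_of_convergent_controlled_sequences
    -- Weight and order grow with `N`, so every fixed seminorm of the increments is eventually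
    -- dominated by a geometric sequence; the limit is then a telescoping series.
    (fun N => {p | (mu N N (p.2 - p.1)).toReal < (1 / 2) ^ N}) (fun N => ?_) fun u hu => ?_
  · rw [uniformity_eq_comap_nhds_zero]
    exact ⟨_, (tendsto_mu_zero N N).eventually_lt_const (by positivity), fun p hp => hp⟩
  · have hd : ∀ k n, Summable fun j => SchwartzMap.seminorm ℝ k n (u (j + 1) - u j) := by
      intro k n
      have h : Summable fun j : ℕ => (Fintype.card ι : ℝ) ^ n * (1 / 2 : ℝ) ^ j :=
        (summable_geometric_of_lt_one (by norm_num) (by norm_num)).mul_left _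
      refine h.of_norm_bounded_eventually_nat ?_
      filter_upwards [eventually_ge_atTop (max k n)] with j hj
      rw [Real.norm_of_nonneg (apply_nonneg _ _)]
      refine (seminorm_le_mu k n _).trans ?_
      have h1 : (mu j j (u (j + 1) - u j)).toReal < (1 / 2) ^ j :=
        hu j j (j + 1) le_rfl (Nat.le_succ j)
      gcongr
      exact (toReal_mu_mono (le_trans (le_max_left _ _) hj) (le_trans (le_max_right _ _) hj)
        _).trans h1.le
    refine ⟨schwartzTsum _ hd + u 0, ?_⟩
    have h := (tendsto_sum_schwartzTsum hd).add_const (u 0)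
    simpa only [Finset.sum_range_sub, sub_add_cancel] using h

instance : BaireSpace 𝓢(Euc ι, ℂ) := by
  let := UniformSpace.pseudoMetricSpace 𝓢(Euc ι, ℂ)
  infer_instance

end Baire

/-! ### Joint continuity of the bilinear form -/

section Bilinear

variable {ι κ : Type} [Fintype ι] [Fintype κ]

/-- A continuous linear map `𝒮 → 𝒮'` is a jointly continuous bilinear form. -/
theorem exists_joint_bound (Lam : 𝓢(Euc κ, ℂ) →L[ℂ] 𝓢'(Euc ι, ℂ)) :
    ∃ C : ℝ, 0 ≤ C ∧ ∃ q l q' l' : ℕ, ∀ (f : 𝓢(Euc κ, ℂ)) (g : 𝓢(Euc ι, ℂ)),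
      ‖Lam f g‖ ≤ C * (mu q l f).toReal * (mu q' l' g).toReal := by
  -- A single integer serves as constant, weight and order, so that countably many sets cover 𝒮.
  -- They are closed because f ↦ Λ(f)(g) is continuous for each fixed g.
  let A : ℕ → Set 𝓢(Euc κ, ℂ) := fun N =>
    {f | ∀ g : 𝓢(Euc ι, ℂ), ‖Lam f g‖ ≤ N * (mu N N g).toReal}
  have hcl : ∀ N, IsClosed (A N) := by
    intro N
    have hA : A N = ⋂ g : 𝓢(Euc ι, ℂ), {f | ‖Lam f g‖ ≤ N * (mu N N g).toReal} := by
      ext f; simp [A]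
    rw [hA]
    refine isClosed_iInter fun g => isClosed_le ?_ continuous_const
    exact ((PointwiseConvergenceCLM.evalCLM (RingHom.id ℂ) ℂ g).continuous.comp
      Lam.continuous).norm
  have hun : ⋃ N, A N = Set.univ := by
    refine Set.eq_univ_of_forall fun f => Set.mem_iUnion.2 ?_
    obtain ⟨C, hC, q, l, h⟩ := exists_norm_le_mu (Lam f)
    refine ⟨max ⌈C⌉₊ (max q l), fun g => (h g).trans ?_⟩
    refine mul_le_mul ((Nat.le_ceil C).trans (by exact_mod_cast le_max_left _ _))
      (toReal_mu_mono ?_ ?_ g) ENNReal.toReal_nonneg (by positivity)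
    · exact (le_max_left _ _).trans (le_max_right _ _)
    · exact (le_max_right _ _).trans (le_max_right _ _)
  obtain ⟨N, f₀, hf₀⟩ := nonempty_interior_of_iUnion_of_closed hcl hun
  obtain ⟨s, r, hr, hs⟩ := ((schwartz_withSeminorms ℂ (Euc κ) ℂ).mem_nhds_iff f₀ _).1
    (mem_interior_iff_mem_nhds.1 hf₀)
  set p := s.sup (schwartzSeminormFamily ℂ (Euc κ) ℂ) with hp
  -- Writing f = (f₀ + f) - f₀ moves the ball from f₀ to the origin, at the cost of a factor 2.
  have hball : ∀ f, p f < r → ∀ g : 𝓢(Euc ι, ℂ), ‖Lam f g‖ ≤ 2 * N * (mu N N g).toReal := by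
    intro f hf g
    have h1 : f₀ + f ∈ A N := hs (by simpa [Seminorm.mem_ball] using hf)
    have h2 : f₀ ∈ A N := hs (by simpa [Seminorm.mem_ball] using hr)
    have h3 : Lam f g = Lam (f₀ + f) g - Lam f₀ g := by
      rw [map_add]
      simp
    rw [h3]
    refine (norm_sub_le _ _).trans ?_
    linarith [h1 g, h2 g]
  have hmain : ∀ f (g : 𝓢(Euc ι, ℂ)), ‖Lam f g‖ ≤ p f * (2 * N * (mu N N g).toReal / r) := by
    intro f g
    set M := 2 * N * (mu N N g).toReal
    have hM : 0 ≤ M := by positivity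
    refine le_of_forall_pos_le_add fun δ hδ => ?_
    -- The seminorm `p f` may vanish, so f is normalized by the slightly larger `P`; the increment
    -- is chosen so that its contribution M/(M+1) · δ stays below δ.
    have hP : 0 < p f + δ * r / (M + 1) := by positivity
    set P := p f + δ * r / (M + 1)
    have hlt : p f < P := lt_add_of_pos_right _ (by positivity)
    have h1 := hball (((r / P : ℝ) : ℂ) • f) (by
      rw [map_smul_eq_mul, Complex.norm_real, Real.norm_of_nonneg (by positivity), div_mul_eq_mul_div,
        div_lt_iff₀ hP]
      gcongr) g
    rw [map_smul] at h1
    have h2 : ((((r / P : ℝ) : ℂ) • Lam f : 𝓢'(Euc ι, ℂ)) g) = ((r / P : ℝ) : ℂ) * Lam f g := rfl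
    rw [h2, norm_mul, Complex.norm_real, Real.norm_of_nonneg (by positivity),
      div_mul_eq_mul_div, div_le_iff₀ hP] at h1
    have h3 : ‖Lam f g‖ ≤ M * P / r := by
      rw [le_div_iff₀ hr, mul_comm]
      exact h1
    refine h3.trans ?_
    have h4 : M * P / r = p f * (M / r) + δ * (M / (M + 1)) := by
      simp only [P]
      field_simp
    rw [h4]
    gcongr
    have : M / (M + 1) ≤ 1 := by
      rw [div_le_one (by positivity)]
      linarith
    nlinarith
  obtain ⟨C, hC, q, l, h⟩ := exists_sup_seminorm_le_mu (ι := κ) s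
  refine ⟨C * (2 * N / r), by positivity, q, l, N, N, fun f g => (hmain f g).trans ?_⟩
  calc _ ≤ (C * (mu q l f).toReal) * (2 * N * (mu N N g).toReal / r) := by
        gcongr
        exact h f
    _ = _ := by ring

end Bilinear

/-! ### Intertwining along words -/

section WordOp

/-- When `R` commutes with derivation, a derivative of `R a` is `R` of a derivative of `a`, so
bounds on `R` of order zero give all orders. -/
lemma wordOp_comm {ι : Type} {A B : Type*} {d : ι → A → A} {d' : ι → B → B} (R : A → B)
    (h : ∀ i a, d' i (R a) = R (d i a)) {k : ℕ} (w : Fin k → ι) (a : A) :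
    wordOp d' k w (R a) = R (wordOp d k w a) := by
  induction k generalizing a with
  | zero => rfl
  | succ k ih =>
    change wordOp d' k _ (d' _ (R a)) = R (wordOp d k _ (d _ a))
    rw [h, ih]

end WordOp

/-! ### Translation, reflection and scaling of Schwartz functions -/

section PartialsOfSchwartz

variable {ι : Type} [Fintype ι]

lemma pderivS_apply (i : ι) (f : 𝓢(Euc ι, ℂ)) (x : Euc ι) :
    pderivS i f x = fderiv ℝ f x (unitVec i) := rfl

lemma pderivS_add (i : ι) (f g : 𝓢(Euc ι, ℂ)) :
    pderivS i (f + g) = pderivS i f + pderivS i g := LineDeriv.lineDerivOp_add _ _ _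

lemma pderivS_smul (i : ι) (c : ℂ) (f : 𝓢(Euc ι, ℂ)) :
    pderivS i (c • f) = c • pderivS i f := LineDeriv.lineDerivOp_smul _ _ _

/-- The partial derivative as a linear map. -/
def pderivLM (i : ι) : 𝓢(Euc ι, ℂ) →ₗ[ℂ] 𝓢(Euc ι, ℂ) where
  toFun := pderivS i
  map_add' := pderivS_add i
  map_smul' := pderivS_smul i

lemma pderivS_sub (i : ι) (f g : 𝓢(Euc ι, ℂ)) :
    pderivS i (f - g) = pderivS i f - pderivS i g := map_sub (pderivLM i) f g

lemma pderivS_sum {J : Type*} (s : Finset J) (i : ι) (f : J → 𝓢(Euc ι, ℂ)) :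
    pderivS i (∑ j ∈ s, f j) = ∑ j ∈ s, pderivS i (f j) := map_sum (pderivLM i) f s

lemma pderivS_comm (i j : ι) (f : 𝓢(Euc ι, ℂ)) :
    pderivS i (pderivS j f) = pderivS j (pderivS i f) := by
  ext x
  have hd : DifferentiableAt ℝ (fderiv ℝ f) x :=
    ((contDiff_infty_iff_fderiv.1 (contDiff_infty_iff_fderiv.1 (smoothS f)).2).1 x)
  have h : ∀ i j, pderivS i (pderivS j f) x
      = fderiv ℝ (fderiv ℝ f) x (unitVec i) (unitVec j) := by
    intro i j
    rw [pderivS_apply]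
    have : ⇑(pderivS j f) = fun y => fderiv ℝ f y (unitVec j) := rfl
    rw [this, fderiv_clm_apply hd (differentiableAt_const _)]
    simp
  rw [h, h]
  have hs : IsSymmSndFDerivAt ℝ f x :=
    ((smoothS f).contDiffAt).isSymmSndFDerivAt (by
      rw [minSmoothness_of_isRCLikeNormedField]; exact WithTop.coe_le_coe.2 le_top)
  exact hs.eq _ _

lemma pderivS_compSubConst (i : ι) (h : Euc ι) (f : 𝓢(Euc ι, ℂ)) :
    pderivS i (SchwartzMap.compSubConstCLM ℂ h f) = SchwartzMap.compSubConstCLM ℂ h (pderivS i f) := by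
  ext x
  rw [pderivS_apply, SchwartzMap.compSubConstCLM_apply, pderivS_apply]
  have : ⇑(SchwartzMap.compSubConstCLM ℂ h f) = fun x => f (x - h) := by
    ext y; rw [SchwartzMap.compSubConstCLM_apply]
  rw [this, fderiv_comp_sub]

/-- The remainder `φ(· + h) - φ - ∑ hᵢ ∂ᵢφ`. -/
def taylorRem (h : Euc ι) (φ : 𝓢(Euc ι, ℂ)) : 𝓢(Euc ι, ℂ) :=
  SchwartzMap.compSubConstCLM ℂ (-h) φ - φ - ∑ i, ((h i : ℝ) : ℂ) • pderivS i φ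

lemma taylorRem_apply (h : Euc ι) (φ : 𝓢(Euc ι, ℂ)) (x : Euc ι) :
    taylorRem h φ x = φ (x + h) - φ x - ∑ i, ((h i : ℝ) : ℂ) * pderivS i φ x := by
  simp [taylorRem]

/-- Derivation commutes with translations and with the other partial derivatives. Hence the
remainder needs to be estimated at order zero only. -/
lemma pderivS_taylorRem (i : ι) (h : Euc ι) (φ : 𝓢(Euc ι, ℂ)) :
    pderivS i (taylorRem h φ) = taylorRem h (pderivS i φ) := by
  simp only [taylorRem, pderivS_sub, pderivS_compSubConst, pderivS_sum, pderivS_smul,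
    pderivS_comm i]

/-- Within distance one the weight 1 + |z| changes by a factor of at most 2. -/
lemma weighted_norm_le_of_mem_closedBall (q : ℕ) (χ : 𝓢(Euc ι, ℂ)) {z z' : Euc ι}
    (h : ‖z' - z‖ ≤ 1) : (1 + ‖z‖) ^ q * ‖χ z'‖ ≤ 2 ^ q * (mu q 0 χ).toReal := by
  have h0 := weighted_norm_le_mu q 0 χ z'
  rw [Nat.cast_zero] at h0
  have h1 : 1 + ‖z‖ ≤ 2 * (1 + ‖z'‖) := by
    have : ‖z‖ ≤ ‖z'‖ + ‖z' - z‖ := by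
      have := norm_sub_norm_le z z'
      rw [norm_sub_rev] at this
      linarith
    linarith [norm_nonneg z']
  calc _ ≤ (2 * (1 + ‖z'‖)) ^ q * ‖χ z'‖ := by gcongr
    _ = 2 ^ q * ((1 + ‖z'‖) ^ q * ‖χ z'‖) := by rw [mul_pow]; ring
    _ ≤ _ := by gcongr

lemma weighted_norm_sub_le (q : ℕ) (χ : 𝓢(Euc ι, ℂ)) {z z' : Euc ι} (h : ‖z' - z‖ ≤ 1) :
    (1 + ‖z‖) ^ q * ‖χ z' - χ z‖
      ≤ (∑ i, 2 ^ q * (mu q 0 (pderivS i χ)).toReal) * ‖z' - z‖ := by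
  have hw : 0 < (1 + ‖z‖) ^ q := by positivity
  have key := (convex_closedBall z (1 : ℝ)).norm_image_sub_le_of_norm_hasFDerivWithin_le
    (f := χ) (C := (∑ i, 2 ^ q * (mu q 0 (pderivS i χ)).toReal) / (1 + ‖z‖) ^ q)
    (fun y _ => (hasFDerivAtS χ y).hasFDerivWithinAt) (fun y hy => by
      refine (norm_ofPartials_le _).trans ?_
      rw [le_div_iff₀ hw, Finset.sum_mul]
      refine Finset.sum_le_sum fun i _ => ?_
      rw [mul_comm]
      exact weighted_norm_le_of_mem_closedBall q _ (by simpa [dist_eq_norm] using hy))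
    (Metric.mem_closedBall_self zero_le_one) (by simpa [dist_eq_norm] using h)
  rw [div_mul_eq_mul_div, le_div_iff₀ hw] at key
  rwa [mul_comm]

/-- The mean value inequality is used twice: on the ball of radius ‖h‖ the derivative differs from
its value at the centre by O(‖h‖), and integrating this along h gives ‖h‖². -/
lemma weighted_taylorRem_le (q : ℕ) (χ : 𝓢(Euc ι, ℂ)) (z : Euc ι) {h : Euc ι} (hh : ‖h‖ ≤ 1) :
    (1 + ‖z‖) ^ q * ‖taylorRem h χ z‖
      ≤ (∑ i, ∑ j, 2 ^ q * (mu q 0 (pderivS j (pderivS i χ))).toReal) * ‖h‖ ^ 2 := by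
  have hw : 0 < (1 + ‖z‖) ^ q := by positivity
  set M := ∑ i, ∑ j, 2 ^ q * (mu q 0 (pderivS j (pderivS i χ))).toReal
  have hM : 0 ≤ M := by positivity
  have key := (convex_closedBall z ‖h‖).norm_image_sub_le_of_norm_hasFDerivWithin_le'
    (f := χ) (C := M * ‖h‖ / (1 + ‖z‖) ^ q) (φ := ofPartials fun i => pderivS i χ z)
    (fun y _ => (hasFDerivAtS χ y).hasFDerivWithinAt) (fun y hy => by
      have hy' : ‖y - z‖ ≤ ‖h‖ := by simpa [dist_eq_norm] using hy
      have : (ofPartials (fun i => pderivS i χ y) - ofPartials fun i => pderivS i χ z)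
          = ofPartials fun i => pderivS i χ y - pderivS i χ z := by
        ext v
        simp [ofPartials_apply, mul_sub, Finset.sum_sub_distrib]
      rw [this]
      refine (norm_ofPartials_le _).trans ?_
      rw [le_div_iff₀ hw, Finset.sum_mul, Finset.sum_mul]
      refine Finset.sum_le_sum fun i _ => ?_
      rw [mul_comm]
      refine (weighted_norm_sub_le q _ (hy'.trans hh)).trans ?_
      gcongr)
    (Metric.mem_closedBall_self (norm_nonneg _))
    (y := z + h) (by simp [dist_eq_norm])
  have h1 : χ (z + h) - χ z - (ofPartials fun i => pderivS i χ z) (z + h - z)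
      = taylorRem h χ z := by
    rw [taylorRem_apply, add_sub_cancel_left, ofPartials_apply]
    simp
  rw [h1, add_sub_cancel_left, div_mul_eq_mul_div, le_div_iff₀ hw] at key
  rw [mul_comm]
  refine key.trans_eq ?_
  ring

lemma toReal_mu_pderivS_pderivS_le (q : ℕ) (i j : ι) {k l : ℕ} (hk : k ≤ l) (w : Fin k → ι)
    (φ : 𝓢(Euc ι, ℂ)) : (mu q 0 (pderivS j (pderivS i (wordOp pderivS k w φ)))).toReal
      ≤ (mu q ((l + 2 : ℕ) : ℝ≥0) φ).toReal := by
  refine ENNReal.toReal_mono (mu_ne_top _ _ φ) ?_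
  refine (mu_pderivS_le _ _ _ _).trans ((mu_pderivS_le _ _ _ _).trans ?_)
  have h := mu_wordOp_le q 2 w φ
  refine le_trans (le_of_eq ?_) (h.trans (mu_mono_order _ ?_ _))
  · norm_num
  · exact_mod_cast by omega

lemma mu_taylorRem_le (q l : ℕ) (φ : 𝓢(Euc ι, ℂ)) {h : Euc ι} (hh : ‖h‖ ≤ 1) :
    mu q l (taylorRem h φ) ≤ ENNReal.ofReal
      ((∑ _i : ι, ∑ _j : ι, 2 ^ q * (mu q ((l + 2 : ℕ) : ℝ≥0) φ).toReal) * ‖h‖ ^ 2) := by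
  refine mu_le_ofReal fun k hk w z => ?_
  rw [partialDS, wordOp_comm (taylorRem h) (fun i a => pderivS_taylorRem i h a), zpow_natCast]
  refine (weighted_taylorRem_le q _ z hh).trans ?_
  exact mul_le_mul_of_nonneg_right (Finset.sum_le_sum fun i _ => Finset.sum_le_sum fun j _ =>
    mul_le_mul_of_nonneg_left (toReal_mu_pderivS_pderivS_le q i j (by exact_mod_cast hk) w φ)
      (by positivity)) (by positivity)

lemma hasFDerivAt_comp_const_sub (φ : 𝓢(Euc ι, ℂ)) (x y : Euc ι) :
    HasFDerivAt (fun y => φ (x - y)) (ofPartials fun i => (-pderivS i φ) (x - y)) y := by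
  have h := (hasFDerivAtS φ (x - y)).comp y ((hasFDerivAt_id y).const_sub x)
  refine h.congr_fderiv ?_
  ext v
  simp [ofPartials_apply]

lemma mu_neg (r : ℤ) (l : ℝ≥0) (f : 𝓢(Euc ι, ℂ)) : mu r l (-f) ≤ mu r l f := by
  have h := mu_smul_le r l (-1) (smoothS f)
  simp only [nnnorm_neg, nnnorm_one, ENNReal.coe_one, one_mul] at h
  rwa [neg_one_smul] at h

/-- Peetre's inequality 1 + |y| ≤ (1 + |x|)(1 + |x - y|): moving the centre to x costs a polynomial
in x whose degree is the weight. -/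
lemma mu_reflectAt_le {d : ℕ} (q l : ℕ) (φ : 𝓢(Euc (Fin d), ℂ)) (x : Euc (Fin d)) :
    mu q l (reflectAt φ x) ≤ ENNReal.ofReal ((1 + ‖x‖) ^ q * (mu q l φ).toReal) := by
  refine mu_le_ofReal fun k hk w y => ?_
  have h0 : ⇑(reflectAt φ x) = fun y => φ (x - y) := by ext y; exact reflectAt_apply φ x y
  rw [h0, partialD_of_family (F := fun (φ : 𝓢(Euc (Fin d), ℂ)) y => φ (x - y))
    (fun φ y => hasFDerivAt_comp_const_sub φ x y), zpow_natCast]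
  set ψ := wordOp (fun i φ => -pderivS i φ) k w φ
  have h1 : (mu q 0 ψ).toReal ≤ (mu q l φ).toReal := by
    refine ENNReal.toReal_mono (mu_ne_top _ _ φ) ?_
    have := le_wordOp (d := fun i φ => -pderivS i φ)
      (N := fun l (φ : 𝓢(Euc (Fin d), ℂ)) => mu q (l : ℝ≥0) φ)
      (fun l i a => (mu_neg _ _ _).trans (by push_cast; exact mu_pderivS_le q l i a)) w 0 φ
    refine le_trans (by simp [ψ]) (this.trans (mu_mono_order _ ?_ _))
    simpa using hk
  have h2 := weighted_norm_le_mu q 0 ψ (x - y)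
  rw [Nat.cast_zero] at h2
  have h3 : 1 + ‖y‖ ≤ (1 + ‖x‖) * (1 + ‖x - y‖) := by
    have := one_add_norm_add_le x (-(x - y))
    rwa [norm_neg, neg_sub, add_sub_cancel] at this
  calc _ ≤ ((1 + ‖x‖) * (1 + ‖x - y‖)) ^ q * ‖ψ (x - y)‖ := by gcongr
    _ = (1 + ‖x‖) ^ q * ((1 + ‖x - y‖) ^ q * ‖ψ (x - y)‖) := by rw [mul_pow]; ring
    _ ≤ _ := by gcongr; exact h2.trans h1

lemma hasFDerivAt_comp_smul (φ : 𝓢(Euc ι, ℂ)) (c : ℝ) (y : Euc ι) :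
    HasFDerivAt (fun y => φ (c • y)) (ofPartials fun i => ((c : ℂ) • pderivS i φ) (c • y)) y := by
  have h := (hasFDerivAtS φ (c • y)).comp y ((hasFDerivAt_id y).const_smul c)
  refine h.congr_fderiv ?_
  ext v
  simp [ofPartials_apply]
  rw [Finset.mul_sum]
  exact Finset.sum_congr rfl fun i _ => by ring

lemma toReal_mu_wordOp_smul_le (q : ℕ) {c : ℝ} (hc : 0 ≤ c) {k : ℕ} (w : Fin k → ι)
    (φ : 𝓢(Euc ι, ℂ)) :
    (mu q 0 (wordOp (fun i (φ : 𝓢(Euc ι, ℂ)) => (c : ℂ) • pderivS i φ) k w φ :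
      𝓢(Euc ι, ℂ))).toReal
      ≤ c ^ k * (mu q k φ).toReal := by
  -- The factor c^l is part of the graded quantity, so that `le_wordOp` delivers c^k at the end of
  -- the word.
  have hstep : ∀ (l : ℕ) i (a : 𝓢(Euc ι, ℂ)), ENNReal.ofReal (c ^ l) * mu q l ((c : ℂ) • pderivS i a)
      ≤ ENNReal.ofReal (c ^ (l + 1)) * mu q ((l + 1 : ℕ) : ℝ≥0) a := by
    intro l i a
    have h := (mu_smul_le q l (c : ℂ) (smoothS (pderivS i a))).trans
      (mul_le_mul_right (mu_pderivS_le q l i a) _)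
    have h2 : (‖(c : ℂ)‖₊ : ℝ≥0∞) = ENNReal.ofReal c := by
      change ‖(c : ℂ)‖ₑ = _
      rw [← ofReal_norm, Complex.norm_real, Real.norm_of_nonneg hc]
    rw [h2] at h
    rw [pow_succ, ENNReal.ofReal_mul (by positivity), mul_assoc]
    push_cast
    exact mul_le_mul_right h _
  have := le_wordOp (d := fun i (φ : 𝓢(Euc ι, ℂ)) => (c : ℂ) • pderivS i φ)
    (N := fun l (φ : 𝓢(Euc ι, ℂ)) => ENNReal.ofReal (c ^ l) * mu q (l : ℝ≥0) φ) hstep w 0 φ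
  refine ENNReal.toReal_le_of_le_ofReal (by positivity) ?_
  rw [ENNReal.ofReal_mul (by positivity), ofReal_toReal_mu]
  simpa only [pow_zero, ENNReal.ofReal_one, one_mul, Nat.cast_zero, zero_add] using this

/-- Of the powers of 1/δ, d come from the normalization and at most l from the chain rule. The
weight costs nothing, since |y| ≤ |y/δ| for δ ≤ 1. -/
lemma mu_rescale_le {d : ℕ} (q l : ℕ) (φ : 𝓢(Euc (Fin d), ℂ)) {δ : ℝ} (hδ : 0 < δ)
    (hδ1 : δ ≤ 1) :
    mu q l (rescale φ δ hδ) ≤ ENNReal.ofReal (δ⁻¹ ^ (d + l) * (mu q l φ).toReal) := by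
  have hδ2 : 1 ≤ δ⁻¹ := (one_le_inv₀ hδ).2 hδ1
  refine mu_le_ofReal fun k hk w y => ?_
  have h0 : ⇑(rescale φ δ hδ) = ((δ : ℂ) ^ d)⁻¹ • fun y => φ (δ⁻¹ • y) := by
    ext y; rw [rescale_apply]; rfl
  have hfam := fun (φ : 𝓢(Euc (Fin d), ℂ)) y => hasFDerivAt_comp_smul φ δ⁻¹ y
  rw [h0, partialD_smul w _ (contDiff_of_family
    (F := fun (φ : 𝓢(Euc (Fin d), ℂ)) y => φ (δ⁻¹ • y)) hfam φ), partialD_of_family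
    (F := fun (φ : 𝓢(Euc (Fin d), ℂ)) y => φ (δ⁻¹ • y)) hfam, zpow_natCast]
  set ψ := wordOp (fun i φ => ((δ⁻¹ : ℝ) : ℂ) • pderivS i φ) k w φ
  have hkl : k ≤ l := by exact_mod_cast hk
  have h1 : (mu q 0 ψ).toReal ≤ δ⁻¹ ^ k * (mu q k φ).toReal :=
    toReal_mu_wordOp_smul_le q (inv_nonneg.2 hδ.le) w φ
  have h2 := weighted_norm_le_mu q 0 ψ (δ⁻¹ • y)
  rw [Nat.cast_zero] at h2
  have h3 : ‖y‖ ≤ ‖δ⁻¹ • y‖ := by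
    rw [norm_smul, Real.norm_of_nonneg (by positivity)]
    exact le_mul_of_one_le_left (norm_nonneg _) hδ2
  have h4 : ‖((δ : ℂ) ^ d)⁻¹‖ = δ⁻¹ ^ d := by
    rw [norm_inv, norm_pow, Complex.norm_real, Real.norm_of_nonneg hδ.le, inv_pow]
  rw [norm_mul, h4]
  calc _ ≤ (1 + ‖δ⁻¹ • y‖) ^ q * (δ⁻¹ ^ d * ‖ψ (δ⁻¹ • y)‖) := by gcongr
    _ = δ⁻¹ ^ d * ((1 + ‖δ⁻¹ • y‖) ^ q * ‖ψ (δ⁻¹ • y)‖) := by ring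
    _ ≤ δ⁻¹ ^ d * (δ⁻¹ ^ k * (mu q k φ).toReal) := by exact mul_le_mul_of_nonneg_left (h2.trans h1) (by positivity)
    _ ≤ δ⁻¹ ^ d * (δ⁻¹ ^ l * (mu q l φ).toReal) := by
        refine mul_le_mul_of_nonneg_left (mul_le_mul (pow_le_pow_right₀ hδ2 hkl)
          (toReal_mu_mono le_rfl hkl φ) ENNReal.toReal_nonneg (by positivity)) (by positivity)
    _ = _ := by rw [pow_add]; ring

end PartialsOfSchwartz

/-! ### 𝒮 with a single norm, embedded isometrically in ℓ^∞ -/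

section NormedSchwartz

variable {ι : Type} [Fintype ι]

/-- The index set of the supremum which defines `μ_{q,l}`. -/
abbrev MuIndex (ι : Type) [Fintype ι] (l : ℕ) : Type := Σ k : Fin (l + 1), (Fin k → ι) × Euc ι

/-- The family of the weighted values of the partial derivatives, as a bounded family. -/
def toLpInfty (q l : ℕ) : 𝓢(Euc ι, ℂ) →ₗ[ℂ] lp (fun _ : MuIndex ι l => ℂ) ∞ where
  toFun f := ⟨fun i => (((1 + ‖i.2.2‖) ^ q : ℝ) : ℂ) * partialD i.2.1 f i.2.2,
    memℓp_infty ⟨(mu q l f).toReal, by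
      rintro _ ⟨i, rfl⟩
      dsimp only
      rw [norm_mul, Complex.norm_real, Real.norm_of_nonneg (by positivity)]
      exact weighted_le_mu q l f (Nat.lt_succ_iff.1 i.1.2) _ _⟩⟩
  map_add' f g := by
    ext i
    have := partialD_add i.2.1 (smoothS f) (smoothS g) i.2.2
    simp [this, mul_add]
    rfl
  map_smul' c f := by
    ext i
    have := partialD_smul i.2.1 c (smoothS f) i.2.2
    simp [this, mul_left_comm]

lemma toLpInfty_apply (q l : ℕ) (f : 𝓢(Euc ι, ℂ)) (i : MuIndex ι l) :
    toLpInfty q l f i = (((1 + ‖i.2.2‖) ^ q : ℝ) : ℂ) * partialD i.2.1 f i.2.2 := rfl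

lemma norm_toLpInfty (q l : ℕ) (f : 𝓢(Euc ι, ℂ)) : ‖toLpInfty q l f‖ = (mu q l f).toReal := by
  have hn : ∀ i : MuIndex ι l,
      ‖toLpInfty q l f i‖ = (1 + ‖i.2.2‖) ^ q * ‖partialD i.2.1 f i.2.2‖ := fun i => by
    rw [toLpInfty_apply, norm_mul, Complex.norm_real, Real.norm_of_nonneg (by positivity)]
  apply le_antisymm
  · refine lp.norm_le_of_forall_le ENNReal.toReal_nonneg fun i => ?_
    rw [hn]
    exact weighted_le_mu q l f (Nat.lt_succ_iff.1 i.1.2) _ _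
  · refine ENNReal.toReal_le_of_le_ofReal (norm_nonneg _) (mu_le_ofReal fun k hk w x => ?_)
    have h := lp.norm_apply_le_norm ENNReal.top_ne_zero (toLpInfty q l f)
      ⟨⟨k, Nat.lt_succ_iff.2 (by exact_mod_cast hk)⟩, w, x⟩
    rw [hn] at h
    rwa [zpow_natCast]

lemma toLpInfty_injective (q l : ℕ) : Function.Injective (toLpInfty (ι := ι) q l) := by
  rw [injective_iff_map_eq_zero]
  intro f hf
  ext x
  have h := weighted_norm_le_mu q l f x
  rw [← norm_toLpInfty, hf, norm_zero] at h
  have h1 : 0 < (1 + ‖x‖) ^ q := by positivity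
  have : ‖f x‖ ≤ 0 := by
    by_contra hc
    exact absurd h (not_le.2 (mul_pos h1 (not_le.1 hc)))
  simpa using this

/-- The Schwartz functions, with the norm `μ_{q,l}`. -/
def NormedSchwartz (ι : Type) [Fintype ι] (_q _l : ℕ) : Type := 𝓢(Euc ι, ℂ)

variable {q l : ℕ}

instance : AddCommGroup (NormedSchwartz ι q l) := inferInstanceAs (AddCommGroup 𝓢(Euc ι, ℂ))

instance : Module ℂ (NormedSchwartz ι q l) := inferInstanceAs (Module ℂ 𝓢(Euc ι, ℂ))

variable (q l) in
/-- The map to a Banach space which induces the norm. -/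
def NormedSchwartz.embed : NormedSchwartz ι q l →ₗ[ℂ] lp (fun _ : MuIndex ι l => ℂ) ∞ :=
  toLpInfty q l

instance : NormedAddCommGroup (NormedSchwartz ι q l) :=
  NormedAddCommGroup.induced _ _ (NormedSchwartz.embed q l) (toLpInfty_injective q l)

instance : NormedSpace ℂ (NormedSchwartz ι q l) :=
  NormedSpace.induced ℂ (NormedSchwartz ι q l) _ (NormedSchwartz.embed q l)

variable (q l) in
/-- The identity map to the Schwartz functions with the norm `μ_{q,l}`. -/
def toNormed : 𝓢(Euc ι, ℂ) →ₗ[ℂ] NormedSchwartz ι q l := LinearMap.id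

variable (q l) in
/-- The identity map from the Schwartz functions with the norm `μ_{q,l}`. -/
def ofNormed : NormedSchwartz ι q l →ₗ[ℂ] 𝓢(Euc ι, ℂ) := LinearMap.id

lemma norm_eq_mu (f : NormedSchwartz ι q l) : ‖f‖ = (mu q l (ofNormed q l f)).toReal :=
  norm_toLpInfty q l f

lemma norm_toNormed (f : 𝓢(Euc ι, ℂ)) : ‖toNormed q l f‖ = (mu q l f).toReal :=
  norm_toLpInfty q l f

lemma taylorRem_reflectAt {d : ℕ} (φ : 𝓢(Euc (Fin d), ℂ)) (x h : Euc (Fin d)) :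
    reflectAt φ (x + h) - reflectAt φ x - ∑ i, ((h i : ℝ) : ℂ) • reflectAt (pderivS i φ) x
      = reflectAt (taylorRem h φ) x := by
  ext y
  simp [reflectAt_apply, taylorRem_apply, add_sub_right_comm]

/-- The increment minus its linear part is the reflected Taylor remainder, which is O(‖h‖²) in
μ_{q,l}. Working with one norm on 𝒮 makes the usual chain and product rules available for
functionals and forms bounded by that norm. -/
lemma hasFDerivAt_reflectAt {d : ℕ} (q l : ℕ) (φ : 𝓢(Euc (Fin d), ℂ)) (x : Euc (Fin d)) :
    HasFDerivAt (fun x => toNormed q l (reflectAt φ x))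
      (ofPartials fun i => toNormed q l (reflectAt (pderivS i φ) x)) x := by
  rw [hasFDerivAt_iff_isLittleO_nhds_zero]
  have heq : ∀ h : Euc (Fin d), toNormed q l (reflectAt φ (x + h)) - toNormed q l (reflectAt φ x)
      - (ofPartials fun i => toNormed q l (reflectAt (pderivS i φ) x)) h
      = toNormed q l (reflectAt (taylorRem h φ) x) := by
    intro h
    rw [← taylorRem_reflectAt, map_sub, map_sub, map_sum, ofPartials_apply]
    simp only [map_smul]
    rfl
  simp only [heq]
  refine Asymptotics.IsBigO.trans_isLittleO (g := fun h : Euc (Fin d) => ‖h‖ ^ 2) ?_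
    (Asymptotics.isLittleO_norm_pow_id one_lt_two)
  refine Asymptotics.IsBigO.of_bound ((1 + ‖x‖) ^ q * (∑ _i : Fin d, ∑ _j : Fin d,
    2 ^ q * (mu q ((l + 2 : ℕ) : ℝ≥0) φ).toReal)) ?_
  filter_upwards [Metric.closedBall_mem_nhds (0 : Euc (Fin d)) one_pos] with h hh
  have hh' : ‖h‖ ≤ 1 := by simpa using hh
  rw [norm_toNormed, norm_pow, norm_norm, mul_assoc]
  refine ENNReal.toReal_le_of_le_ofReal (by positivity) ((mu_reflectAt_le q l _ x).trans ?_)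
  refine ENNReal.ofReal_le_ofReal (mul_le_mul_of_nonneg_left ?_ (by positivity))
  exact ENNReal.toReal_le_of_le_ofReal (by positivity) (mu_taylorRem_le q l φ hh')

end NormedSchwartz

/-! ### Bounded functionals applied to `φ(x - ·)` -/

section Functionals

variable {d : ℕ} {T : 𝓢(Euc (Fin d), ℂ) →ₗ[ℂ] ℂ} {C : ℝ} {q l : ℕ}

/-- A functional bounded by `μ_{q,l}`, as a continuous functional on a normed space. -/
def normedFunctional (T : 𝓢(Euc (Fin d), ℂ) →ₗ[ℂ] ℂ)
    (hT : ∀ f : 𝓢(Euc (Fin d), ℂ), ‖T f‖ ≤ C * (mu q l f).toReal) :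
    NormedSchwartz (Fin d) q l →L[ℂ] ℂ :=
  LinearMap.mkContinuous (T ∘ₗ ofNormed q l) C fun f => by
    rw [norm_eq_mu]
    exact hT _

lemma hasFDerivAt_functional_reflectAt
    (hT : ∀ f : 𝓢(Euc (Fin d), ℂ), ‖T f‖ ≤ C * (mu q l f).toReal) (φ : 𝓢(Euc (Fin d), ℂ))
    (x : Euc (Fin d)) :
    HasFDerivAt (fun x => T (reflectAt φ x)) (ofPartials fun i => T (reflectAt (pderivS i φ) x))
      x := by
  have h := ((normedFunctional T hT).restrictScalars ℝ).hasFDerivAt.comp x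
    (hasFDerivAt_reflectAt q l φ x)
  refine h.congr_fderiv ?_
  ext v
  rw [ContinuousLinearMap.comp_apply, ofPartials_apply, ofPartials_apply, map_sum]
  refine Finset.sum_congr rfl fun i _ => ?_
  rw [map_smul]
  rfl

lemma contDiff_functional_reflectAt
    (hT : ∀ f : 𝓢(Euc (Fin d), ℂ), ‖T f‖ ≤ C * (mu q l f).toReal) (φ : 𝓢(Euc (Fin d), ℂ)) :
    ContDiff ℝ ∞ (fun x => T (reflectAt φ x)) :=
  contDiff_of_family (F := fun (φ : 𝓢(Euc (Fin d), ℂ)) x => T (reflectAt φ x))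
    (hasFDerivAt_functional_reflectAt hT) φ

/-- Derivatives in x fall on φ, while the weight q of the functional becomes polynomial growth of
degree q, the same for every order k. -/
lemma mu_functional_reflectAt_le (hC : 0 ≤ C)
    (hT : ∀ f : 𝓢(Euc (Fin d), ℂ), ‖T f‖ ≤ C * (mu q l f).toReal) (φ : 𝓢(Euc (Fin d), ℂ))
    (k : ℕ) :
    mu (-(q : ℤ)) k (fun x => T (reflectAt φ x))
      ≤ ENNReal.ofReal (C * (mu q ((l + k : ℕ) : ℝ≥0) φ).toReal) := by
  refine mu_le_ofReal fun j hj w x => ?_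
  rw [partialD_of_family (F := fun (φ : 𝓢(Euc (Fin d), ℂ)) x => T (reflectAt φ x))
    (hasFDerivAt_functional_reflectAt hT), zpow_neg_mul_le_iff (by positivity)]
  refine (hT _).trans ?_
  rw [mul_assoc]
  refine mul_le_mul_of_nonneg_left (ENNReal.toReal_le_of_le_ofReal (by positivity)
    ((mu_reflectAt_le q l _ x).trans (ENNReal.ofReal_le_ofReal ?_))) hC
  rw [mul_comm]
  refine mul_le_mul_of_nonneg_right (ENNReal.toReal_mono (mu_ne_top _ _ φ)
    ((mu_wordOp_le q l w φ).trans (mu_mono_order _ ?_ _))) (by positivity)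
  have : j ≤ k := by exact_mod_cast hj
  exact_mod_cast by omega

end Functionals

/-! ### The regularized kernel `Λ(θ(y - ·))(φ(x - ·))` -/

section Kernel

variable {m n : ℕ}

/-- The first component. -/
def fstL (m n : ℕ) : Euc (Fin m ⊕ Fin n) →L[ℝ] Euc (Fin m) :=
  LinearMap.toContinuousLinearMap
    { toFun := fun z => WithLp.toLp 2 fun i => z (Sum.inl i)
      map_add' := fun _ _ => rfl
      map_smul' := fun _ _ => rfl }

/-- The second component. -/
def sndL (m n : ℕ) : Euc (Fin m ⊕ Fin n) →L[ℝ] Euc (Fin n) :=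
  LinearMap.toContinuousLinearMap
    { toFun := fun z => WithLp.toLp 2 fun i => z (Sum.inr i)
      map_add' := fun _ _ => rfl
      map_smul' := fun _ _ => rfl }

lemma fstL_apply (z : Euc (Fin m ⊕ Fin n)) (i : Fin m) : fstL m n z i = z (Sum.inl i) := rfl

lemma sndL_apply (z : Euc (Fin m ⊕ Fin n)) (i : Fin n) : sndL m n z i = z (Sum.inr i) := rfl

lemma fstL_pair (x : Euc (Fin m)) (y : Euc (Fin n)) : fstL m n (pair x y) = x := rfl

lemma sndL_pair (x : Euc (Fin m)) (y : Euc (Fin n)) : sndL m n (pair x y) = y := rfl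

lemma norm_sq_eq_fstL_sndL (z : Euc (Fin m ⊕ Fin n)) :
    ‖z‖ ^ 2 = ‖fstL m n z‖ ^ 2 + ‖sndL m n z‖ ^ 2 := by
  simp only [EuclideanSpace.norm_sq_eq, Fintype.sum_sum_type, fstL_apply, sndL_apply]

lemma norm_fstL_le (z : Euc (Fin m ⊕ Fin n)) : ‖fstL m n z‖ ≤ ‖z‖ := by
  refine abs_le_of_sq_le_sq' ?_ (norm_nonneg z) |>.2
  rw [norm_sq_eq_fstL_sndL]
  exact le_add_of_nonneg_right (by positivity)

lemma norm_sndL_le (z : Euc (Fin m ⊕ Fin n)) : ‖sndL m n z‖ ≤ ‖z‖ := by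
  refine abs_le_of_sq_le_sq' ?_ (norm_nonneg z) |>.2
  rw [norm_sq_eq_fstL_sndL]
  exact le_add_of_nonneg_left (by positivity)

lemma one_add_norm_pair_le (x : Euc (Fin m)) (y : Euc (Fin n)) :
    1 + ‖pair x y‖ ≤ (1 + ‖x‖) * (1 + ‖y‖) := by
  have h : ‖pair x y‖ ≤ ‖x‖ + ‖y‖ := by
    refine abs_le_of_sq_le_sq' ?_ (by positivity) |>.2
    rw [norm_sq_eq_fstL_sndL, fstL_pair, sndL_pair]
    nlinarith [norm_nonneg x, norm_nonneg y]
  nlinarith [norm_nonneg x, norm_nonneg y]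

variable {Lam : 𝓢(Euc (Fin n), ℂ) →L[ℂ] 𝓢'(Euc (Fin m), ℂ)} {C : ℝ} {q l q' l' : ℕ}

/-- A bounded bilinear form, as a continuous bilinear form on normed spaces. -/
def normedBilin (Lam : 𝓢(Euc (Fin n), ℂ) →L[ℂ] 𝓢'(Euc (Fin m), ℂ))
    (h : ∀ (f : 𝓢(Euc (Fin n), ℂ)) (g : 𝓢(Euc (Fin m), ℂ)),
      ‖Lam f g‖ ≤ C * (mu q l f).toReal * (mu q' l' g).toReal) :
    NormedSchwartz (Fin n) q l →L[ℝ] NormedSchwartz (Fin m) q' l' →L[ℝ] ℂ :=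
  LinearMap.mkContinuous₂ (LinearMap.mk₂ ℝ
    (fun (f : NormedSchwartz (Fin n) q l) (g : NormedSchwartz (Fin m) q' l') =>
      Lam (ofNormed q l f) (ofNormed q' l' g))
    (fun f f' g => by rw [map_add, map_add]; rfl)
    (fun c f g => by rw [← Complex.coe_smul c f, map_smul, map_smul]; rfl)
    (fun f g g' => by rw [map_add, map_add])
    (fun c f g => by rw [← Complex.coe_smul c g, map_smul, map_smul]; rfl))
    C fun f g => by
      rw [norm_eq_mu, norm_eq_mu]
      exact h _ _

/-- The partial derivatives of the kernel `Λ(θ(y - ·))(φ(x - ·))` act on the pair `(θ, φ)`. -/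
def pairDeriv (i : Fin m ⊕ Fin n) (a : 𝓢(Euc (Fin n), ℂ) × 𝓢(Euc (Fin m), ℂ)) :
    𝓢(Euc (Fin n), ℂ) × 𝓢(Euc (Fin m), ℂ) :=
  Sum.elim (fun i => (a.1, pderivS i a.2)) (fun j => (pderivS j a.1, a.2)) i

/-- The kernel `(x, y) ↦ Λ(θ(y - ·))(φ(x - ·))`. -/
def regKernel (Lam : 𝓢(Euc (Fin n), ℂ) →L[ℂ] 𝓢'(Euc (Fin m), ℂ))
    (a : 𝓢(Euc (Fin n), ℂ) × 𝓢(Euc (Fin m), ℂ)) (z : Euc (Fin m ⊕ Fin n)) : ℂ :=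
  Lam (reflectAt a.1 (sndL m n z)) (reflectAt a.2 (fstL m n z))

/-- Product rule for the bounded bilinear form; a direction in x differentiates φ and a direction in
y differentiates θ. -/
lemma hasFDerivAt_regKernel
    (h : ∀ (f : 𝓢(Euc (Fin n), ℂ)) (g : 𝓢(Euc (Fin m), ℂ)),
      ‖Lam f g‖ ≤ C * (mu q l f).toReal * (mu q' l' g).toReal)
    (a : 𝓢(Euc (Fin n), ℂ) × 𝓢(Euc (Fin m), ℂ)) (z : Euc (Fin m ⊕ Fin n)) :
    HasFDerivAt (regKernel Lam a) (ofPartials fun i => regKernel Lam (pairDeriv i a) z) z := by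
  have h1 := (hasFDerivAt_reflectAt q l a.1 (sndL m n z)).comp z (sndL m n).hasFDerivAt
  have h2 := (hasFDerivAt_reflectAt q' l' a.2 (fstL m n z)).comp z (fstL m n).hasFDerivAt
  refine ((normedBilin Lam h).hasFDerivAt_of_bilinear h1 h2).congr_fderiv ?_
  ext v
  have e1 : ((normedBilin Lam h).precompR _ (toNormed q l (reflectAt a.1 (sndL m n z)))
      ((ofPartials fun i => toNormed q' l' (reflectAt (pderivS i a.2) (fstL m n z))).comp
        (fstL m n))) v = normedBilin Lam h (toNormed q l (reflectAt a.1 (sndL m n z)))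
          ((ofPartials fun i => toNormed q' l' (reflectAt (pderivS i a.2) (fstL m n z)))
            (fstL m n v)) := rfl
  have e2 : ((normedBilin Lam h).precompL _
      ((ofPartials fun i => toNormed q l (reflectAt (pderivS i a.1) (sndL m n z))).comp
        (sndL m n)) (toNormed q' l' (reflectAt a.2 (fstL m n z)))) v
        = normedBilin Lam h ((ofPartials fun i => toNormed q l (reflectAt (pderivS i a.1)
          (sndL m n z))) (sndL m n v)) (toNormed q' l' (reflectAt a.2 (fstL m n z))) := rfl
  rw [ofPartials_apply, Fintype.sum_sum_type]
  refine (congrArg₂ (· + ·) e1 e2).trans (congrArg₂ (· + ·) ?_ ?_)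
  · rw [ofPartials_apply, map_sum]
    refine Finset.sum_congr rfl fun i _ => ?_
    rw [map_smul]
    rfl
  · rw [ofPartials_apply, map_sum, sum_apply]
    refine Finset.sum_congr rfl fun i _ => ?_
    rw [map_smul]
    rfl

lemma contDiff_regKernel
    (h : ∀ (f : 𝓢(Euc (Fin n), ℂ)) (g : 𝓢(Euc (Fin m), ℂ)),
      ‖Lam f g‖ ≤ C * (mu q l f).toReal * (mu q' l' g).toReal)
    (a : 𝓢(Euc (Fin n), ℂ) × 𝓢(Euc (Fin m), ℂ)) : ContDiff ℝ ∞ (regKernel Lam a) :=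
  contDiff_of_family (hasFDerivAt_regKernel h) a

/-- A word of length at most k puts at most k derivatives on either factor. The growths of degree q
in y and q' in x are both measured by |z|, whence the weight q + q'. -/
lemma mu_regKernel_le (hC : 0 ≤ C)
    (h : ∀ (f : 𝓢(Euc (Fin n), ℂ)) (g : 𝓢(Euc (Fin m), ℂ)),
      ‖Lam f g‖ ≤ C * (mu q l f).toReal * (mu q' l' g).toReal)
    (a : 𝓢(Euc (Fin n), ℂ) × 𝓢(Euc (Fin m), ℂ)) (k : ℕ) :
    mu (-((q + q' : ℕ) : ℤ)) k (regKernel Lam a) ≤ ENNReal.ofReal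
      (C * (mu q ((l + k : ℕ) : ℝ≥0) a.1).toReal * (mu q' ((l' + k : ℕ) : ℝ≥0) a.2).toReal) := by
  refine mu_le_ofReal fun j hj w z => ?_
  have hjk : j ≤ k := by exact_mod_cast hj
  rw [partialD_of_family (hasFDerivAt_regKernel h), zpow_neg_mul_le_iff (by positivity)]
  set b := wordOp pairDeriv j w a
  have h1 : (mu q l b.1).toReal ≤ (mu q ((l + k : ℕ) : ℝ≥0) a.1).toReal := by
    refine ENNReal.toReal_mono (mu_ne_top _ _ _) ?_
    have := le_wordOp (d := pairDeriv (m := m) (n := n))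
      (N := fun l a => mu (ι := Fin n) q (l : ℝ≥0) a.1)
      (fun l i a => by
        rcases i with i | i
        · exact mu_mono_order _ (by simp) _
        · push_cast
          exact mu_pderivS_le q l i a.1) w l a
    exact this.trans (mu_mono_order _ (by exact_mod_cast by omega) _)
  have h2 : (mu q' l' b.2).toReal ≤ (mu q' ((l' + k : ℕ) : ℝ≥0) a.2).toReal := by
    refine ENNReal.toReal_mono (mu_ne_top _ _ _) ?_
    have := le_wordOp (d := pairDeriv (m := m) (n := n))
      (N := fun l a => mu (ι := Fin m) q' (l : ℝ≥0) a.2)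
      (fun l i a => by
        rcases i with i | i
        · push_cast
          exact mu_pderivS_le q' l i a.2
        · exact mu_mono_order _ (by simp) _) w l' a
    exact this.trans (mu_mono_order _ (by exact_mod_cast by omega) _)
  have h3 : (mu q l (reflectAt b.1 (sndL m n z))).toReal
      ≤ (1 + ‖z‖) ^ q * (mu q ((l + k : ℕ) : ℝ≥0) a.1).toReal := by
    refine ENNReal.toReal_le_of_le_ofReal (by positivity)
      ((mu_reflectAt_le q l _ _).trans (ENNReal.ofReal_le_ofReal ?_))
    have := norm_sndL_le z
    gcongr
  have h4 : (mu q' l' (reflectAt b.2 (fstL m n z))).toReal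
      ≤ (1 + ‖z‖) ^ q' * (mu q' ((l' + k : ℕ) : ℝ≥0) a.2).toReal := by
    refine ENNReal.toReal_le_of_le_ofReal (by positivity)
      ((mu_reflectAt_le q' l' _ _).trans (ENNReal.ofReal_le_ofReal ?_))
    have := norm_fstL_le z
    gcongr
  refine (h _ _).trans ((mul_le_mul (mul_le_mul_of_nonneg_left h3 hC) h4 ENNReal.toReal_nonneg
    (by positivity)).trans_eq ?_)
  rw [pow_add]
  ring

end Kernel

/-! ### Continuity of linear maps from 𝒮 to 𝒪_M -/

section SlowGrowth

variable {ι κ : Type} [Fintype ι] [Fintype κ]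

/-- The element of `𝒪_M` given by a smooth function with slow growth. -/
def OM.mk (f : Euc ι → ℂ) (hf : ContDiff ℝ ∞ f) (h : ∀ l : ℕ, ∃ q : ℕ, mu (-(q : ℤ)) l f < ⊤) :
    OM ι :=
  (⟨f, hf, h⟩ : OMSubmodule ι)

lemma OM.ext {f g : OM ι} (h : ∀ x, f x = g x) : f = g := Subtype.ext (funext h)

lemma OM.contDiff (f : OM ι) : ContDiff ℝ ∞ f := f.2.1

lemma OM.exists_mu_lt_top (f : OM ι) (l : ℕ) : ∃ q : ℕ, mu (-(q : ℤ)) l f < ⊤ := f.2.2 l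

lemma OM.partialD_sub {k : ℕ} (w : Fin k → ι) (f g : OM ι) (x : Euc ι) :
    partialD w (f - g : OM ι) x = partialD w f x - partialD w g x := by
  have h := partialD_add w (f := (f - g : OM ι)) (OM.contDiff (f - g)) (OM.contDiff g) x
  have h2 : ((f - g : OM ι) : Euc ι → ℂ) + g = f := sub_add_cancel (f : Euc ι → ℂ) g
  refine eq_sub_of_add_eq (h.symm.trans ?_)
  exact congrFun (congrArg (partialD w) h2) x

/-- A linear map `𝒮 → 𝒪_M` which satisfies weighted estimates is continuous. -/
lemma continuous_of_mu_le (A : 𝓢(Euc κ, ℂ) →ₗ[ℂ] OM ι)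
    (h : ∀ l : ℕ, ∃ C : ℝ, 0 ≤ C ∧ ∃ p q l' : ℕ, ∀ f : 𝓢(Euc κ, ℂ),
      mu (-(p : ℤ)) l (A f) ≤ ENNReal.ofReal (C * (mu q l' f).toReal)) : Continuous A := by
  refine continuous_iInf_rng.2 fun χ => continuous_iInf_rng.2 fun k => continuous_iInf_rng.2
    fun w => continuous_induced_rng.2 (continuous_iff_continuousAt.2 fun f₀ => ?_)
  refine UniformFun.tendsto_iff_tendstoUniformly.2 (Metric.tendstoUniformly_iff.2 fun e he => ?_)
  -- The order is the length of the word, and the growth of degree `p` is absorbed by the decay of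
  -- χ, uniformly in x.
  obtain ⟨C, hC, p, q, l', hA⟩ := h k
  set M := (mu p 0 χ).toReal
  have hM : 0 ≤ M := ENNReal.toReal_nonneg
  have hlim : Tendsto (fun f : 𝓢(Euc κ, ℂ) => M * (C * (mu q l' (f - f₀)).toReal)) (𝓝 f₀)
      (𝓝 0) := by
    have h1 : Tendsto (fun f : 𝓢(Euc κ, ℂ) => f - f₀) (𝓝 f₀) (𝓝 0) := by
      exact (continuous_id.sub (continuous_const (y := f₀))).tendsto' f₀ 0 (sub_self f₀)
    have h2 := (((tendsto_mu_zero q l').comp h1).const_mul C).const_mul M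
    rw [mul_zero, mul_zero] at h2
    exact h2
  filter_upwards [hlim.eventually_lt_const he] with f hf x
  refine lt_of_le_of_lt ?_ hf
  have h1 : partialD w (A f) x - partialD w (A f₀) x = partialD w (A (f - f₀)) x := by
    rw [map_sub, OM.partialD_sub]
  have h2 : (1 + ‖x‖) ^ (-(p : ℤ)) * ‖partialD w (A (f - f₀)) x‖ ≤ C * (mu q l' (f - f₀)).toReal :=
    weighted_le_of_mu_le (by positivity) (hA (f - f₀)) le_rfl w x
  rw [zpow_neg_mul_le_iff (by positivity)] at h2
  have h3 := weighted_norm_le_mu p 0 χ x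
  rw [Nat.cast_zero] at h3
  rw [dist_comm, dist_eq_norm]
  change ‖χ x * partialD w (A f) x - χ x * partialD w (A f₀) x‖ ≤ _
  rw [← mul_sub, h1, norm_mul]
  calc _ ≤ ‖χ x‖ * (C * (mu q l' (f - f₀)).toReal * (1 + ‖x‖) ^ p) := by gcongr
    _ = ((1 + ‖x‖) ^ p * ‖χ x‖) * (C * (mu q l' (f - f₀)).toReal) := by ring
    _ ≤ _ := by gcongr

end SlowGrowth

/-! ### Regularization as a continuous linear map -/

section Regularize

variable {m n : ℕ} {C : ℝ} {q l q' l' : ℕ}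

/-- The order l on f is independent of k, because all k derivatives fall on φ; this makes λ constant
in strong moderation. -/
lemma mu_conv_le (Lam : 𝓢(Euc (Fin n), ℂ) →L[ℂ] 𝓢'(Euc (Fin m), ℂ)) (hC : 0 ≤ C)
    (h : ∀ (f : 𝓢(Euc (Fin n), ℂ)) (g : 𝓢(Euc (Fin m), ℂ)),
      ‖Lam f g‖ ≤ C * (mu q l f).toReal * (mu q' l' g).toReal)
    (φ : 𝓢(Euc (Fin m), ℂ)) (f : 𝓢(Euc (Fin n), ℂ)) (k : ℕ) :
    mu (-(q' : ℤ)) k (conv (Lam f) φ)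
      ≤ ENNReal.ofReal (C * (mu q l f).toReal * (mu q' ((l' + k : ℕ) : ℝ≥0) φ).toReal) :=
  mu_functional_reflectAt_le (T := (Lam f).toLinearMap) (by positivity) (h f) φ k

/-- The regularization `f ↦ Λ(f) * φ`, as a linear map. -/
def regularizeLM (Lam : 𝓢(Euc (Fin n), ℂ) →L[ℂ] 𝓢'(Euc (Fin m), ℂ)) (hC : 0 ≤ C)
    (h : ∀ (f : 𝓢(Euc (Fin n), ℂ)) (g : 𝓢(Euc (Fin m), ℂ)),
      ‖Lam f g‖ ≤ C * (mu q l f).toReal * (mu q' l' g).toReal)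
    (φ : 𝓢(Euc (Fin m), ℂ)) :
    𝓢(Euc (Fin n), ℂ) →ₗ[ℂ] OM (Fin m) where
  toFun f := OM.mk (conv (Lam f) φ)
    (contDiff_functional_reflectAt (T := (Lam f).toLinearMap) (h f) φ)
    fun k => ⟨q', (mu_conv_le Lam hC h φ f k).trans_lt ENNReal.ofReal_lt_top⟩
  map_add' f g := OM.ext fun x => by
    have : Lam (f + g) = Lam f + Lam g := map_add Lam f g
    exact congrArg (fun u : 𝓢'(Euc (Fin m), ℂ) => u (reflectAt φ x)) this
  map_smul' c f := OM.ext fun x => by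
    have : Lam (c • f) = c • Lam f := map_smul Lam c f
    exact congrArg (fun u : 𝓢'(Euc (Fin m), ℂ) => u (reflectAt φ x)) this

lemma coe_regularizeLM (Lam : 𝓢(Euc (Fin n), ℂ) →L[ℂ] 𝓢'(Euc (Fin m), ℂ)) (hC : 0 ≤ C)
    (h : ∀ (f : 𝓢(Euc (Fin n), ℂ)) (g : 𝓢(Euc (Fin m), ℂ)),
      ‖Lam f g‖ ≤ C * (mu q l f).toReal * (mu q' l' g).toReal)
    (φ : 𝓢(Euc (Fin m), ℂ))
    (f : 𝓢(Euc (Fin n), ℂ)) :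
    (regularizeLM Lam hC h φ f : Euc (Fin m) → ℂ) = conv (Lam f) φ := rfl

lemma continuous_regularizeLM (Lam : 𝓢(Euc (Fin n), ℂ) →L[ℂ] 𝓢'(Euc (Fin m), ℂ)) (hC : 0 ≤ C)
    (h : ∀ (f : 𝓢(Euc (Fin n), ℂ)) (g : 𝓢(Euc (Fin m), ℂ)),
      ‖Lam f g‖ ≤ C * (mu q l f).toReal * (mu q' l' g).toReal)
    (φ : 𝓢(Euc (Fin m), ℂ)) :
    Continuous (regularizeLM Lam hC h φ) := by
  refine continuous_of_mu_le _ fun k =>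
    ⟨C * (mu q' ((l' + k : ℕ) : ℝ≥0) φ).toReal, by positivity, q', q, l, fun f => ?_⟩
  rw [mul_right_comm, coe_regularizeLM]
  exact mu_conv_le Lam hC h φ f k

/-- The regularization `f ↦ Λ(f) * φ`. -/
def regularize (Lam : 𝓢(Euc (Fin n), ℂ) →L[ℂ] 𝓢'(Euc (Fin m), ℂ)) (hC : 0 ≤ C)
    (h : ∀ (f : 𝓢(Euc (Fin n), ℂ)) (g : 𝓢(Euc (Fin m), ℂ)),
      ‖Lam f g‖ ≤ C * (mu q l f).toReal * (mu q' l' g).toReal)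
    (φ : 𝓢(Euc (Fin m), ℂ)) :
    𝓢(Euc (Fin n), ℂ) →L[ℂ] OM (Fin m) :=
  ⟨regularizeLM Lam hC h φ, continuous_regularizeLM Lam hC h φ⟩

end Regularize

/-! ### Growth sequences; strong moderation implies moderation -/

section Growth

lemma tendsto_const_div_nat (c : ℝ≥0) : Tendsto (fun l : ℕ => c / (l : ℝ≥0)) atTop (𝓝 0) := by
  rw [← NNReal.tendsto_coe]
  push_cast
  exact tendsto_const_div_atTop_nhds_zero_nat _

lemma const_mem_slow (c : ℝ≥0) (a : ℝ≥0∞) : (fun _ => c) ∈ slow a := by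
  by_cases ha : a = 0
  · exact Or.inl ⟨ha, tendsto_const_div_nat c⟩
  · refine Or.inr ⟨ha, ?_⟩
    have := (ENNReal.tendsto_coe.2 (tendsto_const_div_nat c)).limsup_eq
    rw [this]
    simpa using pos_iff_ne_zero.2 ha

lemma slowLE_subset_slow {a b : ℝ≥0∞} (h : a < b) : slowLE a ⊆ slow b :=
  fun _ hq => Or.inr ⟨(zero_le.trans_lt h).ne', lt_of_le_of_lt hq h⟩

lemma affine_mem_slowLE (c s : ℝ≥0) : (fun l : ℕ => c + s * (l : ℝ≥0)) ∈ slowLE s := by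
  have h : Tendsto (fun l : ℕ => (c + s * (l : ℝ≥0)) / (l : ℝ≥0)) atTop (𝓝 s) := by
    have h1 := (tendsto_const_div_nat c).add_const s
    rw [zero_add] at h1
    refine h1.congr' ?_
    filter_upwards [eventually_gt_atTop 0] with l hl
    have : (l : ℝ≥0) ≠ 0 := by exact_mod_cast hl.ne'
    field_simp
  exact ((ENNReal.tendsto_coe.2 h).limsup_eq).le

lemma IsStronglyModerateOver.isModerate {ι κ : Type} [Fintype ι] [Fintype κ]
    {A B : Set (ℕ → ℝ≥0)} {L : Param → 𝓢(Euc κ, ℂ) →L[ℂ] OM ι}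
    (h : IsStronglyModerateOver A B L) : IsModerate L := by
  obtain ⟨lam, -, r, -, h⟩ := h
  intro l
  obtain ⟨C, p, q, h⟩ := h l
  -- The exponent r(l) and the order λ(l) are real, and moderation asks for natural numbers, so both
  -- are rounded up.
  refine ⟨fun ε => C * Real.toNNReal ((ε : ℝ) ^ (-(r l : ℝ))), ⟨⌈r l⌉₊, ?_⟩, p, q, ⌈lam l⌉₊, ?_⟩
  · refine BigO.mono (t' := -(r l : ℝ))
      (b := fun ε => C * ENNReal.ofReal ((ε : ℝ) ^ (-(r l : ℝ)))) ⟨C, ?_⟩ ?_ ?_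
    · exact .of_forall fun _ => le_rfl
    · exact neg_le_neg (by exact_mod_cast Nat.le_ceil (r l))
    · exact .of_forall fun _ => by rw [ENNReal.coe_mul]; rfl
  · filter_upwards [h] with ε hε f
    refine (hε f).trans ?_
    rw [ENNReal.coe_mul]
    exact mul_le_mul_right (mu_mono_order _ (Nat.le_ceil _) _) _

end Growth

/-! ### Strong moderation of the regularizing net -/

section Nets

variable {m n : ℕ} {C : ℝ} {q l q' l' : ℕ}

lemma rpow_le_one_of_param {s : ℝ} (hs : 0 ≤ s) (ε : Param) : (ε : ℝ) ^ s ≤ 1 :=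
  Real.rpow_le_one ε.2.1.le ε.2.2 hs

lemma inv_rpow_pow (ε : Param) (s : ℝ) (k : ℕ) :
    ((ε : ℝ) ^ s)⁻¹ ^ k = (ε : ℝ) ^ (-(s * k)) := by
  rw [← Real.rpow_neg ε.2.1.le, ← Real.rpow_natCast, ← Real.rpow_mul ε.2.1.le, neg_mul]

/-- The net of the regularizations `f ↦ Λ(f) * φ_{ε^s}`. -/
def regNet (Lam : 𝓢(Euc (Fin n), ℂ) →L[ℂ] 𝓢'(Euc (Fin m), ℂ)) (hC : 0 ≤ C)
    (h : ∀ (f : 𝓢(Euc (Fin n), ℂ)) (g : 𝓢(Euc (Fin m), ℂ)),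
      ‖Lam f g‖ ≤ C * (mu q l f).toReal * (mu q' l' g).toReal)
    (φ : 𝓢(Euc (Fin m), ℂ)) (s : ℝ) (ε : Param) : 𝓢(Euc (Fin n), ℂ) →L[ℂ] OM (Fin m) :=
  regularize Lam hC h (rescale φ ((ε : ℝ) ^ s) (Real.rpow_pos_of_pos ε.2.1 s))

lemma isStronglyModerateOver_regNet (Lam : 𝓢(Euc (Fin n), ℂ) →L[ℂ] 𝓢'(Euc (Fin m), ℂ))
    (hC : 0 ≤ C)
    (h : ∀ (f : 𝓢(Euc (Fin n), ℂ)) (g : 𝓢(Euc (Fin m), ℂ)),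
      ‖Lam f g‖ ≤ C * (mu q l f).toReal * (mu q' l' g).toReal)
    (φ : 𝓢(Euc (Fin m), ℂ)) {s : ℝ} (hs : 0 ≤ s) :
    IsStronglyModerateOver (slow 0) (slowLE (ENNReal.ofReal s)) (regNet Lam hC h φ s) := by
  -- The exponent is s times the m + l' + k powers of 1/δ lost in `mu_rescale_le` at order l' + k in
  -- dimension m.
  refine ⟨fun _ => l, const_mem_slow _ _, fun k => s.toNNReal * (m + l' : ℕ) + s.toNNReal * k,
    affine_mem_slowLE _ _, fun k => ?_⟩
  refine ⟨Real.toNNReal (C * (mu q' ((l' + k : ℕ) : ℝ≥0) φ).toReal), q', q,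
    .of_forall fun ε f => ?_⟩
  change mu _ _ (conv (Lam f) (rescale φ ((ε : ℝ) ^ s) (Real.rpow_pos_of_pos ε.2.1 s))) ≤ _
  refine (mu_conv_le Lam hC h _ f k).trans ?_
  have h1 := mu_rescale_le q' (l' + k) φ (Real.rpow_pos_of_pos ε.2.1 s)
    (rpow_le_one_of_param hs ε)
  have h2 := ENNReal.toReal_le_of_le_ofReal (mul_nonneg (pow_nonneg (inv_nonneg.2
    (Real.rpow_nonneg ε.2.1.le s)) _) ENNReal.toReal_nonneg) h1
  rw [inv_rpow_pow] at h2
  have h3 : (-((s.toNNReal * (m + l' : ℕ) + s.toNNReal * k : ℝ≥0) : ℝ))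
      = -(s * ((m + (l' + k) : ℕ) : ℝ)) := by
    push_cast
    rw [Real.coe_toNNReal s hs]
    ring
  rw [h3, ← ofReal_toReal_mu q l f]
  rw [ENNReal.ofNNReal_toNNReal]
  have hε : 0 ≤ (ε : ℝ) ^ (-(s * ((m + (l' + k) : ℕ) : ℝ))) := Real.rpow_nonneg ε.2.1.le _
  rw [← ENNReal.ofReal_mul (by positivity), ← ENNReal.ofReal_mul (by positivity)]
  refine ENNReal.ofReal_le_ofReal ((mul_le_mul_of_nonneg_left h2 (by positivity)).trans_eq ?_)
  rw [ENNReal.toReal_ofReal ENNReal.toReal_nonneg]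
  ring

end Nets

/-! ### Weighted integrals of Schwartz functions -/

section Integrals

variable {d : ℕ}

/-- The d + 1 additional powers of the weight pay for integrability on ℝᵈ. -/
lemma weighted_norm_le_rpow (q : ℕ) (f : 𝓢(Euc (Fin d), ℂ)) (y : Euc (Fin d)) :
    (1 + ‖y‖) ^ q * ‖f y‖
      ≤ (mu ((q + d + 1 : ℕ) : ℤ) 0 f).toReal * (1 + ‖y‖) ^ (-((d : ℝ) + 1)) := by
  have h := weighted_norm_le_mu (q + d + 1) 0 f y
  rw [Nat.cast_zero] at h
  have hy : 0 < 1 + ‖y‖ := by positivity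
  rw [Real.rpow_neg hy.le, ← div_eq_mul_inv, le_div_iff₀ (by positivity)]
  have : (1 + ‖y‖) ^ ((d : ℝ) + 1) = (1 + ‖y‖) ^ (d + 1) := by
    rw [← Real.rpow_natCast]
    push_cast
    rfl
  rw [this]
  refine le_trans (le_of_eq ?_) h
  ring

lemma integrable_one_add_norm_rpow (d : ℕ) :
    Integrable fun y : Euc (Fin d) => (1 + ‖y‖) ^ (-((d : ℝ) + 1)) :=
  integrable_one_add_norm (by simp)

lemma integrable_weighted_norm (q : ℕ) (f : 𝓢(Euc (Fin d), ℂ)) :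
    Integrable fun y => (1 + ‖y‖) ^ q * ‖f y‖ := by
  refine ((integrable_one_add_norm_rpow d).const_mul
    (mu ((q + d + 1 : ℕ) : ℤ) 0 f).toReal).mono' ?_ (.of_forall fun y => ?_)
  · have := f.continuous
    exact (by fun_prop : Continuous fun y => (1 + ‖y‖) ^ q * ‖f y‖).aestronglyMeasurable
  · rw [Real.norm_of_nonneg (by positivity)]
    exact weighted_norm_le_rpow q f y

/-- The constant in the estimate of weighted integrals by a norm `μ_{r,0}`. -/
def weightConst (d : ℕ) : ℝ≥0 :=
  ⟨∫ y : Euc (Fin d), (1 + ‖y‖) ^ (-((d : ℝ) + 1)), integral_nonneg fun _ => by positivity⟩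

lemma integral_weighted_norm_le (q : ℕ) (f : 𝓢(Euc (Fin d), ℂ)) :
    ∫ y, (1 + ‖y‖) ^ q * ‖f y‖
      ≤ weightConst d * (mu ((q + d + 1 : ℕ) : ℤ) 0 f).toReal := by
  refine (integral_mono (integrable_weighted_norm q f)
    ((integrable_one_add_norm_rpow d).const_mul _)
    (fun y => weighted_norm_le_rpow q f y)).trans_eq ?_
  rw [integral_const_mul, mul_comm]
  rfl

lemma integrable_mul_schwartz {g : Euc (Fin d) → ℂ} (hg : Continuous g) {B : ℝ} {q : ℕ}
    (hB : ∀ y, ‖g y‖ ≤ B * (1 + ‖y‖) ^ q) (f : 𝓢(Euc (Fin d), ℂ)) :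
    Integrable fun y => g y * f y := by
  refine ((integrable_weighted_norm q f).const_mul B).mono' ?_ (.of_forall fun y => ?_)
  · exact (hg.mul f.continuous).aestronglyMeasurable
  · rw [norm_mul, ← mul_assoc]
    gcongr
    exact hB y

lemma norm_integral_mul_schwartz_le {g : Euc (Fin d) → ℂ} {B : ℝ} {q : ℕ}
    (hB : ∀ y, ‖g y‖ ≤ B * (1 + ‖y‖) ^ q) (f : 𝓢(Euc (Fin d), ℂ)) :
    ‖∫ y, g y * f y‖ ≤ B * ∫ y, (1 + ‖y‖) ^ q * ‖f y‖ := by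
  rw [← integral_const_mul]
  refine norm_integral_le_of_norm_le ((integrable_weighted_norm q f).const_mul B)
    (.of_forall fun y => ?_)
  rw [norm_mul, ← mul_assoc]
  gcongr
  exact hB y

end Integrals

/-! ### Integral operators with kernels in 𝒪_M -/

section KernelIntegral

variable {ι : Type} [Fintype ι]

/-- The partial derivative on `𝒪_M`. -/
def OM.pderiv (i : ι) (f : OM ι) : OM ι :=
  OM.mk (Colombeau.pderiv i f) (ContDiff.pderiv f.contDiff i) fun l => by
    obtain ⟨q, hq⟩ := f.exists_mu_lt_top (l + 1)
    exact ⟨q, (mu_pderiv_le _ _ f.contDiff i).trans_lt (by exact_mod_cast hq)⟩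

lemma OM.exists_norm_le (f : OM ι) : ∃ B : ℝ, 0 ≤ B ∧ ∃ q : ℕ, ∀ x, ‖f x‖ ≤ B * (1 + ‖x‖) ^ q := by
  obtain ⟨q, hq⟩ := f.exists_mu_lt_top 0
  refine ⟨(mu (-(q : ℤ)) (0 : ℕ) f).toReal, ENNReal.toReal_nonneg, q, fun x => ?_⟩
  have h := weighted_le_of_mu_le ENNReal.toReal_nonneg (ENNReal.ofReal_toReal hq.ne).ge
    (k := 0) le_rfl Fin.elim0 x
  rwa [partialD_zero, zpow_neg_mul_le_iff (by positivity)] at h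

variable {m n : ℕ}

lemma hasFDerivAt_pair_left (x : Euc (Fin m)) (y : Euc (Fin n)) {K : Euc (Fin m ⊕ Fin n) → ℂ}
    (hK : ContDiff ℝ ∞ K) :
    HasFDerivAt (fun x => K (pair x y))
      (ofPartials fun i => pderiv (Sum.inl i) K (pair x y)) x := by
  let E : Euc (Fin m) →L[ℝ] Euc (Fin m ⊕ Fin n) := LinearMap.toContinuousLinearMap
    { toFun := fun x => pair x 0
      map_add' := fun x x' => by
        ext (i | i)
        · rfl
        · exact (add_zero (0 : ℝ)).symm
      map_smul' := fun c x => by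
        ext (i | i)
        · rfl
        · exact (mul_zero c).symm }
  have hE : ∀ x, pair x y = E x + pair 0 y := fun x => by
    ext (i | i)
    · exact (add_zero _).symm
    · exact (zero_add _).symm
  have h1 : HasFDerivAt (fun x => pair x y) E x := by
    rw [funext hE]
    exact E.hasFDerivAt.add_const _
  refine ((hasFDerivAt_ofPartials hK (pair x y)).comp x h1).congr_fderiv ?_
  ext v
  have h2 : ∀ j, E v (Sum.inr j) = 0 := fun _ => rfl
  have h3 : ∀ j, E v (Sum.inl j) = v j := fun _ => rfl
  rw [ContinuousLinearMap.comp_apply, ofPartials_apply, ofPartials_apply, Fintype.sum_sum_type]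
  simp only [h2, h3, zero_smul, Finset.sum_const_zero, add_zero]

lemma continuous_pair (x : Euc (Fin m)) : Continuous fun y : Euc (Fin n) => pair x y := by
  refine (PiLp.continuous_toLp 2 _).comp (continuous_pi fun i => ?_)
  rcases i with i | i
  · exact continuous_const
  · simp only [Sum.elim_inr]
    fun_prop

/-- The integral operator with kernel `K`. -/
def kernelIntegral (K : Euc (Fin m ⊕ Fin n) → ℂ) (f : 𝓢(Euc (Fin n), ℂ)) (x : Euc (Fin m)) : ℂ :=
  ∫ y, K (pair x y) * f y

lemma OM.norm_pair_le {K : Euc (Fin m ⊕ Fin n) → ℂ} {B : ℝ} (hB : 0 ≤ B) {q : ℕ}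
    (h : ∀ z, ‖K z‖ ≤ B * (1 + ‖z‖) ^ q) (x : Euc (Fin m)) (y : Euc (Fin n)) :
    ‖K (pair x y)‖ ≤ B * (1 + ‖x‖) ^ q * (1 + ‖y‖) ^ q := by
  refine (h _).trans ?_
  rw [mul_assoc, ← mul_pow]
  gcongr
  exact one_add_norm_pair_le x y

lemma OM.integrable_kernel (K : OM (Fin m ⊕ Fin n)) (f : 𝓢(Euc (Fin n), ℂ)) (x : Euc (Fin m)) :
    Integrable fun y => K (pair x y) * f y := by
  obtain ⟨B, hB, q, h⟩ := K.exists_norm_le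
  exact integrable_mul_schwartz (K.contDiff.continuous.comp (continuous_pair x))
    (OM.norm_pair_le hB h x) f

lemma integrable_smulRight {α : Type*} [MeasurableSpace α] {μ : Measure α} {c : α → ℂ}
    (A : Euc ι →L[ℝ] ℝ) (hc : Integrable c μ) :
    Integrable (fun y => A.smulRight (c y)) μ :=
  (ContinuousLinearMap.smulRightL ℝ (Euc ι) ℂ A).integrable_comp hc

lemma integrable_ofPartials {α : Type*} [MeasurableSpace α] {μ : Measure α} {c : α → ι → ℂ}
    (hc : ∀ i, Integrable (fun y => c y i) μ) :
    Integrable (fun y => ofPartials (c y)) μ := by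
  unfold ofPartials
  have h := fun i => integrable_smulRight (μ := μ) (EuclideanSpace.proj i : Euc ι →L[ℝ] ℝ) (hc i)
  exact integrable_finsetSum Finset.univ
    (f := fun i y => (EuclideanSpace.proj i : Euc ι →L[ℝ] ℝ).smulRight (c y i)) fun i _ => h i

lemma integral_ofPartials {α : Type*} [MeasurableSpace α] {μ : Measure α} {c : α → ι → ℂ}
    (hc : ∀ i, Integrable (fun y => c y i) μ) :
    ∫ y, ofPartials (c y) ∂μ = ofPartials fun i => ∫ y, c y i ∂μ := by
  ext v
  rw [ContinuousLinearMap.integral_apply (integrable_ofPartials hc)]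
  simp only [ofPartials_apply]
  have h : ∀ i ∈ Finset.univ, Integrable (fun y => v i • c y i) μ := fun i _ => (hc i).smul (v i)
  rw [integral_finsetSum Finset.univ h]
  exact Finset.sum_congr rfl fun i _ => integral_smul (v i) _

lemma hasFDerivAt_kernelIntegral_of_bound (f : 𝓢(Euc (Fin n), ℂ)) {K : Euc (Fin m ⊕ Fin n) → ℂ}
    (hK : ContDiff ℝ ∞ K) (hint : ∀ x, Integrable fun y => K (pair x y) * f y)
    (hint' : ∀ i x, Integrable fun y => pderiv (Sum.inl i) K (pair x y) * f y)
    {B : Fin m → ℝ} (hB : ∀ i, 0 ≤ B i) {q : Fin m → ℕ}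
    (hq : ∀ i z, ‖pderiv (Sum.inl i) K z‖ ≤ B i * (1 + ‖z‖) ^ q i) (x₀ : Euc (Fin m)) :
    HasFDerivAt (kernelIntegral K f)
      (ofPartials fun i => kernelIntegral (pderiv (Sum.inl i) K) f x₀) x₀ := by
  have hlin : ∀ x y, (ofPartials fun i => pderiv (Sum.inl i) K (pair x y) * f y)
      = f y • (ofPartials fun i => pderiv (Sum.inl i) K (pair x y)) := by
    intro x y
    ext v
    simp only [ofPartials_apply, smul_apply, Finset.smul_sum]
    refine Finset.sum_congr rfl fun i _ => ?_
    rw [smul_comm, smul_eq_mul, mul_comm]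
  have key := hasFDerivAt_integral_of_dominated_of_fderiv_le (𝕜 := ℝ) (μ := volume)
    (F := fun x y => K (pair x y) * f y)
    (F' := fun x y => ofPartials fun i => pderiv (Sum.inl i) K (pair x y) * f y)
    (x₀ := x₀) (s := Metric.ball x₀ 1)
    -- On the unit ball around x₀ one has 1 + ‖x‖ ≤ 2 + ‖x₀‖, which frees the dominating function
    -- from x.
    (bound := fun y => ∑ i, B i * (2 + ‖x₀‖) ^ q i * ((1 + ‖y‖) ^ q i * ‖f y‖))
    (Metric.ball_mem_nhds _ one_pos)
    (.of_forall fun x => (hint x).aestronglyMeasurable) (hint x₀)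
    (integrable_ofPartials fun i => hint' i x₀).aestronglyMeasurable
    (.of_forall fun y x hx => ?_)
    (integrable_finsetSum _ fun i _ => (integrable_weighted_norm (q i) f).const_mul _)
    (.of_forall fun y x _ => ?_)
  · rw [integral_ofPartials fun i => hint' i x₀] at key
    exact key
  · refine (norm_ofPartials_le _).trans (Finset.sum_le_sum fun i _ => ?_)
    rw [norm_mul, ← mul_assoc]
    refine mul_le_mul_of_nonneg_right ((OM.norm_pair_le (hB i) (hq i) x y).trans ?_)
      (norm_nonneg _)
    have h1 : 1 + ‖x‖ ≤ 2 + ‖x₀‖ := by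
      have := norm_sub_norm_le x x₀
      rw [Metric.mem_ball, dist_eq_norm] at hx
      linarith
    have := hB i
    gcongr
  · rw [hlin]
    exact (hasFDerivAt_pair_left x y hK).mul_const (f y)

/-- The derivative of the kernel lies in 𝒪_M again, so the kernels in 𝒪_M parametrize a family
closed under derivation. -/
lemma hasFDerivAt_kernelIntegral (f : 𝓢(Euc (Fin n), ℂ)) (K : OM (Fin m ⊕ Fin n))
    (x₀ : Euc (Fin m)) :
    HasFDerivAt (kernelIntegral K f)
      (ofPartials fun i => kernelIntegral (K.pderiv (Sum.inl i)) f x₀) x₀ := by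
  choose B hB q hq using fun i : Fin m => (K.pderiv (Sum.inl i)).exists_norm_le
  exact hasFDerivAt_kernelIntegral_of_bound f K.contDiff (K.integrable_kernel f)
    (fun i => (K.pderiv (Sum.inl i)).integrable_kernel f) hB hq x₀

lemma contDiff_kernelIntegral (f : 𝓢(Euc (Fin n), ℂ)) (K : OM (Fin m ⊕ Fin n)) :
    ContDiff ℝ ∞ (kernelIntegral (m := m) K f) := by
  have h := contDiff_of_family (d := fun i (K : OM (Fin m ⊕ Fin n)) => K.pderiv (Sum.inl i))
    (F := fun K : OM (Fin m ⊕ Fin n) => kernelIntegral (m := m) K f)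
  exact h (fun a x => hasFDerivAt_kernelIntegral f a x) K

lemma partialD_kernelIntegral (f : 𝓢(Euc (Fin n), ℂ)) (K : OM (Fin m ⊕ Fin n)) {k : ℕ}
    (w : Fin k → Fin m) (x : Euc (Fin m)) :
    partialD w (kernelIntegral (m := m) K f) x = kernelIntegral
      (wordOp (fun i (K : OM (Fin m ⊕ Fin n)) => K.pderiv (Sum.inl i)) k w K :
        OM (Fin m ⊕ Fin n)) f x := by
  have h := partialD_of_family (d := fun i (K : OM (Fin m ⊕ Fin n)) => K.pderiv (Sum.inl i))
    (F := fun K : OM (Fin m ⊕ Fin n) => kernelIntegral (m := m) K f)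
  exact h (fun a x => hasFDerivAt_kernelIntegral f a x) w K x

lemma mu_wordOp_OM_le (q : ℤ) {k l : ℕ} (hk : k ≤ l) (w : Fin k → Fin m)
    (K : OM (Fin m ⊕ Fin n)) :
    mu q 0 (wordOp (fun i (K : OM (Fin m ⊕ Fin n)) => K.pderiv (Sum.inl i)) k w K :
        OM (Fin m ⊕ Fin n)) ≤ mu q l K := by
  have h := le_wordOp (d := fun i (K : OM (Fin m ⊕ Fin n)) => K.pderiv (Sum.inl i))
    (N := fun l (K : OM (Fin m ⊕ Fin n)) => mu q (l : ℝ≥0) K)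
  have h2 := h (fun l i K => by push_cast; exact mu_pderiv_le _ _ K.contDiff _) w 0 K
  rw [Nat.cast_zero, zero_add] at h2
  exact h2.trans (mu_mono_order _ (by exact_mod_cast hk) _)

/-- By 1 + |(x, y)| ≤ (1 + |x|)(1 + |y|), the growth of K in y is absorbed by the decay of f and
only the growth in x is left. No derivative falls on f. -/
lemma mu_kernelIntegral_le (f : 𝓢(Euc (Fin n), ℂ)) (K : OM (Fin m ⊕ Fin n)) {q l : ℕ}
    (hK : mu (-(q : ℤ)) l K ≠ ⊤) :
    mu (-(q : ℤ)) l (kernelIntegral (m := m) K f)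
      ≤ weightConst n * mu (-(q : ℤ)) l K * mu ((q + n + 1 : ℕ) : ℤ) 0 f := by
  have hf : mu ((q + n + 1 : ℕ) : ℤ) 0 f ≠ ⊤ := by simpa using mu_ne_top (q + n + 1) 0 f
  have hR : (weightConst n : ℝ≥0∞) * mu (-(q : ℤ)) l K * mu ((q + n + 1 : ℕ) : ℤ) 0 f
      = ENNReal.ofReal ((mu (-(q : ℤ)) l K).toReal *
        (weightConst n * (mu ((q + n + 1 : ℕ) : ℤ) 0 f).toReal)) := by
    rw [ENNReal.ofReal_mul ENNReal.toReal_nonneg, ENNReal.ofReal_mul NNReal.zero_le_coe,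
      ENNReal.ofReal_toReal hK, ENNReal.ofReal_toReal hf, ENNReal.ofReal_coe_nnreal]
    ring
  rw [hR]
  refine mu_le_ofReal fun k hk w x => ?_
  rw [partialD_kernelIntegral]
  have hmu := mu_wordOp_OM_le (-(q : ℤ)) (Nat.cast_le.1 hk) w K
  rw [← ENNReal.ofReal_toReal hK] at hmu
  generalize (wordOp (fun i (K : OM (Fin m ⊕ Fin n)) => K.pderiv (Sum.inl i)) k w K :
    OM (Fin m ⊕ Fin n)) = K' at hmu ⊢
  have hb : ∀ z, ‖K' z‖ ≤ (mu (-(q : ℤ)) l K).toReal * (1 + ‖z‖) ^ q := fun z => by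
    have h := weighted_le_of_mu_le ENNReal.toReal_nonneg hmu (k := 0) (by simp) Fin.elim0 z
    rwa [partialD_zero, zpow_neg_mul_le_iff (by positivity)] at h
  rw [zpow_neg_mul_le_iff (by positivity)]
  refine (norm_integral_mul_schwartz_le (OM.norm_pair_le ENNReal.toReal_nonneg hb x) f).trans ?_
  rw [mul_right_comm]
  refine mul_le_mul_of_nonneg_right (mul_le_mul_of_nonneg_left (integral_weighted_norm_le q f)
    ENNReal.toReal_nonneg) (by positivity)

/-- The integral operator with a kernel in `𝒪_M` maps `𝒮` into `𝒪_M`. -/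
def OM.kernelIntegral (K : OM (Fin m ⊕ Fin n)) (f : 𝓢(Euc (Fin n), ℂ)) : OM (Fin m) :=
  OM.mk (Colombeau.kernelIntegral K f) (contDiff_kernelIntegral f K) fun l => by
    obtain ⟨q, hq⟩ := K.exists_mu_lt_top l
    refine ⟨q, (mu_kernelIntegral_le f K hq.ne).trans_lt ?_⟩
    refine ENNReal.mul_lt_top (ENNReal.mul_lt_top ENNReal.coe_lt_top hq) ?_
    simpa using mu_lt_top (q + n + 1) 0 f

end KernelIntegral

/-! ### The Schwartz function `z ↦ ∫ θ(y - z) f(y) dy` -/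

section Shear

variable {d : ℕ} {σ : ℝ}

/-- The partial derivatives of `(z, u) ↦ f(σ z + u)` act on `f`. -/
def shearDeriv (σ : ℝ) (i : Fin d ⊕ Fin d) (f : 𝓢(Euc (Fin d), ℂ)) : 𝓢(Euc (Fin d), ℂ) :=
  Sum.elim (fun i => (σ : ℂ) • pderivS i f) (fun i => pderivS i f) i

/-- The function `(z, u) ↦ f(σ z + u)`. -/
def shear (σ : ℝ) (f : 𝓢(Euc (Fin d), ℂ)) (p : Euc (Fin d ⊕ Fin d)) : ℂ :=
  f (σ • fstL d d p + sndL d d p)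

lemma hasFDerivAt_shear (f : 𝓢(Euc (Fin d), ℂ)) (p : Euc (Fin d ⊕ Fin d)) :
    HasFDerivAt (shear σ f) (ofPartials fun i => shear σ (shearDeriv σ i f) p) p := by
  refine ((hasFDerivAtS f (σ • fstL d d p + sndL d d p)).comp p
    (σ • fstL d d + sndL d d).hasFDerivAt).congr_fderiv ?_
  ext v
  rw [ContinuousLinearMap.comp_apply, ofPartials_apply, ofPartials_apply, Fintype.sum_sum_type,
    ← Finset.sum_add_distrib]
  refine Finset.sum_congr rfl fun i _ => ?_
  change (σ * v (Sum.inl i) + v (Sum.inr i)) • pderivS i f _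
    = v (Sum.inl i) • ((σ : ℂ) * pderivS i f _) + v (Sum.inr i) • pderivS i f _
  simp only [Complex.real_smul]
  push_cast
  ring

lemma mu_smul_pderivS_le (hσ : |σ| ≤ 1) (r : ℤ) (l : ℝ≥0) (i : Fin d) (f : 𝓢(Euc (Fin d), ℂ)) :
    mu r l ((σ : ℂ) • pderivS i f : 𝓢(Euc (Fin d), ℂ)) ≤ mu r (l + 1) f := by
  refine (mu_smul_le r l (σ : ℂ) (smoothS (pderivS i f))).trans ?_
  have h : (‖(σ : ℂ)‖₊ : ℝ≥0∞) ≤ 1 := by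
    rw [ENNReal.coe_le_one_iff, ← NNReal.coe_le_coe, coe_nnnorm, Complex.norm_real]
    simpa using hσ
  exact (mul_le_mul' h (mu_pderivS_le r l i f)).trans (by rw [one_mul])

lemma norm_le_mu_zero (f : 𝓢(Euc (Fin d), ℂ)) (x : Euc (Fin d)) :
    ‖f x‖ ≤ (mu (0 : ℕ) (0 : ℕ) f).toReal := by
  simpa using weighted_norm_le_mu 0 0 f x

lemma mu_shear_lt_top (hσ : |σ| ≤ 1) (f : 𝓢(Euc (Fin d), ℂ)) (l : ℕ) :
    mu (-((0 : ℕ) : ℤ)) l (shear σ f) < ⊤ := by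
  refine lt_of_le_of_lt (b := ENNReal.ofReal (mu (0 : ℕ) l f).toReal)
    (mu_le_ofReal fun k hk w p => ?_) ENNReal.ofReal_lt_top
  rw [partialD_of_family hasFDerivAt_shear, Nat.cast_zero, neg_zero, zpow_zero, one_mul]
  refine (norm_le_mu_zero _ _).trans (ENNReal.toReal_mono (mu_ne_top _ _ _) ?_)
  refine (le_wordOp (d := shearDeriv σ)
    (N := fun l (f : 𝓢(Euc (Fin d), ℂ)) => mu (0 : ℕ) (l : ℝ≥0) f) (fun l i f => ?_) w 0 f).trans
    (mu_mono_order _ (by simpa using hk) _)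
  push_cast
  rcases i with i | i
  · exact mu_smul_pderivS_le hσ _ _ i f
  · exact mu_pderivS_le _ _ i f

/-- The function `(z, u) ↦ f(σ z + u)`, as an element of `𝒪_M`. -/
def OM.shear (hσ : |σ| ≤ 1) (f : 𝓢(Euc (Fin d), ℂ)) : OM (Fin d ⊕ Fin d) :=
  OM.mk (Colombeau.shear σ f) (contDiff_of_family hasFDerivAt_shear f)
    fun l => ⟨0, mu_shear_lt_top hσ f l⟩

lemma OM.pderiv_shear (hσ : |σ| ≤ 1) (f : 𝓢(Euc (Fin d), ℂ)) (i : Fin d) :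
    (OM.shear hσ f).pderiv (Sum.inl i) = OM.shear hσ ((σ : ℂ) • pderivS i f) :=
  OM.ext fun x => congrFun (pderiv_of_family (F := Colombeau.shear σ) hasFDerivAt_shear f
    (Sum.inl i)) x

/-- The integral `∫ f(σ z + u) θ(u) du`. -/
def shearIntegral (σ : ℝ) (θ f : 𝓢(Euc (Fin d), ℂ)) (z : Euc (Fin d)) : ℂ :=
  ∫ u, f (σ • z + u) * θ u

/-- This is the integral operator with kernel (z, u) ↦ f(σz + u), applied to θ. -/
lemma hasFDerivAt_shearIntegral (hσ : |σ| ≤ 1) (θ f : 𝓢(Euc (Fin d), ℂ)) (z : Euc (Fin d)) :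
    HasFDerivAt (shearIntegral σ θ f)
      (ofPartials fun i => shearIntegral σ θ ((σ : ℂ) • pderivS i f) z) z := by
  have h := hasFDerivAt_kernelIntegral θ (OM.shear hσ f) z
  simp only [OM.pderiv_shear] at h
  exact h

lemma partialD_shearIntegral (hσ : |σ| ≤ 1) (θ f : 𝓢(Euc (Fin d), ℂ)) {k : ℕ} (w : Fin k → Fin d)
    (z : Euc (Fin d)) :
    partialD w (shearIntegral σ θ f) z = shearIntegral σ θ
      (wordOp (fun i (f : 𝓢(Euc (Fin d), ℂ)) => (σ : ℂ) • pderivS i f) k w f) z :=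
  partialD_of_family (hasFDerivAt_shearIntegral hσ θ) w f z

lemma wordOp_one_smul {k : ℕ} (w : Fin k → Fin d) (f : 𝓢(Euc (Fin d), ℂ)) :
    wordOp (fun i (f : 𝓢(Euc (Fin d), ℂ)) => ((1 : ℝ) : ℂ) • pderivS i f) k w f
      = wordOp pderivS k w f := by
  congr
  ext i f
  simp

lemma one_add_norm_le_mul_add (z u : Euc (Fin d)) : 1 + ‖z‖ ≤ (1 + ‖u‖) * (1 + ‖z + u‖) := by
  have := one_add_norm_add_le (z + u) (-u)
  rwa [add_neg_cancel_right, norm_neg, mul_comm] at this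

lemma weighted_shearIntegral_le (q : ℕ) (θ f : 𝓢(Euc (Fin d), ℂ)) (z : Euc (Fin d)) :
    (1 + ‖z‖) ^ q * ‖shearIntegral 1 θ f z‖
      ≤ (mu q (0 : ℕ) f).toReal * ∫ u, (1 + ‖u‖) ^ q * ‖θ u‖ := by
  have hz : 0 < (1 + ‖z‖) ^ q := by positivity
  have h := norm_integral_mul_schwartz_le (g := fun u => f ((1 : ℝ) • z + u)) (q := q)
    (B := (mu q (0 : ℕ) f).toReal / (1 + ‖z‖) ^ q) (fun u => by
      have h1 := weighted_norm_le_mu q 0 f (z + u)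
      rw [one_smul, div_mul_eq_mul_div, le_div_iff₀ hz]
      calc ‖f (z + u)‖ * (1 + ‖z‖) ^ q ≤ ‖f (z + u)‖ * ((1 + ‖u‖) * (1 + ‖z + u‖)) ^ q := by
            gcongr
            exact one_add_norm_le_mul_add z u
        _ = ((1 + ‖z + u‖) ^ q * ‖f (z + u)‖) * (1 + ‖u‖) ^ q := by rw [mul_pow]; ring
        _ ≤ _ := by gcongr) θ
  rw [div_mul_eq_mul_div, le_div_iff₀ hz, mul_comm] at h
  exact h

lemma mu_shearIntegral_le (q l : ℕ) (θ f : 𝓢(Euc (Fin d), ℂ)) :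
    mu q l (shearIntegral 1 θ f)
      ≤ ENNReal.ofReal ((mu q l f).toReal * ∫ u, (1 + ‖u‖) ^ q * ‖θ u‖) := by
  refine mu_le_ofReal fun k hk w z => ?_
  rw [partialD_shearIntegral (by simp), wordOp_one_smul, zpow_natCast]
  refine (weighted_shearIntegral_le q θ _ z).trans ?_
  refine mul_le_mul_of_nonneg_right (ENNReal.toReal_mono (mu_ne_top _ _ _) ?_)
    (integral_nonneg fun _ => by positivity)
  exact (mu_wordOp_le q 0 w f).trans (mu_mono_order _ (by simpa using hk) _)

/-- The Schwartz function `z ↦ ∫ θ(y - z) f(y) dy`. -/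
def reflConv (θ f : 𝓢(Euc (Fin d), ℂ)) : 𝓢(Euc (Fin d), ℂ) :=
  schwartzOfMu (shearIntegral 1 θ f)
    (contDiff_of_family (hasFDerivAt_shearIntegral (by simp) θ) f)
    fun q l => (mu_shearIntegral_le q l θ f).trans_lt ENNReal.ofReal_lt_top

lemma coe_reflConv (θ f : 𝓢(Euc (Fin d), ℂ)) : ⇑(reflConv θ f) = shearIntegral 1 θ f := rfl

/-- Translating u by z moves the dependence on z from f to θ. With σ = 1 derivatives fall on f,
which suits the decay estimates; with σ = -1 they fall on θ, as they do for `reflectAt`. -/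
lemma shearIntegral_comm (θ f : 𝓢(Euc (Fin d), ℂ)) :
    shearIntegral 1 θ f = shearIntegral (-1) f θ := by
  ext z
  unfold shearIntegral
  rw [← integral_add_left_eq_self (fun u => θ ((-1 : ℝ) • z + u) * f u) z]
  refine integral_congr_ae (.of_forall fun u => ?_)
  simp [mul_comm]

lemma pderivS_reflConv (θ f : 𝓢(Euc (Fin d), ℂ)) (i : Fin d) :
    pderivS i (reflConv θ f) = reflConv θ (pderivS i f) := by
  ext z
  have h := congrFun (pderiv_of_family (hasFDerivAt_shearIntegral (σ := 1) (by simp) θ) f i) z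
  rw [Complex.ofReal_one, one_smul] at h
  exact h

end Shear

/-! ### Taking a functional out of the convolution integral -/

section Interchange

variable {d : ℕ} {T : 𝓢(Euc (Fin d), ℂ) →ₗ[ℂ] ℂ} {C : ℝ} {q l : ℕ}

lemma partialD_reflectAt {k : ℕ} (w : Fin k → Fin d) (θ : 𝓢(Euc (Fin d), ℂ))
    (x y : Euc (Fin d)) :
    partialD w (reflectAt θ x) y
      = (wordOp (fun i (f : 𝓢(Euc (Fin d), ℂ)) => ((-1 : ℝ) : ℂ) • pderivS i f) k w θ :
          𝓢(Euc (Fin d), ℂ)) ((-1 : ℝ) • y + x) := by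
  have h0 : ⇑(reflectAt θ x) = fun y => θ (x - y) := by ext y; exact reflectAt_apply θ x y
  rw [h0, partialD_of_family (F := fun (φ : 𝓢(Euc (Fin d), ℂ)) y => φ (x - y))
    (d := fun i (f : 𝓢(Euc (Fin d), ℂ)) => ((-1 : ℝ) : ℂ) • pderivS i f)
    (fun φ y => by simpa using hasFDerivAt_comp_const_sub φ x y)]
  congr 1
  simp [sub_eq_neg_add]

lemma continuous_toLpInfty_reflectAt (q l : ℕ) (θ : 𝓢(Euc (Fin d), ℂ)) :
    Continuous fun y => toLpInfty q l (reflectAt θ y) := by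
  have h1 : Continuous fun y => toNormed q l (reflectAt θ y) :=
    continuous_iff_continuousAt.2 fun y => (hasFDerivAt_reflectAt q l θ y).continuousAt
  let J : NormedSchwartz (Fin d) q l →L[ℂ] lp (fun _ : MuIndex (Fin d) l => ℂ) ∞ :=
    (NormedSchwartz.embed q l).mkContinuous 1 fun f => by rw [one_mul]; rfl
  exact J.continuous.comp h1

lemma integrable_smul_toLpInfty (q l : ℕ) (θ f : 𝓢(Euc (Fin d), ℂ)) :
    Integrable fun y => f y • toLpInfty q l (reflectAt θ y) := by
  refine ((integrable_weighted_norm q f).const_mul (mu q l θ).toReal).mono'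
    (f.continuous.smul (continuous_toLpInfty_reflectAt q l θ)).aestronglyMeasurable
    (.of_forall fun y => ?_)
  rw [norm_smul, norm_toLpInfty]
  have h := ENNReal.toReal_le_of_le_ofReal (by positivity) (mu_reflectAt_le q l θ y)
  calc _ ≤ ‖f y‖ * ((1 + ‖y‖) ^ q * (mu q l θ).toReal) := by gcongr
    _ = _ := by ring

/-- In the Banach space, the convolution is a Bochner integral. -/
lemma integral_smul_toLpInfty (q l : ℕ) (θ f : 𝓢(Euc (Fin d), ℂ)) :
    ∫ y, f y • toLpInfty q l (reflectAt θ y) = toLpInfty q l (reflConv θ f) := by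
  ext i
  have h := (lp.evalCLM ℂ (fun _ : MuIndex (Fin d) l => ℂ) ∞ i).integral_comp_comm
    (integrable_smul_toLpInfty q l θ f)
  change ∫ y, f y * toLpInfty q l (reflectAt θ y) i
    = (∫ y, f y • toLpInfty q l (reflectAt θ y) : lp (fun _ : MuIndex (Fin d) l => ℂ) ∞) i at h
  rw [← h]
  simp only [toLpInfty_apply]
  -- Evaluation at an index is continuous on ℓ^∞, so it suffices to compare one weighted derivative
  -- at one point; the form with σ = -1 matches `partialD_reflectAt`.
  rw [coe_reflConv, shearIntegral_comm, partialD_shearIntegral (by simp), shearIntegral,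
    ← integral_const_mul]
  refine integral_congr_ae (.of_forall fun y => ?_)
  simp only [partialD_reflectAt]
  ring

/-- A bounded functional extends to the Banach space. -/
lemma exists_extension_toLpInfty
    (hT : ∀ f : 𝓢(Euc (Fin d), ℂ), ‖T f‖ ≤ C * (mu q l f).toReal) :
    ∃ T' : lp (fun _ : MuIndex (Fin d) l => ℂ) ∞ →L[ℂ] ℂ, ∀ f, T' (toLpInfty q l f) = T f := by
  let J := LinearEquiv.ofInjective (toLpInfty (ι := Fin d) q l) (toLpInfty_injective q l)
  let S : LinearMap.range (toLpInfty (ι := Fin d) q l) →L[ℂ] ℂ :=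
    (T ∘ₗ J.symm.toLinearMap).mkContinuous C fun x => by
      obtain ⟨f, rfl⟩ := J.surjective x
      have h := hT f
      rw [← norm_toLpInfty] at h
      change ‖T (J.symm (J f))‖ ≤ C * ‖toLpInfty q l f‖
      rwa [J.symm_apply_apply]
  -- Hahn–Banach: the isometry makes the functional bounded on the image of 𝒮, and its extension
  -- commutes with Bochner integrals in the Banach space.
  obtain ⟨T', hT', -⟩ := exists_extension_norm_eq _ S
  refine ⟨T', fun f => ?_⟩
  have h := hT' (J f)
  have h2 : S (J f) = T f := by simp [S]
  rw [h2] at h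
  exact h

/-- A functional on `𝒮` commutes with the integral which defines the convolution. -/
theorem functional_reflConv
    (hT : ∀ f : 𝓢(Euc (Fin d), ℂ), ‖T f‖ ≤ C * (mu q l f).toReal) (θ f : 𝓢(Euc (Fin d), ℂ)) :
    ∫ y, T (reflectAt θ y) * f y = T (reflConv θ f) := by
  obtain ⟨T', hT'⟩ := exists_extension_toLpInfty hT
  rw [← hT', ← integral_smul_toLpInfty,
    ← T'.integral_comp_comm (integrable_smul_toLpInfty q l θ f)]
  refine integral_congr_ae (.of_forall fun y => ?_)
  simp only [map_smul, hT', smul_eq_mul, mul_comm]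

end Interchange

/-! ### Vanishing moments and the order of approximation -/

section Moments

variable {d : ℕ}

/-- Multiplication by a coordinate. -/
def coordMul (i : Fin d) (ψ : 𝓢(Euc (Fin d), ℂ)) : 𝓢(Euc (Fin d), ℂ) :=
  SchwartzMap.smulLeftCLM ℂ (fun x : Euc (Fin d) => inner ℝ x (unitVec i)) ψ

lemma inner_unitVec (x : Euc (Fin d)) (i : Fin d) : inner ℝ x (unitVec i) = x i := by
  classical
  simp [unitVec, EuclideanSpace.inner_single_right]

lemma coordMul_apply (i : Fin d) (ψ : 𝓢(Euc (Fin d), ℂ)) (x : Euc (Fin d)) :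
    coordMul i ψ x = (x i : ℂ) * ψ x := by
  rw [coordMul, SchwartzMap.smulLeftCLM_apply_apply (by fun_prop), inner_unitVec]
  rfl

/-- All moments of positive order vanish. -/
def MomentsVanish (ψ : 𝓢(Euc (Fin d), ℂ)) : Prop :=
  ∀ L : List (Fin d), L ≠ [] → ∫ x, L.foldr coordMul ψ x = 0

lemma MomentsVanish.integral_coordMul {ψ : 𝓢(Euc (Fin d), ℂ)} (h : MomentsVanish ψ) (i : Fin d) :
    ∫ x, coordMul i ψ x = 0 := h [i] (by simp)

lemma MomentsVanish.coordMul {ψ : 𝓢(Euc (Fin d), ℂ)} (h : MomentsVanish ψ) (i : Fin d) :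
    MomentsVanish (coordMul i ψ) := by
  intro L _
  have := h (L ++ [i]) (by simp)
  rwa [List.foldr_append] at this

lemma foldr_coordMul_apply (L : List (Fin d)) (ψ : 𝓢(Euc (Fin d), ℂ)) (x : Euc (Fin d)) :
    L.foldr coordMul ψ x = ((L.map fun i => (x i : ℂ)).prod) * ψ x := by
  induction L with
  | nil => simp
  | cons i L ih => rw [List.foldr_cons, coordMul_apply, ih, List.map_cons, List.prod_cons, mul_assoc]

/-- A list of coordinates stands for the multi-index that counts its entries. -/
lemma IsMollifier.momentsVanish {φ : 𝓢(Euc (Fin d), ℂ)} (h : IsMollifier φ) :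
    MomentsVanish φ := by
  intro L hL
  refine Eq.trans ?_ (h.2 (fun i => L.count i) fun h0 => hL ?_)
  · refine integral_congr_ae (.of_forall fun x => ?_)
    simp only [foldr_coordMul_apply]
    rw [Finset.prod_list_map_count, Complex.ofReal_prod,
      Finset.prod_subset (Finset.subset_univ L.toFinset)]
    · push_cast
      rfl
    · intro i _ hi
      rw [List.count_eq_zero_of_not_mem (by simpa using hi), pow_zero]
  · refine List.eq_nil_iff_forall_not_mem.2 fun i => ?_
    exact List.count_eq_zero.1 (congrFun h0 i)

/-- The difference of a function and its mean, with weight `ψ` at scale `t`. -/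
def meanDiff (ψ f : 𝓢(Euc (Fin d), ℂ)) (z : Euc (Fin d)) (t : ℝ) : ℂ :=
  ∫ u, (f (z + t • u) - f z) * ψ u

lemma weighted_comp_le (q : ℕ) (f : 𝓢(Euc (Fin d), ℂ)) (z u : Euc (Fin d)) {t : ℝ}
    (ht : t ∈ Set.Icc (0 : ℝ) 1) :
    (1 + ‖z‖) ^ q * ‖f (z + t • u)‖ ≤ (mu q (0 : ℕ) f).toReal * (1 + ‖u‖) ^ q := by
  have h1 := weighted_norm_le_mu q 0 f (z + t • u)
  have h2 : ‖t • u‖ ≤ ‖u‖ := by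
    rw [norm_smul, Real.norm_of_nonneg ht.1]
    exact mul_le_of_le_one_left (norm_nonneg _) ht.2
  have h3 : 1 + ‖z‖ ≤ (1 + ‖u‖) * (1 + ‖z + t • u‖) :=
    (one_add_norm_le_mul_add z (t • u)).trans (by gcongr)
  calc _ ≤ ((1 + ‖u‖) * (1 + ‖z + t • u‖)) ^ q * ‖f (z + t • u)‖ := by gcongr
    _ = ((1 + ‖z + t • u‖) ^ q * ‖f (z + t • u)‖) * (1 + ‖u‖) ^ q := by rw [mul_pow]; ring
    _ ≤ _ := by gcongr

lemma norm_sub_le_const (f : 𝓢(Euc (Fin d), ℂ)) (z u : Euc (Fin d)) (t : ℝ) :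
    ‖f (z + t • u) - f z‖ ≤ 2 * (mu (0 : ℕ) (0 : ℕ) f).toReal * (1 + ‖u‖) ^ 0 := by
  rw [pow_zero, mul_one, two_mul]
  exact (norm_sub_le _ _).trans (add_le_add (norm_le_mu_zero f _) (norm_le_mu_zero f _))

lemma continuous_comp_add_smul (f : 𝓢(Euc (Fin d), ℂ)) (z : Euc (Fin d)) (t : ℝ) :
    Continuous fun u : Euc (Fin d) => f (z + t • u) :=
  f.continuous.comp (by fun_prop)

lemma integrable_meanDiff (ψ f : 𝓢(Euc (Fin d), ℂ)) (z : Euc (Fin d)) (t : ℝ) :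
    Integrable fun u => (f (z + t • u) - f z) * ψ u :=
  integrable_mul_schwartz ((continuous_comp_add_smul f z t).sub continuous_const)
    (fun u => norm_sub_le_const f z u t) ψ

lemma integrable_comp_mul (ψ f : 𝓢(Euc (Fin d), ℂ)) (z : Euc (Fin d)) (t : ℝ) :
    Integrable fun u => f (z + t • u) * ψ u :=
  integrable_mul_schwartz (continuous_comp_add_smul f z t) (q := 0)
    (fun u => by rw [pow_zero, mul_one]; exact norm_le_mu_zero f _) ψ

lemma meanDiff_zero (ψ f : 𝓢(Euc (Fin d), ℂ)) (z : Euc (Fin d)) : meanDiff ψ f z 0 = 0 := by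
  simp [meanDiff]

lemma meanDiff_eq_of_integral_eq_zero {ψ : 𝓢(Euc (Fin d), ℂ)} (h : ∫ x, ψ x = 0)
    (f : 𝓢(Euc (Fin d), ℂ)) (z : Euc (Fin d)) (t : ℝ) :
    meanDiff ψ f z t = ∫ u, f (z + t • u) * ψ u := by
  simp only [meanDiff, sub_mul]
  rw [integral_sub (integrable_comp_mul ψ f z t) (ψ.integrable.const_mul _), integral_const_mul, h,
    mul_zero, sub_zero]

lemma hasDerivAt_comp_add_smul (f : 𝓢(Euc (Fin d), ℂ)) (z u : Euc (Fin d)) (t : ℝ) :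
    HasDerivAt (fun t : ℝ => f (z + t • u)) (∑ i, (u i : ℂ) * pderivS i f (z + t • u)) t := by
  have h1 : HasDerivAt (fun t : ℝ => z + t • u) u t := by
    simpa using ((hasDerivAt_id t).smul_const u).const_add z
  have h := (hasFDerivAtS f (z + t • u)).comp_hasDerivAt t h1
  rw [ofPartials_apply] at h
  exact h

/-- Differentiation in t produces the terms u_i ∂_i f(z + tu) ψ(u). As u_i ψ has integral zero, the
value ∂_i f(z) may be subtracted for free, so the derivative is again a sum of mean differences,
with weights u_i ψ whose moments also vanish. -/
lemma hasDerivAt_meanDiff {ψ : 𝓢(Euc (Fin d), ℂ)} (h : MomentsVanish ψ)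
    (f : 𝓢(Euc (Fin d), ℂ)) (z : Euc (Fin d)) (t : ℝ) :
    HasDerivAt (meanDiff ψ f z) (∑ i, meanDiff (coordMul i ψ) (pderivS i f) z t) t := by
  have hF' : ∀ t : ℝ, ∀ u, (∑ i, (u i : ℂ) * pderivS i f (z + t • u)) * ψ u
      = ∑ i, pderivS i f (z + t • u) * coordMul i ψ u := by
    intro t u
    rw [Finset.sum_mul]
    refine Finset.sum_congr rfl fun i _ => ?_
    rw [coordMul_apply]
    ring
  have hint := fun i => integrable_comp_mul (coordMul i ψ) (pderivS i f) z t
  have key := hasDerivAt_integral_of_dominated_loc_of_deriv_le (𝕜 := ℝ) (μ := volume) (x₀ := t)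
    (s := Set.univ)
    (F := fun t u => (f (z + t • u) - f z) * ψ u)
    (F' := fun t u => ∑ i, pderivS i f (z + t • u) * coordMul i ψ u)
    (bound := fun u => ∑ i, (mu (0 : ℕ) (0 : ℕ) (pderivS i f)).toReal * ‖coordMul i ψ u‖)
    univ_mem (.of_forall fun t => (integrable_meanDiff ψ f z t).aestronglyMeasurable)
    (integrable_meanDiff ψ f z t)
    (integrable_finsetSum _ fun i _ => hint i).aestronglyMeasurable
    (.of_forall fun u t _ => (norm_sum_le _ _).trans (Finset.sum_le_sum fun i _ => by
      rw [norm_mul]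
      gcongr
      exact norm_le_mu_zero _ _))
    (integrable_finsetSum _ fun i _ => ((coordMul i ψ).integrable.norm.const_mul _))
    (.of_forall fun u t _ => by
      simp only [← hF']
      exact ((hasDerivAt_comp_add_smul f z u t).sub_const (f z)).mul_const (ψ u))
  have h2 := key.2
  rw [integral_finsetSum _ fun i _ => hint i] at h2
  simp only [meanDiff_eq_of_integral_eq_zero (h.integral_coordMul _)]
  exact h2

/-- If the moments of `ψ` vanish, the mean at scale `t` differs from the value by `O(t^k)`. -/
theorem exists_meanDiff_le (k : ℕ) : ∀ {ψ : 𝓢(Euc (Fin d), ℂ)}, MomentsVanish ψ → ∀ q : ℕ,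
    ∃ C : ℝ, 0 ≤ C ∧ ∀ (f : 𝓢(Euc (Fin d), ℂ)) (z : Euc (Fin d)), ∀ t ∈ Set.Icc (0 : ℝ) 1,
      (1 + ‖z‖) ^ q * ‖meanDiff ψ f z t‖ ≤ C * t ^ k * (mu q k f).toReal := by
  induction k with
  | zero =>
    intro ψ _ q
    refine ⟨2 * ∫ u, (1 + ‖u‖) ^ q * ‖ψ u‖, by positivity, fun f z t ht => ?_⟩
    have hz : 0 < (1 + ‖z‖) ^ q := by positivity
    have hb := norm_integral_mul_schwartz_le (g := fun u => f (z + t • u) - f z) (q := q)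
      (B := 2 * (mu q (0 : ℕ) f).toReal / (1 + ‖z‖) ^ q) (fun u => by
        have h1 := weighted_comp_le q f z u ht
        have h2 := weighted_comp_le q f z u (t := 0) (by simp)
        rw [zero_smul, add_zero] at h2
        rw [div_mul_eq_mul_div, le_div_iff₀ hz, mul_comm]
        have h3 := mul_le_mul_of_nonneg_left (norm_sub_le (f (z + t • u)) (f z)) hz.le
        linarith) ψ
    rw [div_mul_eq_mul_div, le_div_iff₀ hz, mul_comm] at hb
    refine hb.trans_eq ?_
    rw [pow_zero]
    ring
  | succ k ih =>
    intro ψ hψ q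
    choose C hC h using fun i => ih (hψ.coordMul i) q
    refine ⟨∑ i, C i, Finset.sum_nonneg fun i _ => hC i, fun f z t ht => ?_⟩
    have hz : 0 < (1 + ‖z‖) ^ q := by positivity
    have hS : 0 ≤ ∑ i, C i := Finset.sum_nonneg fun i _ => hC i
    -- Mean value inequality on [0, t], starting from the value 0 at t = 0: each step of the
    -- induction gains one power of t and loses one derivative of f.
    have key := norm_image_sub_le_of_norm_deriv_le_segment' (f := meanDiff ψ f z) (a := 0) (b := t)
      (C := (∑ i, C i) * t ^ k * (mu q ((k + 1 : ℕ) : ℝ≥0) f).toReal / (1 + ‖z‖) ^ q)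
      (fun r _ => (hasDerivAt_meanDiff hψ f z r).hasDerivWithinAt) (fun r hr => by
        rw [le_div_iff₀ hz, mul_comm, mul_assoc, Finset.sum_mul]
        refine (mul_le_mul_of_nonneg_left (norm_sum_le _ _) hz.le).trans ?_
        rw [Finset.mul_sum]
        refine Finset.sum_le_sum fun i _ => ?_
        refine (h i (pderivS i f) z r ⟨hr.1, hr.2.le.trans ht.2⟩).trans ?_
        rw [mul_assoc]
        refine mul_le_mul_of_nonneg_left (mul_le_mul (pow_le_pow_left₀ hr.1 hr.2.le k)
          (ENNReal.toReal_mono (mu_ne_top _ _ _) ?_) ENNReal.toReal_nonneg (pow_nonneg ht.1 k))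
          (hC i)
        push_cast
        exact mu_pderivS_le q k i f) t ⟨ht.1, le_rfl⟩
    rw [meanDiff_zero, sub_zero, sub_zero, div_mul_eq_mul_div, le_div_iff₀ hz, mul_comm] at key
    refine key.trans_eq ?_
    rw [pow_succ]
    ring

/-- Change of variable by the factor δ; since ∫ θ = 1, the subtracted f(z) can be put under the
integral. -/
lemma reflConv_rescale_sub (θ f : 𝓢(Euc (Fin d), ℂ)) (h1 : ∫ x, θ x = 1) {δ : ℝ} (hδ : 0 < δ)
    (z : Euc (Fin d)) :
    (reflConv (rescale θ δ hδ) f - f) z = meanDiff θ f z δ := by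
  rw [sub_apply, coe_reflConv, shearIntegral, meanDiff]
  simp only [sub_mul]
  rw [integral_sub (integrable_comp_mul θ f z δ) (θ.integrable.const_mul _), integral_const_mul,
    h1, mul_one]
  congr 1
  have h := Measure.integral_comp_inv_smul_of_nonneg (volume : Measure (Euc (Fin d)))
    (fun u => f (z + δ • u) * θ u) hδ.le
  have hd : (δ : ℂ) ^ d ≠ 0 := pow_ne_zero _ (by exact_mod_cast hδ.ne')
  rw [finrank_euclideanSpace_fin] at h
  have h2 : ∫ u, f (z + δ • u) * θ u
      = ((δ : ℂ) ^ d)⁻¹ * ∫ u, f (z + δ • δ⁻¹ • u) * θ (δ⁻¹ • u) := by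
    rw [h, eq_inv_mul_iff_mul_eq₀ hd, Complex.real_smul]
    push_cast
    rfl
  rw [h2, ← integral_const_mul]
  refine integral_congr_ae (.of_forall fun u => ?_)
  simp only [rescale_apply, smul_inv_smul₀ hδ.ne', one_smul]
  ring

/-- Convolution with a mollifier at scale `δ` is the identity up to `O(δ^k)`, with a loss of `k`
derivatives. -/
theorem exists_mu_reflConv_sub_le {θ : 𝓢(Euc (Fin d), ℂ)} (h1 : ∫ x, θ x = 1)
    (hθ : MomentsVanish θ) (k q : ℕ) :
    ∃ C : ℝ, 0 ≤ C ∧ ∀ (l : ℕ) (f : 𝓢(Euc (Fin d), ℂ)) (δ : ℝ) (hδ : 0 < δ), δ ≤ 1 →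
      mu q l (reflConv (rescale θ δ hδ) f - f : 𝓢(Euc (Fin d), ℂ))
        ≤ ENNReal.ofReal (C * δ ^ k * (mu q ((k + l : ℕ) : ℝ≥0) f).toReal) := by
  obtain ⟨C, hC, h⟩ := exists_meanDiff_le k hθ q
  refine ⟨C, hC, fun l f δ hδ hδ1 => mu_le_ofReal fun j hj w z => ?_⟩
  -- Both terms of the difference commute with derivation, so the estimate of order zero is applied
  -- to a derivative of f.
  rw [partialDS, wordOp_comm (d := pderivS) (fun f => reflConv (rescale θ δ hδ) f - f)
    (fun i f => by rw [pderivS_sub, pderivS_reflConv]), reflConv_rescale_sub θ _ h1, zpow_natCast]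
  refine (h _ z δ ⟨hδ.le, hδ1⟩).trans ?_
  refine mul_le_mul_of_nonneg_left (ENNReal.toReal_mono (mu_ne_top _ _ _)
    ((mu_wordOp_le q k w f).trans (mu_mono_order _ ?_ _))) (by positivity)
  have : j ≤ l := by exact_mod_cast hj
  exact_mod_cast by omega

end Moments

/-! ### Existence of mollifiers with vanishing moments -/

section Existence

open FourierTransform

variable {d : ℕ}

/-- The Fourier transform of a Schwartz function on `ℝᵈ`, as a Schwartz function. -/
def fourierS (ψ : 𝓢(Euc (Fin d), ℂ)) : 𝓢(Euc (Fin d), ℂ) := 𝓕 ψ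

lemma exists_fourierS_eq (χ : 𝓢(Euc (Fin d), ℂ)) : ∃ θ, fourierS θ = χ :=
  ⟨𝓕⁻ χ, FourierTransform.fourier_fourierInv_eq χ⟩

lemma pderivS_fourierS (i : Fin d) (ψ : 𝓢(Euc (Fin d), ℂ)) :
    pderivS i (fourierS ψ) = (-(2 * Real.pi * Complex.I) : ℂ) • fourierS (coordMul i ψ) := by
  rw [fourierS, pderivS, SchwartzMap.lineDerivOp_fourier_eq, FourierTransform.fourier_smul]
  rfl

lemma fourierS_apply_zero (ψ : 𝓢(Euc (Fin d), ℂ)) : fourierS ψ 0 = ∫ x, ψ x := by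
  rw [fourierS, SchwartzMap.fourier_coe, Real.fourier_eq]
  simp

lemma pderivS_eventuallyEq {f : 𝓢(Euc (Fin d), ℂ)} {c : ℂ} {x : Euc (Fin d)}
    (h : f =ᶠ[𝓝 x] fun _ => c) (i : Fin d) : pderivS i f =ᶠ[𝓝 x] fun _ => 0 := by
  filter_upwards [h.eventuallyEq_nhds] with y hy
  rw [pderivS_apply, hy.fderiv_eq]
  simp

/-- Multiplication by a coordinate becomes a derivative of the transform, and a function constant
near the origin has derivative zero near the origin. -/
lemma fourierS_foldr_coordMul_eventuallyEq {ψ : 𝓢(Euc (Fin d), ℂ)} {c : ℂ}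
    (h : fourierS ψ =ᶠ[𝓝 0] fun _ => c) (L : List (Fin d)) :
    ∃ c', (L ≠ [] → c' = 0) ∧ fourierS (L.foldr coordMul ψ) =ᶠ[𝓝 0] fun _ => c' := by
  induction L with
  | nil => exact ⟨c, by simp, h⟩
  | cons i L ih =>
    obtain ⟨c', -, h'⟩ := ih
    refine ⟨0, fun _ => rfl, ?_⟩
    have h2 := pderivS_eventuallyEq h' i
    rw [pderivS_fourierS] at h2
    filter_upwards [h2] with y hy
    rw [smul_apply, smul_eq_mul] at hy
    refine (mul_eq_zero.1 hy).resolve_left ?_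
    simp [Real.pi_ne_zero]

/-- There are Schwartz functions of integral one all of whose other moments vanish. -/
theorem exists_momentsVanish (d : ℕ) :
    ∃ θ : 𝓢(Euc (Fin d), ℂ), ∫ x, θ x = 1 ∧ MomentsVanish θ := by
  let b : ContDiffBump (0 : Euc (Fin d)) := ⟨1, 2, one_pos, one_lt_two⟩
  have hs : HasCompactSupport fun x => (b x : ℂ) :=
    b.hasCompactSupport.comp_left (g := fun r : ℝ => (r : ℂ)) Complex.ofReal_zero
  have hc : ContDiff ℝ ∞ fun x => (b x : ℂ) := Complex.ofRealCLM.contDiff.comp b.contDiff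
  -- θ is the inverse transform of a bump equal to one near the origin: the value there is the
  -- integral of θ, and the vanishing derivatives there give the other moments.
  obtain ⟨θ, hθ⟩ := exists_fourierS_eq (hs.toSchwartzMap hc)
  have h1 : fourierS θ =ᶠ[𝓝 0] fun _ => 1 := by
    rw [hθ]
    filter_upwards [b.eventuallyEq_one] with y hy
    change (b y : ℂ) = 1
    rw [hy]
    simp
  refine ⟨θ, ?_, fun L hL => ?_⟩
  · rw [← fourierS_apply_zero]
    exact h1.self_of_nhds
  · obtain ⟨c', hc', h⟩ := fourierS_foldr_coordMul_eventuallyEq h1 L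
    rw [← fourierS_apply_zero, h.self_of_nhds]
    exact hc' hL

end Existence

/-! ### Elementary facts on orders of nets -/

section BigO

lemma BigO.of_le {a : Param → ℝ≥0∞} {t C : ℝ} (hC : 0 ≤ C)
    (h : ∀ ε : Param, a ε ≤ ENNReal.ofReal (C * (ε : ℝ) ^ t)) : BigO a t :=
  ⟨C.toNNReal, .of_forall fun ε => (h ε).trans_eq (ENNReal.ofReal_mul hC)⟩

lemma BigO.eventually_ne_top {a : Param → ℝ≥0∞} {t : ℝ} (h : BigO a t) :
    ∀ᶠ ε in toZero, a ε ≠ ⊤ := by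
  obtain ⟨C, hC⟩ := h
  filter_upwards [hC] with ε hε
  exact (hε.trans_lt (ENNReal.mul_lt_top ENNReal.coe_lt_top ENNReal.ofReal_lt_top)).ne

end BigO

/-! ### Generalized kernels and independence of representatives -/

section KernelNets

variable {m n : ℕ} {ι : Type} [Fintype ι]

lemma BigO.kernelIntegral {K : Param → OM (Fin m ⊕ Fin n)} {f : Param → 𝓢(Euc (Fin n), ℂ)}
    {q l : ℕ} {t t' : ℝ} (hK : BigO (fun ε => mu (-(q : ℤ)) l (K ε)) t)
    (hf : BigO (fun ε => mu ((q + n + 1 : ℕ) : ℤ) ((0 : ℕ) : ℝ≥0) (f ε)) t') :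
    BigO (fun ε => mu (-(q : ℤ)) l ((K ε).kernelIntegral (f ε))) (t + t') :=
  ((hK.const_mul (weightConst n)).mul hf).mono le_rfl (hK.eventually_ne_top.mono fun ε h => by
    have := mu_kernelIntegral_le (f ε) (K ε) h
    rwa [← Nat.cast_zero] at this)

/-- The net of the integrals of `f_ε` against the kernels `K_ε`. -/
def kernelNet (K : Param → OM (Fin m ⊕ Fin n)) (f : Param → 𝓢(Euc (Fin n), ℂ)) (ε : Param) :
    OM (Fin m) := (K ε).kernelIntegral (f ε)

lemma kernelNet_mem_Etau {K : Param → OM (Fin m ⊕ Fin n)} (hK : K ∈ Etau (Fin m ⊕ Fin n))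
    {f : Param → 𝓢(Euc (Fin n), ℂ)} (hf : f ∈ ES (Fin n)) : kernelNet K f ∈ Etau (Fin m) := by
  intro l
  obtain ⟨q, N, hN⟩ := hK l
  obtain ⟨N', hN'⟩ := hf (q + n + 1) 0
  exact ⟨q, N + N', (hN.kernelIntegral hN').mono (by push_cast; linarith) (.of_forall fun _ => le_rfl)⟩

lemma kernelNet_mem_Ntau_left {K : Param → OM (Fin m ⊕ Fin n)} (hK : K ∈ Ntau (Fin m ⊕ Fin n))
    {f : Param → 𝓢(Euc (Fin n), ℂ)} (hf : f ∈ ES (Fin n)) : kernelNet K f ∈ Ntau (Fin m) := by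
  intro l
  obtain ⟨q, hK⟩ := hK l
  obtain ⟨N, hN⟩ := hf (q + n + 1) 0
  exact ⟨q, fun p => ((hK (p + N)).kernelIntegral hN).mono (by push_cast; linarith)
    (.of_forall fun _ => le_rfl)⟩

lemma kernelNet_mem_Ntau_right {K : Param → OM (Fin m ⊕ Fin n)} (hK : K ∈ Etau (Fin m ⊕ Fin n))
    {f : Param → 𝓢(Euc (Fin n), ℂ)} (hf : f ∈ NS (Fin n)) : kernelNet K f ∈ Ntau (Fin m) := by
  intro l
  obtain ⟨q, N, hN⟩ := hK l
  exact ⟨q, fun p => (hN.kernelIntegral (hf (q + n + 1) 0 (p + N))).mono (by push_cast; linarith)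
    (.of_forall fun _ => le_rfl)⟩

lemma kernelNet_sub_left (K K' : Param → OM (Fin m ⊕ Fin n)) (f : Param → 𝓢(Euc (Fin n), ℂ)) :
    kernelNet (K - K') f = kernelNet K f - kernelNet K' f := by
  funext ε
  refine OM.ext fun x => ?_
  refine Eq.trans ?_ (integral_sub ((K ε).integrable_kernel (f ε) x)
    ((K' ε).integrable_kernel (f ε) x))
  exact integral_congr_ae (.of_forall fun y => sub_mul _ _ _)

lemma kernelNet_sub_right (K : Param → OM (Fin m ⊕ Fin n)) (f g : Param → 𝓢(Euc (Fin n), ℂ)) :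
    kernelNet K (f - g) = kernelNet K f - kernelNet K g := by
  funext ε
  refine OM.ext fun x => ?_
  refine Eq.trans ?_ (integral_sub ((K ε).integrable_kernel (f ε) x)
    ((K ε).integrable_kernel (g ε) x))
  exact integral_congr_ae (.of_forall fun y => mul_sub _ _ _)

lemma clsTau_eq_iff {u v : Etau ι} : clsTau u = clsTau v ↔ u.1 - v.1 ∈ Ntau ι :=
  Submodule.Quotient.eq _

lemma clsS_eq_iff {f g : ES ι} : clsS f = clsS g ↔ f.1 - g.1 ∈ NS ι :=
  Submodule.Quotient.eq _

/-- It suffices to check the kernel property on slow representatives. -/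
lemma isKernelOn_of_sub_mem {a : ℝ≥0∞} (H : Etau (Fin m ⊕ Fin n))
    (L : Param → 𝓢(Euc (Fin n), ℂ) →L[ℂ] OM (Fin m)) (hL : IsModerate L)
    (h : ∀ f : ES (Fin n),
      (∃ N ∈ slow a, ∀ q l : ℕ, BigO (fun ε => mu q l (f.1 ε)) (-(N l : ℝ))) →
        netMap L f.1 - kernelNet H.1 f.1 ∈ Ntau (Fin m)) :
    IsKernelOn a (clsTau H) (extension L hL) := by
  rintro _ ⟨f₀, rfl, hN⟩ K hK f hf
  refine ⟨⟨kernelNet K.1 f.1, kernelNet_mem_Etau K.2 f.2⟩, fun _ _ => rfl, ?_⟩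
  rw [extension_clsS, clsTau_eq_iff]
  have h1 := h f₀ hN
  have h2 := kernelNet_mem_Ntau_right H.2 (clsS_eq_iff.1 hf)
  have h3 := kernelNet_mem_Ntau_left (clsTau_eq_iff.1 hK) f.2
  rw [kernelNet_sub_right] at h2
  rw [kernelNet_sub_left] at h3
  have h4 := (Ntau (Fin m)).sub_mem ((Ntau (Fin m)).sub_mem h1 h2) h3
  have h5 : netMap L f₀.1 - kernelNet H.1 f₀.1 - (kernelNet H.1 f.1 - kernelNet H.1 f₀.1)
      - (kernelNet K.1 f.1 - kernelNet H.1 f.1) = netMap L f₀.1 - kernelNet K.1 f.1 := by abel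
  rwa [h5] at h4

end KernelNets

/-! ### The net of regularized kernels -/

section RegularizedKernel

variable {m n d : ℕ}

/-- The Schwartz function `φ` at scale `ε^s`. -/
def scaleNet (φ : 𝓢(Euc (Fin d), ℂ)) (s : ℝ) (ε : Param) : 𝓢(Euc (Fin d), ℂ) :=
  rescale φ ((ε : ℝ) ^ s) (Real.rpow_pos_of_pos ε.2.1 s)

lemma bigO_mu_scaleNet (q l : ℕ) (φ : 𝓢(Euc (Fin d), ℂ)) {s : ℝ} (hs : 0 ≤ s) :
    BigO (fun ε => mu q l (scaleNet φ s ε)) (-(s * (d + l : ℕ))) :=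
  .of_le (C := (mu q l φ).toReal) ENNReal.toReal_nonneg fun ε => by
    rw [mul_comm, ← inv_rpow_pow]
    exact mu_rescale_le q l φ (Real.rpow_pos_of_pos ε.2.1 s) (rpow_le_one_of_param hs ε)

variable {Lam : 𝓢(Euc (Fin n), ℂ) →L[ℂ] 𝓢'(Euc (Fin m), ℂ)} {C : ℝ} {q l q' l' : ℕ}

/-- The net of the kernels `(x, y) ↦ Λ(θ_{ε^t}(y - ·))(φ_{ε^s}(x - ·))`. -/
def regKernelNet (hC : 0 ≤ C)
    (h : ∀ (f : 𝓢(Euc (Fin n), ℂ)) (g : 𝓢(Euc (Fin m), ℂ)),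
      ‖Lam f g‖ ≤ C * (mu q l f).toReal * (mu q' l' g).toReal)
    (θ : 𝓢(Euc (Fin n), ℂ)) (φ : 𝓢(Euc (Fin m), ℂ)) (t s : ℝ) (ε : Param) : OM (Fin m ⊕ Fin n) :=
  OM.mk (regKernel Lam (scaleNet θ t ε, scaleNet φ s ε)) (contDiff_regKernel h _)
    fun k => ⟨q + q', (mu_regKernel_le hC h _ k).trans_lt ENNReal.ofReal_lt_top⟩

lemma regKernelNet_mem_Etau (hC : 0 ≤ C)
    (h : ∀ (f : 𝓢(Euc (Fin n), ℂ)) (g : 𝓢(Euc (Fin m), ℂ)),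
      ‖Lam f g‖ ≤ C * (mu q l f).toReal * (mu q' l' g).toReal)
    (θ : 𝓢(Euc (Fin n), ℂ)) (φ : 𝓢(Euc (Fin m), ℂ)) {t s : ℝ} (ht : 0 ≤ t) (hs : 0 ≤ s) :
    regKernelNet hC h θ φ t s ∈ Etau (Fin m ⊕ Fin n) := by
  intro k
  refine ⟨q + q', ⌈t * (n + (l + k) : ℕ) + s * (m + (l' + k) : ℕ)⌉₊, ?_⟩
  refine (((bigO_mu_scaleNet q (l + k) θ ht).const_mul C.toNNReal).mul
    (bigO_mu_scaleNet q' (l' + k) φ hs)).mono ?_ (.of_forall fun ε => ?_)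
  · rw [← neg_add]
    exact neg_le_neg (Nat.le_ceil _)
  · refine (mu_regKernel_le hC h _ k).trans_eq ?_
    rw [ENNReal.ofReal_mul (by positivity), ENNReal.ofReal_mul hC, ofReal_toReal_mu,
      ofReal_toReal_mu]
    rfl

/-- For fixed x the functional f ↦ Λ(f)(φ_{ε^s}(x - ·)) is bounded by μ_{q,l}, so it can be taken
out of the integral over y. -/
lemma kernelIntegral_regKernelNet (hC : 0 ≤ C)
    (h : ∀ (f : 𝓢(Euc (Fin n), ℂ)) (g : 𝓢(Euc (Fin m), ℂ)),
      ‖Lam f g‖ ≤ C * (mu q l f).toReal * (mu q' l' g).toReal)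
    (θ : 𝓢(Euc (Fin n), ℂ)) (φ : 𝓢(Euc (Fin m), ℂ)) (t s : ℝ) (ε : Param)
    (f : 𝓢(Euc (Fin n), ℂ)) :
    (regKernelNet hC h θ φ t s ε).kernelIntegral f
      = regNet Lam hC h φ s ε (reflConv (scaleNet θ t ε) f) := by
  refine OM.ext fun x => ?_
  set g := reflectAt (scaleNet φ s ε) x with hg
  let T : 𝓢(Euc (Fin n), ℂ) →ₗ[ℂ] ℂ :=
    { toFun := fun f => Lam f g
      map_add' := fun f f' => congrArg (fun u : 𝓢'(Euc (Fin m), ℂ) => u g) (map_add Lam f f')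
      map_smul' := fun c f => congrArg (fun u : 𝓢'(Euc (Fin m), ℂ) => u g) (map_smul Lam c f) }
  exact functional_reflConv (T := T) (C := C * (mu q' l' g).toReal) (q := q) (l := l)
    (fun f => (h f g).trans_eq (mul_right_comm _ _ _)) (scaleNet θ t ε) f

end RegularizedKernel

/-! ### Slow growth against the gain of mollification -/

section Slow

/-- Here a ≤ 1 enters: for a > 0 the strict inequality lim sup N(j)/j < a leaves room for some c <
1, and for a = 0 any positive c will do. -/
lemma exists_eventually_le_mul {a : ℝ≥0∞} (ha : a ≤ 1) {N : ℕ → ℝ≥0} (hN : N ∈ slow a) :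
    ∃ c : ℝ≥0, c < 1 ∧ ∀ᶠ j : ℕ in atTop, N j ≤ c * j := by
  have key : ∃ c : ℝ≥0, c < 1 ∧ ∀ᶠ j : ℕ in atTop, N j / (j : ℝ≥0) < c := by
    rcases hN with ⟨-, h⟩ | ⟨-, h⟩
    · exact ⟨1 / 2, NNReal.half_lt_self one_ne_zero, h.eventually_lt_const (by norm_num)⟩
    · obtain ⟨c, hc, hc'⟩ := ENNReal.lt_iff_exists_nnreal_btwn.1 h
      refine ⟨c, by exact_mod_cast hc'.trans_le ha, ?_⟩
      filter_upwards [eventually_lt_of_limsup_lt hc] with j hj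
      exact_mod_cast hj
  obtain ⟨c, hc, h⟩ := key
  refine ⟨c, hc, ?_⟩
  filter_upwards [h, eventually_gt_atTop 0] with j hj hj0
  exact (div_le_iff₀ (by exact_mod_cast hj0)).1 hj.le

lemma exists_le_sub_of_mem_slow {a : ℝ≥0∞} (ha : a ≤ 1) {N : ℕ → ℝ≥0} (hN : N ∈ slow a)
    (l p : ℕ) : ∃ k : ℕ, (p : ℝ) ≤ k - N (k + l) := by
  obtain ⟨c, hc, h⟩ := exists_eventually_le_mul ha hN
  obtain ⟨j, hj⟩ := eventually_atTop.1 h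
  have hc' : (0 : ℝ) < 1 - c := sub_pos.2 (by exact_mod_cast hc)
  -- One has k - N(k + l) ≥ (1 - c)k - cl once k + l is in the range of the linear bound, and the
  -- ceiling makes the right side at least p.
  refine ⟨max j ⌈(p + c * l) / (1 - c : ℝ)⌉₊, ?_⟩
  set k := max j ⌈(p + c * l) / (1 - c : ℝ)⌉₊
  have h1 : (N (k + l) : ℝ) ≤ c * (k + l : ℕ) := by
    exact_mod_cast hj (k + l) ((le_max_left _ _).trans (Nat.le_add_right _ _))
  have h2 : (p + c * l) / (1 - c : ℝ) ≤ k :=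
    (Nat.le_ceil _).trans (by exact_mod_cast le_max_right _ _)
  rw [div_le_iff₀ hc'] at h2
  push_cast at h1
  linarith

variable {d : ℕ}

/-- A slow net is reproduced by mollification at scale `ε`, up to a negligible net. -/
lemma reflConv_sub_mem_NS {a : ℝ≥0∞} (ha : a ≤ 1) {N : ℕ → ℝ≥0} (hN : N ∈ slow a)
    {f : Param → 𝓢(Euc (Fin d), ℂ)}
    (hf : ∀ q l : ℕ, BigO (fun ε => mu q l (f ε)) (-(N l : ℝ)))
    {θ : 𝓢(Euc (Fin d), ℂ)} (h1 : ∫ x, θ x = 1) (hθ : MomentsVanish θ) :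
    (fun ε => reflConv (scaleNet θ 1 ε) (f ε) - f ε) ∈ NS (Fin d) := by
  intro q l p
  -- Mollification gains ε^k, and the k + l derivatives of f_ε cost ε^{-N(k+l)}; k is chosen so that
  -- the gain wins by ε^p.
  obtain ⟨k, hk⟩ := exists_le_sub_of_mem_slow ha hN l p
  obtain ⟨C, hC, h⟩ := exists_mu_reflConv_sub_le h1 hθ k q
  have h2 : BigO (fun ε : Param => ENNReal.ofReal (C * (ε : ℝ) ^ (k : ℝ))) k :=
    .of_le hC fun _ => le_rfl
  refine (h2.mul (hf q (k + l))).mono (by linarith) (.of_forall fun ε => ?_)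
  refine (h l (f ε) _ (Real.rpow_pos_of_pos ε.2.1 1)
    (rpow_le_one_of_param zero_le_one ε)).trans_eq ?_
  have hε := ε.2.1.le
  rw [Real.rpow_one, Real.rpow_natCast, ENNReal.ofReal_mul (by positivity), ofReal_toReal_mu]

end Slow

/-! ### Equality in the generalized distribution sense -/

section GeneralizedDistribution

variable {d : ℕ}

lemma OM.integrable_mul (u : OM (Fin d)) (g : 𝓢(Euc (Fin d), ℂ)) :
    Integrable fun x => u x * g x := by
  obtain ⟨B, -, q, h⟩ := u.exists_norm_le
  exact integrable_mul_schwartz u.contDiff.continuous h g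

lemma isBigO_integral_of_mem_Ntau {u : Param → OM (Fin d)} (hu : u ∈ Ntau (Fin d))
    (g : 𝓢(Euc (Fin d), ℂ)) (p : ℕ) :
    (fun ε => ∫ x, u ε x * g x) =O[toZero] fun ε : Param => (ε : ℝ) ^ p := by
  obtain ⟨q, h⟩ := hu 0
  obtain ⟨C, hC⟩ := h p
  refine Asymptotics.IsBigO.of_bound (C * ∫ x, (1 + ‖x‖) ^ q * ‖g x‖) ?_
  filter_upwards [hC] with ε hε
  have hε0 := ε.2.1.le
  rw [Real.rpow_natCast, ← ENNReal.ofReal_coe_nnreal,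
    ← ENNReal.ofReal_mul NNReal.zero_le_coe] at hε
  have hb : ∀ x, ‖u ε x‖ ≤ (C * (ε : ℝ) ^ p) * (1 + ‖x‖) ^ q := fun x => by
    have h := weighted_le_of_mu_le (by positivity) hε (k := 0) (by simp) Fin.elim0 x
    rwa [partialD_zero, zpow_neg_mul_le_iff (by positivity)] at h
  refine (norm_integral_mul_schwartz_le hb g).trans_eq ?_
  rw [Real.norm_of_nonneg (by positivity)]
  ring

variable {m n : ℕ} {Lam : 𝓢(Euc (Fin n), ℂ) →L[ℂ] 𝓢'(Euc (Fin m), ℂ)} {C : ℝ} {q l q' l' : ℕ}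

lemma integral_regNet_mul (hC : 0 ≤ C)
    (h : ∀ (f : 𝓢(Euc (Fin n), ℂ)) (g : 𝓢(Euc (Fin m), ℂ)),
      ‖Lam f g‖ ≤ C * (mu q l f).toReal * (mu q' l' g).toReal)
    (φ : 𝓢(Euc (Fin m), ℂ)) (s : ℝ) (ε : Param) (f : 𝓢(Euc (Fin n), ℂ))
    (g : 𝓢(Euc (Fin m), ℂ)) :
    ∫ x, regNet Lam hC h φ s ε f x * g x = Lam f (reflConv (scaleNet φ s ε) g) :=
  functional_reflConv (T := (Lam f).toLinearMap) (h f) (scaleNet φ s ε) g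

lemma isBigO_sub_integral_regNet (hC : 0 ≤ C)
    (h : ∀ (f : 𝓢(Euc (Fin n), ℂ)) (g : 𝓢(Euc (Fin m), ℂ)),
      ‖Lam f g‖ ≤ C * (mu q l f).toReal * (mu q' l' g).toReal)
    {φ : 𝓢(Euc (Fin m), ℂ)} (hφ : IsMollifier φ) {s : ℝ} (hs : 0 < s) (f : 𝓢(Euc (Fin n), ℂ))
    (g : 𝓢(Euc (Fin m), ℂ)) (p : ℕ) :
    (fun ε => Lam f g - ∫ x, regNet Lam hC h φ s ε f x * g x)
      =O[toZero] fun ε : Param => (ε : ℝ) ^ p := by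
  -- The mollifier passes from Λ(f) to g at scale ε^s, so ⌈p/s⌉ steps of approximation give at least
  -- ε^p.
  obtain ⟨D, hD, hb⟩ := exists_mu_reflConv_sub_le hφ.1 hφ.momentsVanish ⌈p / s⌉₊ q'
  refine Asymptotics.IsBigO.of_bound (C * (mu q l f).toReal *
    (D * (mu q' ((⌈p / s⌉₊ + l' : ℕ) : ℝ≥0) g).toReal)) (.of_forall fun ε => ?_)
  have hε := ε.2.1.le
  rw [integral_regNet_mul, ← norm_neg, neg_sub, ← map_sub, Real.norm_of_nonneg (by positivity)]
  refine (h f _).trans ?_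
  rw [mul_assoc (C * (mu q l f).toReal)]
  refine mul_le_mul_of_nonneg_left ?_ (by positivity)
  have hδ := Real.rpow_pos_of_pos ε.2.1 s
  refine (ENNReal.toReal_le_of_le_ofReal (by positivity)
    (hb l' g _ hδ (rpow_le_one_of_param hs.le ε))).trans ?_
  rw [mul_right_comm]
  refine mul_le_mul_of_nonneg_left ?_ (by positivity)
  rw [← Real.rpow_natCast, ← Real.rpow_mul hε, ← Real.rpow_natCast]
  refine Real.rpow_le_rpow_of_exponent_ge ε.2.1 ε.2.2 ?_
  have := Nat.le_ceil (p / s)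
  rwa [div_le_iff₀ hs, mul_comm] at this

lemma bigO_const (c : ℝ≥0∞) (hc : c ≠ ⊤) : BigO (fun _ => c) 0 :=
  .of_le (C := c.toReal) ENNReal.toReal_nonneg fun ε => by simp [hc]

lemma const_mem_ES (f : 𝓢(Euc (Fin d), ℂ)) : (fun _ => f) ∈ ES (Fin d) := fun q l =>
  ⟨0, by simpa using bigO_const _ (mu_ne_top q l f)⟩

lemma clsS_const_mem_GSslow (f : 𝓢(Euc (Fin d), ℂ)) (a : ℝ≥0∞) :
    clsS ⟨fun _ => f, const_mem_ES f⟩ ∈ GSslow (Fin d) a :=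
  ⟨_, rfl, fun _ => 0, const_mem_slow 0 a, fun q l => by
    simpa using bigO_const _ (mu_ne_top q l f)⟩

/-- A constant net has growth exponent 0, so the kernel property applies to it for every a. The
error splits into that of regularizing Λ(f) and the integral against g of the negligible net by
which L_ε f differs from the kernel integral. -/
lemma IsKernelOn.eqGD {hC : 0 ≤ C}
    {h : ∀ (f : 𝓢(Euc (Fin n), ℂ)) (g : 𝓢(Euc (Fin m), ℂ)),
      ‖Lam f g‖ ≤ C * (mu q l f).toReal * (mu q' l' g).toReal}
    {φ : 𝓢(Euc (Fin m), ℂ)} {s : ℝ} {hL : IsModerate (regNet Lam hC h φ s)} {a : ℝ≥0∞}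
    {H : Gtau (Fin m ⊕ Fin n)} (hH : IsKernelOn a H (extension (regNet Lam hC h φ s) hL))
    (hφ : IsMollifier φ) (hs : 0 < s) (f : 𝓢(Euc (Fin n), ℂ)) : EqGD (Lam f) H f := by
  intro K hK g p
  obtain ⟨u, hu, hTu⟩ := hH _ (clsS_const_mem_GSslow f a) K hK _ rfl
  rw [extension_clsS, clsTau_eq_iff] at hTu
  have h1 := (isBigO_sub_integral_regNet hC h hφ hs f g p).add
    (isBigO_integral_of_mem_Ntau hTu g p)
  refine h1.congr_left fun ε => ?_
  have h2 : ∫ x, ((regNet Lam hC h φ s ε f : Euc (Fin m) → ℂ) x - u.1 ε x) * g x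
      = (∫ x, regNet Lam hC h φ s ε f x * g x) - ∫ x, u.1 ε x * g x := by
    rw [← integral_sub (OM.integrable_mul _ g) (OM.integrable_mul _ g)]
    simp only [sub_mul]
  have h3 : ∫ x, u.1 ε x * g x = ∫ x, (∫ y, K.1 ε (pair x y) * f y) * g x := by
    simp only [hu]
  rw [← h3]
  refine (congrArg (_ + ·) h2).trans ?_
  ring

/-- The kernel integral is L_ε of the mollified net. Mollification changes a slow net by a
negligible one, and L_ε preserves negligibility. -/
lemma isKernelOn_regKernelNet (hC : 0 ≤ C)
    (h : ∀ (f : 𝓢(Euc (Fin n), ℂ)) (g : 𝓢(Euc (Fin m), ℂ)),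
      ‖Lam f g‖ ≤ C * (mu q l f).toReal * (mu q' l' g).toReal)
    {θ : 𝓢(Euc (Fin n), ℂ)} (h1 : ∫ x, θ x = 1) (hθ : MomentsVanish θ)
    (φ : 𝓢(Euc (Fin m), ℂ)) {s : ℝ} (hs : 0 ≤ s) (hL : IsModerate (regNet Lam hC h φ s))
    {a : ℝ≥0∞} (ha : a ≤ 1) :
    IsKernelOn a (clsTau ⟨_, regKernelNet_mem_Etau hC h θ φ zero_le_one hs⟩)
      (extension (regNet Lam hC h φ s) hL) := by
  refine isKernelOn_of_sub_mem _ _ hL ?_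
  rintro f ⟨N, hN, hf⟩
  have h2 := (Ntau (Fin m)).neg_mem
    (netMap_mem_Ntau hL _ (reflConv_sub_mem_NS ha hN hf h1 hθ))
  refine (congrArg (· ∈ Ntau (Fin m)) ?_).mp h2
  funext ε
  have h3 : kernelNet (regKernelNet hC h θ φ 1 s) f.1 ε
      = regNet Lam hC h φ s ε (reflConv (scaleNet θ 1 ε) (f.1 ε)) :=
    kernelIntegral_regKernelNet hC h θ φ 1 s ε (f.1 ε)
  have h4 : netMap (regNet Lam hC h φ s) (fun ε => reflConv (scaleNet θ 1 ε) (f.1 ε) - f.1 ε) ε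
      = regNet Lam hC h φ s ε (reflConv (scaleNet θ 1 ε) (f.1 ε))
        - regNet Lam hC h φ s ε (f.1 ε) := map_sub (regNet Lam hC h φ s ε) _ _
  rw [Pi.neg_apply, Pi.sub_apply, h3, h4, neg_sub]
  rfl

end GeneralizedDistribution

end Colombeau

end

/-! ### The proposition -/

open Colombeau in
theorem proposition4p7 (m n : ℕ) (hm : 0 < m) (hn : 0 < n)
    (Lam : 𝓢(Euc (Fin n), ℂ) →L[ℂ] 𝓢'(Euc (Fin m), ℂ))
    (φ : 𝓢(Euc (Fin m), ℂ)) (hφ : IsMollifier φ) (s : ℝ) (hs0 : 0 < s) (hs1 : s < 1) :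
    ∃ L : Param → 𝓢(Euc (Fin n), ℂ) →L[ℂ] OM (Fin m),
      (∀ (ε : Param) (f : 𝓢(Euc (Fin n), ℂ)) (x : Euc (Fin m)), L ε f x =
        conv (Lam f) (rescale φ ((ε : ℝ) ^ s) (Real.rpow_pos_of_pos ε.2.1 s)) x) ∧
      IsStronglyModerateOver (slow 0) (slowLE (ENNReal.ofReal s)) L ∧
      (∀ c : ℝ, s < c → IsStronglyModerate 0 (ENNReal.ofReal c) L) ∧
      ∃ hL : IsModerate L,
        (∃ H : Gtau (Fin m ⊕ Fin n), ∀ a : ℝ≥0∞, a ≤ 1 → IsKernelOn a H (extension L hL)) ∧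
        (∀ H : Gtau (Fin m ⊕ Fin n), ∀ a : ℝ≥0∞, a ≤ 1 → IsKernelOn a H (extension L hL) →
          ∀ f : 𝓢(Euc (Fin n), ℂ), EqGD (Lam f) H f) := by
  obtain ⟨C, hC, q, l, q', l', h⟩ := exists_joint_bound Lam
  -- θ lives on ℝⁿ and is unrelated to φ; it depends neither on ε nor on a, so one kernel serves all
  -- a ≤ 1.
  obtain ⟨θ, h1, hθ⟩ := exists_momentsVanish n
  have hstrong := isStronglyModerateOver_regNet Lam hC h φ hs0.le
  refine ⟨regNet Lam hC h φ s, fun _ _ _ => rfl, hstrong, fun c hc => ?_, hstrong.isModerate,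
    ⟨_, fun a ha => isKernelOn_regKernelNet hC h h1 hθ φ hs0.le _ ha⟩,
    fun H a _ hH f => hH.eqGD hφ hs0 f⟩
  obtain ⟨lam, hlam, r, hr, hb⟩ := hstrong
  exact ⟨lam, hlam, r, slowLE_subset_slow
    ((ENNReal.ofReal_lt_ofReal_iff (hs0.trans hc)).2 hc) hr, hb⟩
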